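/- **Setting.** Let $a,b,c>0$ with $b^2=27ac$, let $\mathcal Q$ be the space of symmetric traceless real $3\times3$ matrices with the Frobenius norm, and set $$F(q)=\tfrac a2\operatorname{tr}q^2-\tfrac b3\operatorname{tr}q^3+\tfrac c4(\operatorname{tr}q^2)^2,\quad F_\varepsilon=F+\varepsilon^3,\quad f(s)=\tfrac{s^2}{27}(9a-2bs+3cs^2),$$ $$s_+=\frac{b+\sqrt{b^2-24ac}}{4c},\quad \sigma=\tfrac{2}{\sqrt3}\int_0^{s_+}\!\sqrt{f(\tau)}\,d\tau,\quad \mathcal N=\{s_+(e\otimes e-\tfrac13I_3): e\in\mathbb S^2\}.$$ Let $d^F(q)=\inf\int_0^1\sqrt{2F(\gamma)}\,|\gamma'|\,dt$ over Lipschitz curves $\gamma:[0,1]\to\mathcal Q$ with $\gamma(0)\in\mathcal N$, $\gamma(1)=q$. For a smooth nonnegative $\eta:\mathcal Q\to\mathbb R$ with integral $1$, supported in the open unit ball and isotropic ($\eta(M^\top qM)=\eta(q)$ for $M\in O(3)$), let $d^F_\varepsilon=\eta_\varepsilon*d^F$ with $\eta_\varepsilon(q)=\varepsilon^{-20}\eta(\varepsilon^{-4}q)$.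 Let $\Omega\subset\mathbb R^3$ be a smooth bounded domain, $\Omega^+$ a smooth simply connected domain with $\overline{\Omega^+}\subset\Omega$, $\Gamma_0=\partial\Omega^+$, $\Omega^-=\Omega\setminus\overline{\Omega^+}$. Let $d_\Gamma$ be the signed distance to $\Gamma_0$, positive in $\Omega^+$ and negative in $\Omega^-$, and $\Gamma_0(r)=\{y\in\Omega:\operatorname{dist}(y,\Gamma_0)<r\}$. Let $\delta>0$ be such that $\operatorname{dist}(\Gamma_0,\partial\Omega)\ge3\delta$ and $d_\Gamma$ is smooth in $\Gamma_0(3\delta)$. Let $\phi:\mathbb R\to[0,\infty)$ be smooth, even, nonincreasing on $[0,1]$, positive for $|x|<1$, zero for $|x|\ge1$, with $1-4x^2\le\phi(x)\le1-\frac12x^2$ for $|x|\le\frac12$, and let $\boldsymbol\xi=-\phi(d_\Gamma/\delta)\nabla d_\Gamma$, so that on $\Gamma_0$ it is the unit normal pointing into $\Omega^-$. Let $\vartheta(r)=-r$ for $|r|\le\delta$, $\vartheta(r)=-\delta$ for $r\ge\delta$, $\vartheta(r)=\delta$ for $r\le-\delta$. For $Q:\Omega\to\mathcal Q$ put $\psi_\varepsilon=d^F_\varepsilon\circ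 Q$ and $$E[v_\varepsilon,Q\,|\,v]=\int_\Omega\tfrac12|v_\varepsilon-v|^2dx+\int_\Omega\Big(\tfrac\varepsilon2|\nabla Q|^2+\tfrac1\varepsilon F_\varepsilon(Q)-\boldsymbol\xi\cdot\nabla\psi_\varepsilon\Big)dx,\qquad E_{\rm vol}[Q]=\int_\Omega(\sigma\chi_{\Omega^-}-\psi_\varepsilon)\,\vartheta(d_\Gamma)\,dx .$$ Let $\tilde\zeta:\mathbb R\to[0,1]$ be smooth with $\tilde\zeta=1$ on $|s|\le\frac12$ and $\tilde\zeta=0$ on $|s|\ge1$, let $S(z)=\frac{s_+}2\big(1+\tanh(\frac{\sqrt a}2z)\big)$ and $$\tilde S_\varepsilon=\tilde\zeta\big(\tfrac{d_\Gamma}\delta\big)S\big(\tfrac{d_\Gamma}\varepsilon\big)+\Big(1-\tilde\zeta\big(\tfrac{d_\Gamma}\delta\big)\Big)s_+\chi_{\Omega^+}.$$ **Proposition.** For $u_0\in H^1(\Omega;\mathbb S^2)$ and $0<\varepsilon\le1$ let $Q_{0,\varepsilon}=\tilde S_\varepsilon\,(u_0\otimes u_0-\frac13I_3)$. Then $Q_{0,\varepsilon}\in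 H^1(\Omega;\mathcal Q)\cap L^\infty(\Omega;\mathcal Q)$ and $$Q_{0,\varepsilon}=\begin{cases}s_+(u_0\otimes u_0-\frac13I_3)&\text{in }\Omega^+\setminus\Gamma_0(\delta),\\ S(d_\Gamma/\varepsilon)(u_0\otimes u_0-\frac13I_3)&\text{in }\Gamma_0(\delta/2),\\ 0&\text{in }\Omega^-\setminus\Gamma_0(\delta).\end{cases}$$ Moreover $\psi_\varepsilon=d^F_\varepsilon\circ Q_{0,\varepsilon}\in H^1(\Omega)$, the integrands depending on $Q_{0,\varepsilon}$ in $E$ and $E_{\rm vol}$ are integrable, and for every $M$ there is $C_0>0$, depending only on $M$ and on the fixed data $a,b,c,\Omega,\Omega^+,\delta,\phi,\tilde\zeta$ (not on $\varepsilon$, $\eta$, or on $u_0$ otherwise), such that whenever $\|u_0\|_{H^1(\Omega)}\le M$, $0<\varepsilon\le 1$, and the initial velocities $v_{0,\varepsilon},v_0\in L^2(\Omega;\mathbb R^3)$ satisfy $\frac12\int_\Omega|v_{0,\varepsilon}-v_0|^2dx\le K\varepsilon$ for some $K$, $$E[v_{0,\varepsilon},Q_{0,\varepsilon}\,|\,v_0]+E_{\rm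 vol}[Q_{0,\varepsilon}]\le (C_0+K)\,\varepsilon ;$$ in particular the left side is at most $C_0\varepsilon$ if $v_{0,\varepsilon}=v_0$. -/

import Mathlib

open MeasureTheory Set Metric
open scoped ContDiff

noncomputable section

namespace BerisEdwards

abbrev Vec3 := EuclideanSpace ℝ (Fin 3)

/-- The unit sphere of three-dimensional space. -/
abbrev S2 := Metric.sphere (0 : Vec3) 1

/-! ### Symmetric traceless matrices -/

/-- Symmetric traceless real `3 × 3` matrices, as a subspace of the matrices with the Frobenius
inner product. -/
def symTraceless : Submodule ℝ (EuclideanSpace ℝ (Fin 3 × Fin 3)) where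
  carrier := {q | (∀ i j, q (i, j) = q (j, i)) ∧ ∑ i, q (i, i) = 0}
  add_mem' := by
    rintro p q ⟨hp, hp'⟩ ⟨hq, hq'⟩
    refine ⟨fun i j => ?_, ?_⟩
    · simp [hp i j, hq i j]
    · simp [Finset.sum_add_distrib, hp', hq']
  zero_mem' := by simp
  smul_mem' := by
    rintro c q ⟨hq, hq'⟩
    refine ⟨fun i j => ?_, ?_⟩
    · simp [hq i j]
    · simp [← Finset.mul_sum, hq']

/-- The five-dimensional space of Q-tensors. -/
abbrev QTensor := ↥symTraceless

/-- A Q-tensor as a matrix. -/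
def QTensor.mat (q : QTensor) : Matrix (Fin 3) (Fin 3) ℝ := Matrix.of fun i j => q.1 (i, j)

/-- Lebesgue measure on the Euclidean space of Q-tensors. -/
def qMeasure : Measure QTensor := (stdOrthonormalBasis ℝ QTensor).toBasis.addHaar

/-- The uniaxial tensor `e ⊗ e - I / 3`. -/
def director (e : S2) : QTensor :=
  ⟨WithLp.toLp 2 fun ij => e.1 ij.1 * e.1 ij.2 - if ij.1 = ij.2 then 1 / 3 else 0, by
    refine ⟨fun i j => ?_, ?_⟩
    · simp [mul_comm, eq_comm]
    · have h : ‖e.1‖ = 1 := by simp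
      have h2 := EuclideanSpace.real_norm_sq_eq e.1
      rw [h] at h2
      simp only [Fin.sum_univ_three] at h2 ⊢
      norm_num
      linarith⟩

/-! ### Bulk energy -/

/-- The bulk energy density `F`. -/
def bulkEnergy (a b c : ℝ) (q : QTensor) : ℝ :=
  a / 2 * (q.mat ^ 2).trace - b / 3 * (q.mat ^ 3).trace + c / 4 * ((q.mat ^ 2).trace) ^ 2

/-- The regularized bulk energy density `F_ε = F + ε ^ 3`. -/
def bulkEnergyReg (a b c ε : ℝ) (q : QTensor) : ℝ := bulkEnergy a b c q + ε ^ 3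

/-- The bulk energy `f (s)` of a uniaxial tensor of order `s`. -/
def uniaxialEnergy (a b c s : ℝ) : ℝ := s ^ 2 / 27 * (9 * a - 2 * b * s + 3 * c * s ^ 2)

/-- The equilibrium order parameter `s_+`. -/
def sPlus (a b c : ℝ) : ℝ := (b + √(b ^ 2 - 24 * a * c)) / (4 * c)

/-- The surface tension `σ`. -/
def surfaceTension (a b c : ℝ) : ℝ :=
  2 / √3 * ∫ τ in (0 : ℝ)..sPlus a b c, √(uniaxialEnergy a b c τ)

/-- The manifold of nematic minimizers of the bulk energy. -/
def nematic (a b c : ℝ) : Set QTensor := {q | ∃ e : S2, q = sPlus a b c • director e}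

/-- The quasi-distance `d^F` to the nematic manifold. -/
def quasiDist (a b c : ℝ) (q : QTensor) : ℝ :=
  sInf {L | ∃ γ : ℝ → QTensor, (∃ K, LipschitzOnWith K γ (Icc 0 1)) ∧
    γ 0 ∈ nematic a b c ∧ γ 1 = q ∧
    L = ∫ t in (0 : ℝ)..1, √(2 * bulkEnergy a b c (γ t)) * ‖deriv γ t‖}

/-- Smooth, nonnegative, isotropic mollifiers of unit mass, supported in the unit ball. -/
structure IsIsotropicMollifier (η : QTensor → ℝ) : Prop where
  smooth : ContDiff ℝ ∞ η
  nonneg : ∀ q, 0 ≤ η q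
  support : tsupport η ⊆ ball 0 1
  mass : ∫ q, η q ∂qMeasure = 1
  isotropic : ∀ M ∈ Matrix.orthogonalGroup (Fin 3) ℝ, ∀ p q : QTensor,
    q.mat = M.transpose * p.mat * M → η q = η p

/-- The mollified quasi-distance `d^F_ε = η_ε * d^F` with `η_ε (q) = ε ^ (-20) η (ε ^ (-4) q)`. -/
def quasiDistReg (a b c : ℝ) (η : QTensor → ℝ) (ε : ℝ) : QTensor → ℝ :=
  convolution (fun q => (ε ^ 20)⁻¹ * η ((ε ^ 4)⁻¹ • q)) (quasiDist a b c)
    (ContinuousLinearMap.mul ℝ ℝ) qMeasure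

/-! ### Weak derivatives and the space `H¹` -/

section Sobolev

variable {E : Type*} [NormedAddCommGroup E] [NormedSpace ℝ E]

/-- `G k` is the weak `k`-th partial derivative of `w` in the open set `Ω`, for all `k`. -/
structure IsWeakGradient (Ω : Set Vec3) (w : Vec3 → E) (G : Fin 3 → Vec3 → E) : Prop where
  locInt : LocallyIntegrableOn w Ω
  locInt_grad : ∀ k, LocallyIntegrableOn (G k) Ω
  byParts : ∀ k, ∀ φ : Vec3 → ℝ, ContDiff ℝ ∞ φ → HasCompactSupport φ → tsupport φ ⊆ Ω →
    ∫ x in Ω, fderiv ℝ φ x (EuclideanSpace.single k 1) • w x = -∫ x in Ω, φ x • G k x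

open Classical in
/-- The weak gradient (unique almost everywhere in `Ω`), and zero if there is none. -/
def weakGrad (Ω : Set Vec3) (w : Vec3 → E) : Fin 3 → Vec3 → E :=
  if h : ∃ G, IsWeakGradient Ω w G then h.choose else 0

/-- Membership in `H¹(Ω; E)`. -/
def MemH1 (Ω : Set Vec3) (w : Vec3 → E) : Prop :=
  MemLp w 2 (volume.restrict Ω) ∧
    ∃ G, IsWeakGradient Ω w G ∧ ∀ k, MemLp (G k) 2 (volume.restrict Ω)

/-- The `H¹(Ω; E)` norm. -/
def h1Norm (Ω : Set Vec3) (w : Vec3 → E) : ℝ :=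
  √((∫ x in Ω, ‖w x‖ ^ 2) + ∫ x in Ω, ∑ k, ‖weakGrad Ω w k x‖ ^ 2)

end Sobolev

/-! ### The initial interface -/

/-- `U` has smooth boundary and lies locally on one side of it. -/
def HasSmoothBoundary (U : Set Vec3) : Prop :=
  ∀ p ∈ frontier U, ∃ (V : Set Vec3) (ρ : Vec3 → ℝ), IsOpen V ∧ p ∈ V ∧ ContDiffOn ℝ ∞ ρ V ∧
    fderiv ℝ ρ p ≠ 0 ∧ U ∩ V = {x ∈ V | 0 < ρ x}

/-- The outer phase `Ω⁻`. -/
def outerPhase (Ω Ωp : Set Vec3) : Set Vec3 := Ω \ closure Ωp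

open Classical in
/-- The signed distance `d_Γ`, positive in `Ω⁺` and negative in `Ω⁻`. -/
def sdist (Ω Ωp : Set Vec3) (x : Vec3) : ℝ :=
  if x ∈ outerPhase Ω Ωp then -infDist x Ωp else infDist x (outerPhase Ω Ωp)

/-- The tube of radius `r` about the interface `Γ₀ = ∂Ω⁺`. -/
def tube (Ω Ωp : Set Vec3) (r : ℝ) : Set Vec3 := {y ∈ Ω | infDist y (frontier Ωp) < r}

/-- `Ω` is a smooth bounded domain, `Ω⁺` a smooth simply connected domain compactly contained in
it, and `δ` is a tubular width of the interface `Γ₀ = ∂Ω⁺`: the interface has distance at least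
`3δ` from `∂Ω`, and the signed distance is smooth in the tube of radius `3δ`. -/
structure IsInterface (Ω Ωp : Set Vec3) (δ : ℝ) : Prop where
  isOpen : IsOpen Ω
  connected : IsConnected Ω
  bounded : Bornology.IsBounded Ω
  smooth : HasSmoothBoundary Ω
  isOpen_plus : IsOpen Ωp
  simplyConnected_plus : SimplyConnectedSpace Ωp
  smooth_plus : HasSmoothBoundary Ωp
  closure_plus : closure Ωp ⊆ Ω
  δ_pos : 0 < δ
  dist_boundary : ∀ x ∈ frontier Ωp, ∀ y ∈ frontier Ω, 3 * δ ≤ dist x y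
  smooth_sdist : ContDiffOn ℝ ∞ (sdist Ω Ωp) (tube Ω Ωp (3 * δ))

/-! ### Relative energy and bulk error at a fixed time -/

/-- The cut-off in the definition of the calibration `ξ`. -/
structure IsCalibrationCutoff (φ : ℝ → ℝ) : Prop where
  smooth : ContDiff ℝ ∞ φ
  even : ∀ x, φ (-x) = φ x
  antitone : AntitoneOn φ (Icc 0 1)
  pos : ∀ x, |x| < 1 → 0 < φ x
  zero : ∀ x, 1 ≤ |x| → φ x = 0
  bounds : ∀ x, |x| ≤ 1 / 2 → 1 - 4 * x ^ 2 ≤ φ x ∧ φ x ≤ 1 - 1 / 2 * x ^ 2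

/-- The calibration: a cut-off extension of the unit normal of `Γ₀` that points into `Ω⁻`, the
side where `ψ_ε` is large. -/
def calibration (Ω Ωp : Set Vec3) (δ : ℝ) (φ : ℝ → ℝ) (x : Vec3) : Vec3 :=
  -(φ (sdist Ω Ωp x / δ) • gradient (sdist Ω Ωp) x)

/-- `ψ_ε = d^F_ε ∘ Q`. -/
def psi (a b c : ℝ) (η : QTensor → ℝ) (ε : ℝ) (Q : Vec3 → QTensor) (x : Vec3) : ℝ :=
  quasiDistReg a b c η ε (Q x)

/-- The density `ε/2 |∇Q|² + F_ε(Q)/ε - ξ · ∇ψ_ε`. -/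
def relativeDensity (a b c : ℝ) (Ω Ωp : Set Vec3) (δ : ℝ) (φ : ℝ → ℝ) (η : QTensor → ℝ) (ε : ℝ)
    (Q : Vec3 → QTensor) (x : Vec3) : ℝ :=
  ε / 2 * ∑ k, ‖weakGrad Ω Q k x‖ ^ 2 + 1 / ε * bulkEnergyReg a b c ε (Q x)
    - ∑ k, calibration Ω Ωp δ φ x k * weakGrad Ω (psi a b c η ε Q) k x

/-- The relative energy `E[v_ε, Q_ε | v, χ]` at a fixed time. -/
def relativeEnergy (a b c : ℝ) (Ω Ωp : Set Vec3) (δ : ℝ) (φ : ℝ → ℝ) (η : QTensor → ℝ) (ε : ℝ)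
    (vε v : Vec3 → Vec3) (Q : Vec3 → QTensor) : ℝ :=
  (∫ x in Ω, 1 / 2 * ‖vε x - v x‖ ^ 2) + ∫ x in Ω, relativeDensity a b c Ω Ωp δ φ η ε Q x

/-- The truncation `ϑ` of (minus) the signed distance. -/
def truncation (δ r : ℝ) : ℝ := if δ ≤ r then -δ else if r ≤ -δ then δ else -r

/-- The density `(σ χ_{Ω⁻} - ψ_ε) ϑ(d_Γ)`. -/
def bulkErrorDensity (a b c : ℝ) (Ω Ωp : Set Vec3) (δ : ℝ) (η : QTensor → ℝ) (ε : ℝ)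
    (Q : Vec3 → QTensor) (x : Vec3) : ℝ :=
  (surfaceTension a b c * (outerPhase Ω Ωp).indicator 1 x - psi a b c η ε Q x) *
    truncation δ (sdist Ω Ωp x)

/-- The bulk error `E_vol[Q_ε | χ]` at a fixed time. -/
def bulkError (a b c : ℝ) (Ω Ωp : Set Vec3) (δ : ℝ) (η : QTensor → ℝ) (ε : ℝ)
    (Q : Vec3 → QTensor) : ℝ :=
  ∫ x in Ω, bulkErrorDensity a b c Ω Ωp δ η ε Q x

/-! ### The initial datum -/

/-- The cut-off in the definition of the initial datum. -/
structure IsInitialCutoff (ζ : ℝ → ℝ) : Prop where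
  smooth : ContDiff ℝ ∞ ζ
  range : ∀ s, ζ s ∈ Icc 0 1
  one : ∀ s, |s| ≤ 1 / 2 → ζ s = 1
  zero : ∀ s, 1 ≤ |s| → ζ s = 0

/-- The transition profile `S`. -/
def profile (a b c z : ℝ) : ℝ := sPlus a b c / 2 * (1 + Real.tanh (√a / 2 * z))

/-- The order parameter of the initial datum. -/
def initialOrder (a b c : ℝ) (Ω Ωp : Set Vec3) (δ : ℝ) (ζ : ℝ → ℝ) (ε : ℝ) (x : Vec3) : ℝ :=
  ζ (sdist Ω Ωp x / δ) * profile a b c (sdist Ω Ωp x / ε)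
    + (1 - ζ (sdist Ω Ωp x / δ)) * (sPlus a b c * Ωp.indicator 1 x)

/-- The initial datum `Q_{0,ε}`. -/
def initialDatum (a b c : ℝ) (Ω Ωp : Set Vec3) (δ : ℝ) (ζ : ℝ → ℝ) (ε : ℝ) (u₀ : Vec3 → S2)
    (x : Vec3) : QTensor :=
  initialOrder a b c Ω Ωp δ ζ ε x • director (u₀ x)

end BerisEdwards

end

open BerisEdwards

namespace BerisEdwards

open Filter Topology

/-! ### Calculus of weak derivatives -/

section WeakCalculus

variable {E F : Type*} [NormedAddCommGroup E] [NormedSpace ℝ E]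
  [NormedAddCommGroup F] [NormedSpace ℝ F]

/-! The datum is an optimal transition profile evaluated at the signed distance `d`, times a
director field of constant length, so up to a tangential error the estimate is one-dimensional.

Since `b² = 27ac`, the uniaxial energy is a perfect square `m(s)²` with `m` = `uniaxialRoot`
vanishing at `0` and `s₊` (`uniaxialEnergy_eq`), and the profile solves `S' = √3 m(S)`
(`hasDerivAt_profile`). Let `W` = `wellPrimitive` be the primitive of `(2/√3) m` vanishing at `0`.
On uniaxial tensors of order `s ∈ [0, s₊]` the quasi-distance equals `W(s₊) - W(s)`
(`quasiDist_smul_director`): uniaxial tensors minimise the bulk energy at fixed norm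
(`uniaxialEnergy_le_bulkEnergy`), which bounds every length below, and a straight segment attains
the bound. Along the datum the unmollified potential is therefore a smooth function of the order
parameter.

The squared norm of the director is constantly `2/3`, so the director is orthogonal to its weak
gradient (`exists_director_gradient_bound`). Hence `ε/2 |∇Q|²` splits into `ε/3 |∇s|²` and a term
bounded by a multiple of `ε |∇u₀|²`, which costs `O(ε) M²`. By the eikonal equation
(`IsInterface.sum_fderiv_sdist_sq`) what remains of the density, for the unmollified potential and
without the `ε³` in the bulk energy, is `ε/3 s'² + m²/ε - φ (2/√3) m s'`. Close to the interface `s'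
= √3 m/ε` turns this into `2(1 - φ) m²/ε`, and `1 - φ ≤ 4(d/δ)²` against the exponential decay of
`m` in `|d|/ε` gives `O(ε)`. Further away every term is exponentially small
(`exists_calibrated_density_le`). The bulk error is similar, with `|d|` times the decay being `O(ε)`
(`exists_bulk_density_le`). Both bounds are pointwise and uniform, so multiplying by the volume of
`Ω` suffices.

Mollifying changes the potential uniformly by `O(ε)`, with a constant independent of the mollifier
(`exists_dist_quasiDistReg_le`). Closeness of gradients is not used: the flux is integrated by parts
onto the calibration, a test field in `Ω` (`neg_integral_flux_le`). That `ψ_ε` lies in `H¹` follows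
from smoothness of the mollified quasi-distance and the chain rule `MemH1.comp_of_bounded`. -/

lemma integrable_smul_of_tsupport_subset {Ω : Set Vec3} {w : Vec3 → E}
    (hw : LocallyIntegrableOn w Ω) {φ : Vec3 → ℝ} (hφ : ContinuousOn φ Ω) {K : Set Vec3}
    (hK : IsCompact K) (hKΩ : K ⊆ Ω) (h0 : ∀ x ∉ K, φ x = 0) :
    Integrable (fun x => φ x • w x) := by
  have h1 : IntegrableOn (fun x => φ x • w x) K :=
    (hw.integrableOn_compact_subset hKΩ hK).continuousOn_smul (hφ.mono hKΩ) hK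
  refine (integrableOn_iff_integrable_of_support_subset fun x hx => ?_).mp h1
  by_contra hxK
  exact hx (by simp [h0 x hxK])

lemma setIntegral_eq_integral_of_zero_off {Ω K : Set Vec3} {w : Vec3 → E} (hKΩ : K ⊆ Ω)
    (h0 : ∀ x ∉ K, w x = 0) : ∫ x in Ω, w x = ∫ x, w x :=
  setIntegral_eq_integral_of_forall_compl_eq_zero fun x hx => h0 x fun h => hx (hKΩ h)

/-- Weak gradients are unique almost everywhere. -/
lemma IsWeakGradient.ae_eq [CompleteSpace E] {Ω : Set Vec3} (hΩ : IsOpen Ω) {w : Vec3 → E}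
    {G G' : Fin 3 → Vec3 → E} (h : IsWeakGradient Ω w G) (h' : IsWeakGradient Ω w G') (k : Fin 3) :
    G k =ᵐ[volume.restrict Ω] G' k := by
  have key := hΩ.ae_eq_zero_of_integral_contDiff_smul_eq_zero
    ((h.locInt_grad k).sub (h'.locInt_grad k)) (fun φ hφ hc hs => by
      have z : ∀ x ∉ tsupport φ, φ x = 0 := fun x hx => image_eq_zero_of_notMem_tsupport hx
      have i1 := integrable_smul_of_tsupport_subset (h.locInt_grad k)
        hφ.continuous.continuousOn hc hs z
      have i2 := integrable_smul_of_tsupport_subset (h'.locInt_grad k)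
        hφ.continuous.continuousOn hc hs z
      have e1 := h.byParts k φ hφ hc hs
      have e2 := h'.byParts k φ hφ hc hs
      rw [setIntegral_eq_integral_of_zero_off hs (w := fun x => φ x • G k x)
        fun x hx => by simp [z x hx]] at e1
      rw [setIntegral_eq_integral_of_zero_off hs (w := fun x => φ x • G' k x)
        fun x hx => by simp [z x hx]] at e2
      simp only [Pi.sub_apply, smul_sub]
      rw [integral_sub i1 i2, sub_eq_zero]
      exact neg_injective (e1.symm.trans e2))
  rw [Filter.EventuallyEq, ae_restrict_iff' hΩ.measurableSet]
  filter_upwards [key] with x hx hxΩ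
  exact sub_eq_zero.mp (hx hxΩ)

lemma contDiff_mul_of_tsupport_subset {Ω : Set Vec3} (hΩ : IsOpen Ω) {φ h : Vec3 → ℝ}
    (hφ : ContDiff ℝ ∞ φ) (hs : tsupport φ ⊆ Ω) (hh : ContDiffOn ℝ ∞ h Ω) :
    ContDiff ℝ ∞ (fun x => φ x * h x) := by
  rw [contDiff_iff_contDiffAt]
  intro x
  by_cases hx : x ∈ tsupport φ
  · exact hφ.contDiffAt.mul (hh.contDiffAt (hΩ.mem_nhds (hs hx)))
  · have : (fun x => φ x * h x) =ᶠ[𝓝 x] fun _ => 0 := by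
      filter_upwards [(isClosed_tsupport φ).isOpen_compl.mem_nhds hx] with y hy
      simp [image_eq_zero_of_notMem_tsupport hy]
    exact contDiffAt_const.congr_of_eventuallyEq this

lemma continuousOn_fderiv_apply {Ω : Set Vec3} (hΩ : IsOpen Ω) {h : Vec3 → F}
    (hh : ContDiffOn ℝ ∞ h Ω) (v : Vec3) : ContinuousOn (fun x => fderiv ℝ h x v) Ω :=
  (hh.continuousOn_fderiv_of_isOpen hΩ (by simp)).clm_apply continuousOn_const

/-- Integration by parts against a product of a test function with a smooth function. -/
lemma IsWeakGradient.integral_mul_smul {Ω : Set Vec3} (hΩ : IsOpen Ω)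
    {w : Vec3 → E} {G : Fin 3 → Vec3 → E} (hw : IsWeakGradient Ω w G) (k : Fin 3)
    {φ h : Vec3 → ℝ} (hφ : ContDiff ℝ ∞ φ) (hc : HasCompactSupport φ) (hs : tsupport φ ⊆ Ω)
    (hh : ContDiffOn ℝ ∞ h Ω) :
    ∫ x in Ω, (h x * fderiv ℝ φ x (EuclideanSpace.single k 1)) • w x =
      -∫ x in Ω, φ x • (fderiv ℝ h x (EuclideanSpace.single k 1) • w x + h x • G k x) := by
  set e : Vec3 := EuclideanSpace.single k 1
  have z : ∀ x ∉ tsupport φ, φ x = 0 := fun x hx => image_eq_zero_of_notMem_tsupport hx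
  have z' : ∀ x ∉ tsupport φ, fderiv ℝ φ x = 0 := fun x hx => fderiv_of_notMem_tsupport ℝ hx
  have hsub : tsupport (fun x => φ x * h x) ⊆ tsupport φ := tsupport_mul_subset_left
  have key := hw.byParts k (fun x => φ x * h x) (contDiff_mul_of_tsupport_subset hΩ hφ hs hh)
    (hc.mono' (subset_tsupport _ |>.trans hsub)) (hsub.trans hs)
  have d : ∀ x ∈ Ω, fderiv ℝ (fun x => φ x * h x) x e =
      φ x * fderiv ℝ h x e + h x * fderiv ℝ φ x e := by
    intro x hx
    rw [fderiv_fun_mul (hφ.differentiable (by simp) x)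
      ((hh.contDiffAt (hΩ.mem_nhds hx)).differentiableAt (by simp))]
    simp
  have i1 : Integrable (fun x => (φ x * fderiv ℝ h x e) • w x) :=
    integrable_smul_of_tsupport_subset hw.locInt
      (hφ.continuous.continuousOn.mul (continuousOn_fderiv_apply hΩ hh e)) hc hs
      fun x hx => by simp [z x hx]
  have i2 : Integrable (fun x => (h x * fderiv ℝ φ x e) • w x) :=
    integrable_smul_of_tsupport_subset hw.locInt
      (hh.continuousOn.mul (continuousOn_fderiv_apply hΩ hφ.contDiffOn e)) hc hs
      fun x hx => by simp [z' x hx]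
  have i3 : Integrable (fun x => (φ x * h x) • G k x) :=
    integrable_smul_of_tsupport_subset (hw.locInt_grad k)
      (hφ.continuous.continuousOn.mul hh.continuousOn) hc hs
      fun x hx => by simp [z x hx]
  rw [setIntegral_congr_fun hΩ.measurableSet (g := fun x =>
    (φ x * fderiv ℝ h x e) • w x + (h x * fderiv ℝ φ x e) • w x)
    (fun x hx => by beta_reduce; rw [← add_smul, ← d x hx])] at key
  rw [integral_add i1.integrableOn i2.integrableOn] at key
  simp only [smul_add, smul_smul]
  rw [integral_add i1.integrableOn i3.integrableOn, neg_add, ← key]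
  abel

/-- Product rule for a smooth function and a weakly differentiable function. -/
lemma IsWeakGradient.smul {Ω : Set Vec3} (hΩ : IsOpen Ω) {w : Vec3 → E}
    {G : Fin 3 → Vec3 → E} (hw : IsWeakGradient Ω w G) {h : Vec3 → ℝ} (hh : ContDiffOn ℝ ∞ h Ω) :
    IsWeakGradient Ω (fun x => h x • w x)
      (fun k x => fderiv ℝ h x (EuclideanSpace.single k 1) • w x + h x • G k x) where
  locInt := hw.locInt.continuousOn_smul hΩ.isLocallyClosed hh.continuousOn
  locInt_grad k := (hw.locInt.continuousOn_smul hΩ.isLocallyClosed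
    (continuousOn_fderiv_apply hΩ hh _)).add
      ((hw.locInt_grad k).continuousOn_smul hΩ.isLocallyClosed hh.continuousOn)
  byParts k φ hφ hc hs := by
    rw [← hw.integral_mul_smul hΩ k hφ hc hs hh]
    simp only [smul_smul, mul_comm]

/-- Constants have vanishing weak gradient. -/
lemma isWeakGradient_const (Ω : Set Vec3) (e : E) :
    IsWeakGradient Ω (fun _ => e) (fun _ _ => 0) where
  locInt := (locallyIntegrable_const e).locallyIntegrableOn Ω
  locInt_grad _ := (locallyIntegrable_const (0 : E)).locallyIntegrableOn Ω
  byParts k φ hφ hc hs := by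
    have z' : ∀ x ∉ tsupport φ, fderiv ℝ φ x = 0 := fun x hx => fderiv_of_notMem_tsupport ℝ hx
    rw [setIntegral_eq_integral_of_zero_off hs (fun x hx => by simp [z' x hx])]
    set v : Vec3 := EuclideanSpace.single k 1
    have hd : Continuous fun x => fderiv ℝ φ x v :=
      (hφ.continuous_fderiv (by simp)).clm_apply continuous_const
    have hi : Integrable (fun x => fderiv ℝ φ x v) :=
      hd.integrable_of_hasCompactSupport (hc.fderiv_apply (𝕜 := ℝ) v)
    have := integral_mul_fderiv_eq_neg_fderiv_mul_of_integrable (μ := (volume : Measure Vec3))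
      (f := fun _ : Vec3 => (1 : ℝ)) (g := φ) (v := v) (by simp) (by simpa using hi)
      (by simpa using hφ.continuous.integrable_of_hasCompactSupport hc)
      (fun x _ => differentiableAt_const _) (fun x _ => hφ.differentiable (by simp) x)
    simp only [one_mul, fderiv_fun_const, Pi.zero_apply, zero_apply, zero_mul,
      integral_zero, neg_zero] at this
    -- In an incomplete space the Bochner integral is zero by convention, so both sides vanish.
    by_cases hE : CompleteSpace E
    · rw [integral_smul_const, this]; simp
    · simp [integral, hE]

/-- The classical gradient of a smooth function is its weak gradient. -/
lemma isWeakGradient_of_contDiffOn {Ω : Set Vec3} (hΩ : IsOpen Ω) {h : Vec3 → ℝ}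
    (hh : ContDiffOn ℝ ∞ h Ω) :
    IsWeakGradient Ω h (fun k x => fderiv ℝ h x (EuclideanSpace.single k 1)) := by
  simpa using (isWeakGradient_const Ω (1 : ℝ)).smul hΩ hh

end WeakCalculus

/-! ### Approximation of weakly differentiable functions by mollification. -/

section Mollification

variable {E F : Type*} [NormedAddCommGroup E] [NormedSpace ℝ E]
  [NormedAddCommGroup F] [NormedSpace ℝ F]

/-- Dominated convergence with a convergent sequence of dominating functions. -/
lemma tendsto_integral_of_dominated_convergent {α : Type*} [MeasurableSpace α] {μ : Measure α}
    {f : ℕ → α → F} {f' : α → F} {h : ℕ → α → ℝ} {h' : α → ℝ}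
    (hf : ∀ n, AEStronglyMeasurable (f n) μ) (hh : ∀ n, Integrable (h n) μ)
    (hh' : Integrable h' μ) (hle : ∀ n, ∀ᵐ x ∂μ, ‖f n x‖ ≤ h n x)
    (hlim : ∀ᵐ x ∂μ, Tendsto (fun n => f n x) atTop (𝓝 (f' x)))
    (hhlim : ∀ᵐ x ∂μ, Tendsto (fun n => h n x) atTop (𝓝 (h' x)))
    (hintegral : Tendsto (fun n => ∫ x, h n x ∂μ) atTop (𝓝 (∫ x, h' x ∂μ))) :
    Tendsto (fun n => ∫ x, f n x ∂μ) atTop (𝓝 (∫ x, f' x ∂μ)) := by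
  have hle' : ∀ᵐ x ∂μ, ∀ n, ‖f n x‖ ≤ h n x := ae_all_iff.mpr hle
  have hf' : AEStronglyMeasurable f' μ := aestronglyMeasurable_of_tendsto_ae _ hf hlim
  have fi : ∀ n, Integrable (f n) μ := fun n => (hh n).mono' (hf n) (hle n)
  have fle : ∀ᵐ x ∂μ, ‖f' x‖ ≤ h' x := by
    filter_upwards [hle', hlim, hhlim] with x h1 h2 h3
    exact le_of_tendsto_of_tendsto' h2.norm h3 h1
  have fi' : Integrable f' μ := hh'.mono' hf' fle
  -- These functions are nonnegative and tend to `2h'`. Fatou's lemma for them, with convergence of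
  -- the integrals of `h n`, forces the integral of `‖f n - f'‖` to zero.
  set g : ℕ → α → ℝ := fun n x => h n x + h' x - ‖f n x - f' x‖ with hg
  have gnn : ∀ n, 0 ≤ᵐ[μ] g n := fun n => by
    filter_upwards [hle', fle] with x h1 h2
    have := norm_sub_le (f n x) (f' x)
    simp only [Pi.zero_apply, hg]
    linarith [h1 n]
  have gi : ∀ n, Integrable (g n) μ := fun n => ((hh n).add hh').sub ((fi n).sub fi').norm
  have glim : ∀ᵐ x ∂μ, Tendsto (fun n => g n x) atTop (𝓝 (h' x + h' x)) := by
    filter_upwards [hlim, hhlim] with x h2 h3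
    have : Tendsto (fun n => ‖f n x - f' x‖) atTop (𝓝 0) := by
      simpa using (h2.sub_const (f' x)).norm
    simpa using (h3.add_const (h' x)).sub this
  have h'nn : 0 ≤ᵐ[μ] fun x => h' x + h' x := by
    filter_upwards [fle] with x h2
    have := norm_nonneg (f' x)
    simp only [Pi.zero_apply]; linarith
  have fatou : ENNReal.ofReal (∫ x, (h' x + h' x) ∂μ) ≤
      liminf (fun n => ENNReal.ofReal (∫ x, g n x ∂μ)) atTop := by
    rw [ofReal_integral_eq_lintegral_ofReal (f := fun x => h' x + h' x) (hh'.add hh') h'nn]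
    calc ∫⁻ x, ENNReal.ofReal (h' x + h' x) ∂μ
        = ∫⁻ x, liminf (fun n => ENNReal.ofReal (g n x)) atTop ∂μ := by
          refine lintegral_congr_ae ?_
          filter_upwards [glim] with x hx
          exact ((ENNReal.tendsto_ofReal hx).liminf_eq).symm
      _ ≤ liminf (fun n => ∫⁻ x, ENNReal.ofReal (g n x) ∂μ) atTop :=
          lintegral_liminf_le' fun n => (gi n).aestronglyMeasurable.aemeasurable.ennreal_ofReal
      _ = _ := by
          congr 1; ext n
          rw [ofReal_integral_eq_lintegral_ofReal (gi n) (gnn n)]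
  set I : ℕ → ℝ := fun n => ∫ x, ‖f n x - f' x‖ ∂μ with hI
  have gint : ∀ n, ∫ x, g n x ∂μ = (∫ x, h n x ∂μ) + (∫ x, h' x ∂μ) - I n := fun n => by
    rw [hg]
    simp only
    rw [integral_sub (f := fun x => h n x + h' x) (g := fun x => ‖f n x - f' x‖)
      ((hh n).add hh') ((fi n).sub fi').norm, integral_add (hh n) hh']
  have hI0 : Tendsto I atTop (𝓝 0) := by
    rw [Metric.tendsto_atTop]
    intro ε hε
    have hInn : ∀ n, 0 ≤ I n := fun n => integral_nonneg fun x => norm_nonneg _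
    have hA := Metric.tendsto_atTop.mp hintegral (ε / 2) (by positivity)
    obtain ⟨N, hN⟩ := hA
    have hB : ∀ᶠ n in atTop, ∫ x, (h' x + h' x) ∂μ - ε / 2 < ∫ x, g n x ∂μ := by
      by_cases hpos : ∫ x, (h' x + h' x) ∂μ - ε / 2 < 0
      · exact Eventually.of_forall fun n => hpos.trans_le (integral_nonneg_of_ae (gnn n))
      · push Not at hpos
        have hlt : ENNReal.ofReal (∫ x, (h' x + h' x) ∂μ - ε / 2) <
            liminf (fun n => ENNReal.ofReal (∫ x, g n x ∂μ)) atTop :=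
          lt_of_lt_of_le ((ENNReal.ofReal_lt_ofReal_iff_of_nonneg hpos).mpr (by linarith)) fatou
        filter_upwards [eventually_lt_of_lt_liminf hlt] with n hn
        exact (ENNReal.ofReal_lt_ofReal_iff_of_nonneg hpos).mp hn
    obtain ⟨N', hN'⟩ := eventually_atTop.mp hB
    refine ⟨max N N', fun n hn => ?_⟩
    have h1 := hN n (le_trans (le_max_left _ _) hn)
    have h2 := hN' n (le_trans (le_max_right _ _) hn)
    rw [gint, integral_add hh' hh'] at h2
    rw [Real.dist_eq] at h1 ⊢
    rw [sub_zero, abs_of_nonneg (hInn n)]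
    have := (abs_lt.mp h1).2
    linarith
  rw [tendsto_iff_norm_sub_tendsto_zero]
  refine squeeze_zero (fun _ => norm_nonneg _) (fun n => ?_) hI0
  rw [← integral_sub (fi n) fi']
  exact norm_integral_le_integral_norm _

open ContinuousLinearMap in
/-- The derivative of a mollification is the mollification of the weak derivative. -/
lemma fderiv_convolution_of_weak [CompleteSpace E] {W H : Vec3 → E} (hW : Integrable W)
    {v : Vec3}
    (hWH : ∀ φ : Vec3 → ℝ, ContDiff ℝ ∞ φ → HasCompactSupport φ →
      ∫ x, fderiv ℝ φ x v • W x = -∫ x, φ x • H x)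
    {ρ : Vec3 → ℝ} (hρ : ContDiff ℝ ∞ ρ) (hc : HasCompactSupport ρ) (x : Vec3) :
    DifferentiableAt ℝ (convolution ρ W (lsmul ℝ ℝ) volume) x ∧
    fderiv ℝ (convolution ρ W (lsmul ℝ ℝ) volume) x v =
      convolution ρ H (lsmul ℝ ℝ) volume x := by
  have hd := hc.hasFDerivAt_convolution_left (lsmul ℝ ℝ) (hρ.of_le (by simp))
    hW.locallyIntegrable x (μ := (volume : Measure Vec3))
  refine ⟨hd.differentiableAt, ?_⟩
  rw [hd.fderiv, convolution_eq_swap, convolution_eq_swap]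
  have hex : Integrable (fun t => (precompL Vec3 (lsmul ℝ ℝ : ℝ →L[ℝ] E →L[ℝ] E)
      (fderiv ℝ ρ (x - t))) (W t)) := by
    have := (hc.fderiv (𝕜 := ℝ)).convolutionExists_left (μ := (volume : Measure Vec3))
      (precompL Vec3 (lsmul ℝ ℝ : ℝ →L[ℝ] E →L[ℝ] E)) (hρ.continuous_fderiv (by simp))
      hW.locallyIntegrable x
    exact this.integrable_swap
  rw [ContinuousLinearMap.integral_apply hex]
  simp only [precompL_apply, lsmul_apply]
  -- The reflected kernel `t ↦ ρ (x - t)` serves as the test function; the sign from the reflection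
  -- cancels the sign of integration by parts.
  have hφ : ContDiff ℝ ∞ (fun t => ρ (x - t)) := hρ.comp (contDiff_const.sub contDiff_id)
  have hcφ : HasCompactSupport (fun t => ρ (x - t)) :=
    hc.comp_homeomorph (Homeomorph.subLeft x)
  have key := hWH _ hφ hcφ
  have hfd : ∀ t, fderiv ℝ (fun t => ρ (x - t)) t v = -(fderiv ℝ ρ (x - t) v) := fun t => by
    have h1 : HasFDerivAt (fun t => ρ (x - t)) ((fderiv ℝ ρ (x - t)).comp
        (0 - ContinuousLinearMap.id ℝ Vec3)) t :=
      (hρ.differentiable (by simp) (x - t)).hasFDerivAt.comp t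
        ((hasFDerivAt_const x t).sub (hasFDerivAt_id t))
    rw [h1.fderiv]; simp
  simp only [hfd, neg_smul, integral_neg, neg_inj] at key
  exact key

open ContinuousLinearMap in
/-- The chain rule for weakly differentiable integrable functions on the whole space. -/
lemma integral_fderiv_smul_comp_of_weak [CompleteSpace E] [CompleteSpace F] {W H : Vec3 → E}
    (hW : Integrable W)
    (hH : Integrable H) {v : Vec3}
    (hWH : ∀ φ : Vec3 → ℝ, ContDiff ℝ ∞ φ → HasCompactSupport φ →
      ∫ x, fderiv ℝ φ x v • W x = -∫ x, φ x • H x)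
    {Φ : E → F} (hΦ : ContDiff ℝ 1 Φ) {B : ℝ} (hB : ∀ q, ‖Φ q‖ ≤ B) (hB' : ∀ q, ‖fderiv ℝ Φ q‖ ≤ B)
    {φ : Vec3 → ℝ} (hφ : ContDiff ℝ ∞ φ) (hc : HasCompactSupport φ) :
    ∫ x, fderiv ℝ φ x v • Φ (W x) = -∫ x, φ x • fderiv ℝ Φ (W x) (H x) := by
  have hB0 : 0 ≤ B := (norm_nonneg _).trans (hB 0)
  let β : ℕ → ContDiffBump (0 : Vec3) := fun n =>
    ⟨1 / ((n : ℝ) + 1), 2 / ((n : ℝ) + 1), by positivity,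
      div_lt_div_of_pos_right (by norm_num) (by positivity)⟩
  have hβ : Tendsto (fun n => (β n).rOut) atTop (𝓝 0) := by
    have := (tendsto_one_div_add_atTop_nhds_zero_nat (𝕜 := ℝ)).const_mul 2
    simpa only [β, mul_one_div, mul_zero] using this
  have hβ' : ∀ᶠ n in atTop, (β n).rOut ≤ 2 * (β n).rIn :=
    Eventually.of_forall fun n => by simp only [β]; rw [mul_one_div]
  let ρ : ℕ → Vec3 → ℝ := fun n => (β n).normed volume
  have hρ : ∀ n, ContDiff ℝ ∞ (ρ n) := fun n => (β n).contDiff_normed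
  have hρc : ∀ n, HasCompactSupport (ρ n) := fun n => (β n).hasCompactSupport_normed
  let Wn : ℕ → Vec3 → E := fun n => convolution (ρ n) W (lsmul ℝ ℝ) volume
  let Hn : ℕ → Vec3 → E := fun n => convolution (ρ n) H (lsmul ℝ ℝ) volume
  let hn : ℕ → Vec3 → ℝ := fun n => convolution (ρ n) (fun x => ‖H x‖) (lsmul ℝ ℝ) volume
  have wlim : ∀ᵐ x, Tendsto (fun n => Wn n x) atTop (𝓝 (W x)) :=
    ContDiffBump.ae_convolution_tendsto_right_of_locallyIntegrable hβ hβ' hW.locallyIntegrable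
  have Hlim : ∀ᵐ x, Tendsto (fun n => Hn n x) atTop (𝓝 (H x)) :=
    ContDiffBump.ae_convolution_tendsto_right_of_locallyIntegrable hβ hβ' hH.locallyIntegrable
  have hlim : ∀ᵐ x, Tendsto (fun n => hn n x) atTop (𝓝 ‖H x‖) :=
    ContDiffBump.ae_convolution_tendsto_right_of_locallyIntegrable hβ hβ'
      hH.norm.locallyIntegrable
  have cW : ∀ n, ContDiff ℝ 1 (Wn n) := fun n =>
    (hρc n).contDiff_convolution_left _ ((hρ n).of_le (by simp)) hW.locallyIntegrable
  have cH : ∀ n, Continuous (Hn n) := fun n =>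
    (hρc n).continuous_convolution_left _ (hρ n).continuous hH.locallyIntegrable
  have ihn : ∀ n, Integrable (hn n) := fun n =>
    (β n).integrable_normed.integrable_convolution _ hH.norm
  have Hle : ∀ n x, ‖Hn n x‖ ≤ hn n x := fun n x => by
    refine (norm_integral_le_integral_norm _).trans (le_of_eq ?_)
    refine integral_congr_ae (Eventually.of_forall fun t => ?_)
    simp only [lsmul_apply, norm_smul, smul_eq_mul]
    rw [Real.norm_of_nonneg ((β n).nonneg_normed _)]
  have hnint : ∀ n, ∫ x, hn n x = ∫ x, ‖H x‖ := fun n => by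
    rw [integral_convolution (lsmul ℝ ℝ) (β n).integrable_normed hH.norm,
      (β n).integral_normed]
    simp
  obtain ⟨Cφ, hCφ⟩ := hφ.continuous.bounded_above_of_compact_support hc
  have hdφ : Continuous fun x => fderiv ℝ φ x v :=
    (hφ.continuous_fderiv (by simp)).clm_apply continuous_const
  have hcdφ : HasCompactSupport fun x => fderiv ℝ φ x v := hc.fderiv_apply (𝕜 := ℝ) v
  have cΦ' : Continuous (fderiv ℝ Φ) := hΦ.continuous_fderiv (by simp)
  have step : ∀ n, ∫ x, fderiv ℝ φ x v • Φ (Wn n x) =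
      -∫ x, φ x • fderiv ℝ Φ (Wn n x) (Hn n x) := fun n => by
    have hd : ∀ x, HasFDerivAt (fun x => Φ (Wn n x))
        ((fderiv ℝ Φ (Wn n x)).comp (fderiv ℝ (Wn n) x)) x := fun x =>
      (hΦ.differentiable (by simp) _).hasFDerivAt.comp x
        ((cW n).differentiable (by simp) x).hasFDerivAt
    have hfd : ∀ x, fderiv ℝ (fun x => Φ (Wn n x)) x v = fderiv ℝ Φ (Wn n x) (Hn n x) := fun x => by
      rw [(hd x).fderiv, ContinuousLinearMap.comp_apply,
        (fderiv_convolution_of_weak hW hWH (hρ n) (hρc n) x).2]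
    have cg : Continuous fun x => Φ (Wn n x) := hΦ.continuous.comp (cW n).continuous
    have cg' : Continuous fun x => fderiv ℝ Φ (Wn n x) (Hn n x) :=
      (cΦ'.comp (cW n).continuous).clm_apply (cH n)
    have := integral_smul_fderiv_eq_neg_fderiv_smul_of_integrable (μ := (volume : Measure Vec3))
      (f := φ) (g := fun x => Φ (Wn n x)) (v := v)
      ((hdφ.smul cg).integrable_of_hasCompactSupport hcdφ.smul_right)
      (by simp only [hfd]; exact (hφ.continuous.smul cg').integrable_of_hasCompactSupport
            hc.smul_right)
      ((hφ.continuous.smul cg).integrable_of_hasCompactSupport hc.smul_right)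
      (fun x _ => hφ.differentiable (by simp) x) (fun x _ => (hd x).differentiableAt)
    simp only [hfd] at this
    rw [this, neg_neg]
  have l1 : Tendsto (fun n => ∫ x, fderiv ℝ φ x v • Φ (Wn n x)) atTop
      (𝓝 (∫ x, fderiv ℝ φ x v • Φ (W x))) := by
    refine tendsto_integral_of_dominated_convergence (fun x => ‖fderiv ℝ φ x v‖ * B) (fun n =>
      (hdφ.smul (hΦ.continuous.comp (cW n).continuous)).aestronglyMeasurable)
      ((hdφ.integrable_of_hasCompactSupport hcdφ).norm.mul_const B) (fun n =>
        Eventually.of_forall fun x => ?_) ?_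
    · rw [norm_smul]; exact mul_le_mul_of_nonneg_left (hB _) (norm_nonneg _)
    · filter_upwards [wlim] with x hx
      exact ((hΦ.continuous.tendsto _).comp hx).const_smul _
  have l2 : Tendsto (fun n => ∫ x, φ x • fderiv ℝ Φ (Wn n x) (Hn n x)) atTop
      (𝓝 (∫ x, φ x • fderiv ℝ Φ (W x) (H x))) := by
    -- The mollified gradient has no evident fixed dominating function; it is dominated by the
    -- mollification of `‖H‖`, whose integral does not depend on `n`.
    refine tendsto_integral_of_dominated_convergent (h := fun n x => Cφ * B * hn n x)
      (h' := fun x => Cφ * B * ‖H x‖) (fun n => ?_) (fun n => (ihn n).const_mul _)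
      (hH.norm.const_mul _) (fun n => Eventually.of_forall fun x => ?_) ?_ ?_ ?_
    · exact (hφ.continuous.smul
        ((cΦ'.comp (cW n).continuous).clm_apply (cH n))).aestronglyMeasurable
    · rw [norm_smul, mul_assoc]
      refine mul_le_mul (hCφ x) ?_ (norm_nonneg _) ((norm_nonneg _).trans (hCφ x))
      exact (le_opNorm _ _).trans (mul_le_mul (hB' _) (Hle n x) (norm_nonneg _) hB0)
    · filter_upwards [wlim, Hlim] with x h1 h2
      have := ((cΦ'.tendsto _).comp h1)
      exact ((isBoundedBilinearMap_apply.continuous.tendsto (fderiv ℝ Φ (W x), H x)).comp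
        (this.prodMk_nhds h2)).const_smul _
    · filter_upwards [hlim] with x hx
      exact hx.const_mul _
    · simp only [integral_const_mul, hnint]
      exact tendsto_const_nhds
  refine tendsto_nhds_unique l1 ?_
  simp only [step]
  exact l2.neg

end Mollification

/-! ### Chain rules and the space `H¹` on open sets. -/

section ChainRule

variable {E F : Type*} [NormedAddCommGroup E] [NormedSpace ℝ E]
  [NormedAddCommGroup F] [NormedSpace ℝ F]

lemma exists_contDiff_cutoff {Ω K : Set Vec3} (hΩ : IsOpen Ω) (hK : IsCompact K) (hKΩ : K ⊆ Ω) :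
    ∃ χ : Vec3 → ℝ, ContDiff ℝ ∞ χ ∧ HasCompactSupport χ ∧ tsupport χ ⊆ Ω ∧
      ∀ x ∈ K, χ =ᶠ[𝓝 x] fun _ => 1 := by
  obtain ⟨L, hL, hKL, hLΩ⟩ := exists_compact_between hK hΩ hKΩ
  obtain ⟨χ, h1, h0, -⟩ := exists_contMDiffMap_one_nhds_of_subset_interior (n := (⊤ : ℕ∞))
    (modelWithCornersSelf ℝ Vec3) hK.isClosed hKL
  have hs : tsupport χ ⊆ L := by
    refine closure_minimal (fun x hx => ?_) hL.isClosed
    by_contra hxL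
    exact hx (h0 x hxL)
  exact ⟨χ, χ.contMDiff.contDiff, hL.of_isClosed_subset (isClosed_tsupport _) hs, hs.trans hLΩ,
    fun x hx => h1.filter_mono (nhds_le_nhdsSet hx)⟩

/-- Chain rule for weakly differentiable functions. -/
lemma IsWeakGradient.comp [CompleteSpace E] [CompleteSpace F] {Ω : Set Vec3} (hΩ : IsOpen Ω)
    {w : Vec3 → E} {G : Fin 3 → Vec3 → E} (hw : IsWeakGradient Ω w G) {Φ : E → F}
    (hΦ : ContDiff ℝ 1 Φ) {B : ℝ} (hB : ∀ q, ‖Φ q‖ ≤ B) (hB' : ∀ q, ‖fderiv ℝ Φ q‖ ≤ B) :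
    IsWeakGradient Ω (fun x => Φ (w x)) (fun k x => fderiv ℝ Φ (w x) (G k x)) where
  locInt := by
    rw [locallyIntegrableOn_iff hΩ.isLocallyClosed]
    intro K hK hKc
    have := (hw.locInt.integrableOn_compact_subset hK hKc).aestronglyMeasurable
    exact IntegrableOn.of_bound hKc.measure_lt_top
      (hΦ.continuous.comp_aestronglyMeasurable this) B (Eventually.of_forall fun x => hB _)
  locInt_grad k := by
    rw [locallyIntegrableOn_iff hΩ.isLocallyClosed]
    intro K hK hKc
    have h1 := (hw.locInt.integrableOn_compact_subset hK hKc).aestronglyMeasurable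
    have h2 := (hw.locInt_grad k).integrableOn_compact_subset hK hKc
    refine (h2.norm.const_mul B).mono' ?_ (Eventually.of_forall fun x => ?_)
    · exact isBoundedBilinearMap_apply.continuous.comp_aestronglyMeasurable
        (((hΦ.continuous_fderiv (by simp)).comp_aestronglyMeasurable h1).prodMk
          h2.aestronglyMeasurable)
    · exact (ContinuousLinearMap.le_opNorm _ _).trans
        (mul_le_mul_of_nonneg_right (hB' _) (norm_nonneg _))
  byParts k φ hφ hc hs := by
    -- The product `χ w` is integrable and weakly differentiable on the whole space, and agrees with
    -- `w` near the support of the test function. This reduces the claim to the global chain rule.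
    obtain ⟨χ, hχ, hχc, hχs, hχ1⟩ := exists_contDiff_cutoff hΩ hc hs
    set v : Vec3 := EuclideanSpace.single k 1
    have z : ∀ x ∉ tsupport φ, φ x = 0 := fun x hx => image_eq_zero_of_notMem_tsupport hx
    have z' : ∀ x ∉ tsupport φ, fderiv ℝ φ x = 0 := fun x hx => fderiv_of_notMem_tsupport ℝ hx
    have y : ∀ x ∉ tsupport χ, χ x = 0 := fun x hx => image_eq_zero_of_notMem_tsupport hx
    have y' : ∀ x ∉ tsupport χ, fderiv ℝ χ x = 0 := fun x hx => fderiv_of_notMem_tsupport ℝ hx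
    have iW : Integrable (fun x => χ x • w x) :=
      integrable_smul_of_tsupport_subset hw.locInt hχ.continuous.continuousOn hχc hχs y
    have iH : Integrable (fun x => fderiv ℝ χ x v • w x + χ x • G k x) :=
      (integrable_smul_of_tsupport_subset hw.locInt
        (continuousOn_fderiv_apply hΩ hχ.contDiffOn v) hχc hχs fun x hx => by simp [y' x hx]).add
      (integrable_smul_of_tsupport_subset (hw.locInt_grad k) hχ.continuous.continuousOn hχc hχs y)
    have hWH : ∀ f : Vec3 → ℝ, ContDiff ℝ ∞ f → HasCompactSupport f →
        ∫ x, fderiv ℝ f x v • χ x • w x =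
          -∫ x, f x • (fderiv ℝ χ x v • w x + χ x • G k x) := by
      intro f hf _
      have key := hw.integral_mul_smul hΩ k hχ hχc hχs hf.contDiffOn
      rw [setIntegral_eq_integral_of_zero_off hχs (fun x hx => by simp [y' x hx]),
        setIntegral_eq_integral_of_zero_off hχs (fun x hx => by simp [y x hx])] at key
      have cfd : ∀ {g : Vec3 → ℝ}, ContDiff ℝ ∞ g → ContinuousOn (fun x => fderiv ℝ g x v) Ω :=
        fun hg => continuousOn_fderiv_apply hΩ hg.contDiffOn v
      have j1 : Integrable (fun x => (χ x * fderiv ℝ f x v) • w x) :=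
        integrable_smul_of_tsupport_subset hw.locInt
          (hχ.continuous.continuousOn.mul (cfd hf)) hχc hχs fun x hx => by simp [y x hx]
      have j2 : Integrable (fun x => (f x * fderiv ℝ χ x v) • w x) :=
        integrable_smul_of_tsupport_subset hw.locInt
          (hf.continuous.continuousOn.mul (cfd hχ)) hχc hχs fun x hx => by simp [y' x hx]
      have j3 : Integrable (fun x => (χ x * f x) • G k x) :=
        integrable_smul_of_tsupport_subset (hw.locInt_grad k)
          (hχ.continuous.continuousOn.mul hf.continuous.continuousOn) hχc hχs
          fun x hx => by simp [y x hx]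
      simp only [smul_add, smul_smul] at key ⊢
      rw [integral_add j1 j3] at key
      simp only [mul_comm (fderiv ℝ f _ v), mul_comm (f _) (χ _)] at key ⊢
      rw [integral_add j2 j3, key]
      abel
    have key := integral_fderiv_smul_comp_of_weak iW iH hWH hΦ hB hB' hφ hc
    rw [setIntegral_eq_integral_of_zero_off hs (fun x hx => by simp [z' x hx]),
      setIntegral_eq_integral_of_zero_off hs (fun x hx => by simp [z x hx])]
    convert key using 1
    · refine integral_congr_ae (Eventually.of_forall fun x => ?_)
      by_cases hx : x ∈ tsupport φ
      · simp [(hχ1 x hx).self_of_nhds]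
      · simp [z' x hx]
    · congr 1
      refine integral_congr_ae (Eventually.of_forall fun x => ?_)
      by_cases hx : x ∈ tsupport φ
      · have : fderiv ℝ χ x = 0 := by rw [(hχ1 x hx).fderiv_eq]; simp
        simp [(hχ1 x hx).self_of_nhds, this]
      · simp [z x hx]

/-- Chain rule for bounded weakly differentiable functions. -/
lemma IsWeakGradient.comp_of_bounded [FiniteDimensional ℝ E] [CompleteSpace F]
    {Ω : Set Vec3} (hΩ : IsOpen Ω)
    {w : Vec3 → E} {G : Fin 3 → Vec3 → E} (hw : IsWeakGradient Ω w G) {R : ℝ}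
    (hR : ∀ x, ‖w x‖ ≤ R) {Φ : E → F} (hΦ : ContDiff ℝ ∞ Φ) :
    IsWeakGradient Ω (fun x => Φ (w x)) (fun k x => fderiv ℝ Φ (w x) (G k x)) := by
  have : CompleteSpace E := FiniteDimensional.complete ℝ E
  have hR0 : 0 ≤ R := (norm_nonneg _).trans (hR 0)
  -- Truncating `Φ` makes it and its derivative globally bounded. The margin `1` puts every value of
  -- `w` in an open ball where the bump is `1`, so derivatives agree there too.
  let β : ContDiffBump (0 : E) := ⟨R + 1, R + 2, by linarith, by linarith⟩
  have hΨ : ContDiff ℝ ∞ (fun q => β q • Φ q) := β.contDiff.smul hΦ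
  have hΨc : HasCompactSupport (fun q => β q • Φ q) := β.hasCompactSupport.smul_right
  obtain ⟨B₁, hB₁⟩ := hΨ.continuous.bounded_above_of_compact_support hΨc
  obtain ⟨B₂, hB₂⟩ := (hΨ.continuous_fderiv (by simp)).bounded_above_of_compact_support
    (hΨc.fderiv (𝕜 := ℝ))
  have heq : ∀ x, (fun q => β q • Φ q) =ᶠ[𝓝 (w x)] Φ := fun x => by
    have : ball (0 : E) (R + 1) ∈ 𝓝 (w x) :=
      isOpen_ball.mem_nhds (by rw [mem_ball_zero_iff]; linarith [hR x])
    filter_upwards [this] with q hq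
    rw [β.one_of_mem_closedBall (ball_subset_closedBall hq), one_smul]
  have key := hw.comp hΩ (hΨ.of_le (by simp)) (B := max B₁ B₂)
    (fun q => (hB₁ q).trans (le_max_left _ _)) (fun q => (hB₂ q).trans (le_max_right _ _))
  have e1 : (fun x => β (w x) • Φ (w x)) = fun x => Φ (w x) :=
    funext fun x => (heq x).self_of_nhds
  have e2 : ∀ x, fderiv ℝ (fun q => β q • Φ q) (w x) = fderiv ℝ Φ (w x) :=
    fun x => (heq x).fderiv_eq
  simp only [e1, e2] at key
  exact key

lemma exists_bound_fderiv_of_bounded [FiniteDimensional ℝ E] {w : Vec3 → E} {R : ℝ}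
    (hR : ∀ x, ‖w x‖ ≤ R) {Φ : E → F} (hΦ : ContDiff ℝ ∞ Φ) :
    ∃ B, ∀ x, ‖Φ (w x)‖ ≤ B ∧ ‖fderiv ℝ Φ (w x)‖ ≤ B := by
  have := FiniteDimensional.proper_real E
  obtain ⟨B₁, hB₁⟩ := (isCompact_closedBall (0 : E) R).exists_bound_of_continuousOn
    hΦ.continuous.continuousOn
  obtain ⟨B₂, hB₂⟩ := (isCompact_closedBall (0 : E) R).exists_bound_of_continuousOn
    (hΦ.continuous_fderiv (by simp)).continuousOn
  exact ⟨max B₁ B₂, fun x => ⟨(hB₁ _ (by simpa using hR x)).trans (le_max_left _ _),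
    (hB₂ _ (by simpa using hR x)).trans (le_max_right _ _)⟩⟩

lemma memLp_fderiv_apply [FiniteDimensional ℝ E] {Ω : Set Vec3} {w g : Vec3 → E} {R : ℝ}
    (hm : AEStronglyMeasurable w (volume.restrict Ω)) (hR : ∀ x, ‖w x‖ ≤ R)
    {Φ : E → F} (hΦ : ContDiff ℝ ∞ Φ) (hg : MemLp g 2 (volume.restrict Ω)) :
    MemLp (fun x => fderiv ℝ Φ (w x) (g x)) 2 (volume.restrict Ω) := by
  obtain ⟨B, hB⟩ := exists_bound_fderiv_of_bounded hR hΦ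
  refine (hg.norm.const_mul B).mono ?_ (Eventually.of_forall fun x => ?_)
  · exact isBoundedBilinearMap_apply.continuous.comp_aestronglyMeasurable
      (((hΦ.continuous_fderiv (by simp)).comp_aestronglyMeasurable hm).prodMk
        hg.aestronglyMeasurable)
  · refine ((ContinuousLinearMap.le_opNorm _ _).trans
      (mul_le_mul_of_nonneg_right (hB x).2 (norm_nonneg _))).trans ?_
    exact le_abs_self _

/-- A smooth function of a bounded `H¹` function is of class `H¹`. -/
lemma MemH1.comp_of_bounded [FiniteDimensional ℝ E] [CompleteSpace F]
    {Ω : Set Vec3} (hΩ : IsOpen Ω) (hfin : volume Ω ≠ ⊤)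
    {w : Vec3 → E} (hw : MemH1 Ω w) {R : ℝ}
    (hR : ∀ x, ‖w x‖ ≤ R) {Φ : E → F} (hΦ : ContDiff ℝ ∞ Φ) :
    MemH1 Ω (fun x => Φ (w x)) := by
  obtain ⟨hw2, G, hG, hG2⟩ := hw
  obtain ⟨B, hB⟩ := exists_bound_fderiv_of_bounded hR hΦ
  have : IsFiniteMeasure (volume.restrict Ω) := ⟨by simpa using hfin.lt_top⟩
  exact ⟨MemLp.of_bound (hΦ.continuous.comp_aestronglyMeasurable hw2.aestronglyMeasurable) B
    (Eventually.of_forall fun x => (hB x).1), _, hG.comp_of_bounded hΩ hR hΦ,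
    fun k => memLp_fderiv_apply hw2.aestronglyMeasurable hR hΦ (hG2 k)⟩

lemma MemH1.isWeakGradient_weakGrad {Ω : Set Vec3} {w : Vec3 → E} (hw : MemH1 Ω w) :
    IsWeakGradient Ω w (weakGrad Ω w) := by
  obtain ⟨-, G, hG, -⟩ := hw
  have h : ∃ G, IsWeakGradient Ω w G := ⟨G, hG⟩
  rw [weakGrad, dif_pos h]
  exact h.choose_spec

/-- The gradient picked by choice need not be the one known to be square integrable; uniqueness
almost everywhere transfers the integrability. -/
lemma MemH1.memLp_weakGrad [CompleteSpace E] {Ω : Set Vec3} (hΩ : IsOpen Ω) {w : Vec3 → E}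
    (hw : MemH1 Ω w) (k : Fin 3) : MemLp (weakGrad Ω w k) 2 (volume.restrict Ω) := by
  have h := hw.isWeakGradient_weakGrad
  obtain ⟨-, G, hG, hG2⟩ := hw
  exact (memLp_congr_ae (hG.ae_eq hΩ h k)).mp (hG2 k)

end ChainRule

/-! ### Algebra of Q-tensors -/

section QTensorAlgebra

lemma QTensor.mat_symm (q : QTensor) (i j : Fin 3) : q.mat i j = q.mat j i := q.2.1 i j

lemma QTensor.mat_trace (q : QTensor) : q.mat.trace = 0 := q.2.2

lemma QTensor.trace_sq (q : QTensor) : (q.mat ^ 2).trace = ‖q‖ ^ 2 := by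
  rw [Submodule.coe_norm, EuclideanSpace.real_norm_sq_eq, Fintype.sum_prod_type]
  simp only [pow_two, Matrix.trace, Matrix.diag_apply, Matrix.mul_apply]
  refine Finset.sum_congr rfl fun i _ => Finset.sum_congr rfl fun j _ => ?_
  rw [q.mat_symm j i]
  rfl

/-- The difference of the two sides is twice the discriminant `((x - y)(y - z)(x - z))²`, which
vanishes exactly when two of the numbers coincide. -/
lemma sum_cube_sq_le_of_sum_eq_zero {x y z : ℝ} (h : x + y + z = 0) :
    6 * (x ^ 3 + y ^ 3 + z ^ 3) ^ 2 ≤ (x ^ 2 + y ^ 2 + z ^ 2) ^ 3 := by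
  obtain rfl : z = -x - y := by linarith
  have : (x ^ 2 + y ^ 2 + (-x - y) ^ 2) ^ 3 - 6 * (x ^ 3 + y ^ 3 + (-x - y) ^ 3) ^ 2 =
      2 * ((x - y) * (x + 2 * y) * (2 * x + y)) ^ 2 := by ring
  have := sq_nonneg ((x - y) * (x + 2 * y) * (2 * x + y))
  linarith

/-- The spectral theorem: the numbers are the eigenvalues, which turns trace inequalities into
inequalities for three reals. -/
lemma QTensor.trace_pow (q : QTensor) : ∃ v : Fin 3 → ℝ, ∀ n : ℕ, (q.mat ^ n).trace = ∑ i, v i ^ n := by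
  have hA : q.mat.IsHermitian := by
    ext i j; simp [Matrix.conjTranspose_apply, q.mat_symm i j]
  refine ⟨hA.eigenvalues, fun n => ?_⟩
  conv_lhs => rw [hA.spectral_theorem, ← map_pow, Matrix.diagonal_pow]
  rw [Unitary.conjStarAlgAut_apply, Matrix.trace_mul_comm, ← mul_assoc]
  simp [Matrix.trace]

lemma QTensor.trace_cube_sq_le (q : QTensor) : 6 * (q.mat ^ 3).trace ^ 2 ≤ (‖q‖ ^ 2) ^ 3 := by
  obtain ⟨v, hv⟩ := q.trace_pow
  rw [← q.trace_sq, hv, hv]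
  have h1 := hv 1
  rw [pow_one, q.mat_trace] at h1
  simp only [Fin.sum_univ_three, pow_one] at h1 ⊢
  exact sum_cube_sq_le_of_sum_eq_zero h1.symm

/-- At fixed norm only the cubic term varies, and it enters with the sign of `-b`. Its trace is
largest, equal to `2s³/9`, on uniaxial tensors of nonnegative order, by `QTensor.trace_cube_sq_le`.
-/
lemma uniaxialEnergy_le_bulkEnergy {a b c : ℝ} (hb : 0 ≤ b) {q : QTensor} {s : ℝ} (hs : 0 ≤ s)
    (hq : ‖q‖ ^ 2 = 2 / 3 * s ^ 2) : uniaxialEnergy a b c s ≤ bulkEnergy a b c q := by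
  have h := q.trace_cube_sq_le
  have ht : (q.mat ^ 3).trace ≤ 2 / 9 * s ^ 3 := by
    refine le_of_sq_le_sq ?_ (by positivity)
    rw [hq] at h
    nlinarith
  rw [bulkEnergy, uniaxialEnergy, q.trace_sq, hq]
  have := mul_le_mul_of_nonneg_left ht hb
  nlinarith

lemma norm_sphere (e : S2) : ∑ i, e.1 i * e.1 i = 1 := by
  have h : ‖e.1‖ = 1 := by simp
  have h2 := EuclideanSpace.real_norm_sq_eq e.1
  rw [h] at h2
  simpa [pow_two] using h2.symm

lemma smul_director_mat (s : ℝ) (e : S2) : QTensor.mat (s • director e) =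
    s • (Matrix.vecMulVec e.1 e.1 - (1 / 3 : ℝ) • (1 : Matrix (Fin 3) (Fin 3) ℝ)) := by
  ext i j
  simp only [QTensor.mat, director, Matrix.of_apply, Matrix.smul_apply, Matrix.sub_apply,
    Matrix.vecMulVec_apply, Matrix.one_apply, smul_eq_mul]
  by_cases h : i = j <;> simp [h]

/-- All powers are computable because `e ⊗ e` is a projection of trace one. -/
lemma trace_director (s : ℝ) (e : S2) :
    (QTensor.mat (s • director e) ^ 2).trace = 2 / 3 * s ^ 2 ∧
    (QTensor.mat (s • director e) ^ 3).trace = 2 / 9 * s ^ 3 := by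
  rw [smul_director_mat]
  set P := Matrix.vecMulVec e.1 e.1 with hP
  have hdot : e.1.ofLp ⬝ᵥ e.1.ofLp = 1 := norm_sphere e
  have hPP : P * P = P := by
    rw [hP, Matrix.vecMulVec_mul_vecMulVec, hdot, one_smul]
  have htr : P.trace = 1 := by
    rw [hP, Matrix.trace_vecMulVec, hdot]
  have h2 : (P - (1 / 3 : ℝ) • 1) ^ 2 = (1 / 3 : ℝ) • P + (1 / 9 : ℝ) • 1 := by
    rw [pow_two, sub_mul, mul_sub, mul_sub, hPP]
    simp only [mul_smul_comm, smul_mul_assoc, mul_one, one_mul, smul_smul]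
    module
  have h3 : (P - (1 / 3 : ℝ) • 1) ^ 3 = (1 / 3 : ℝ) • P - (1 / 27 : ℝ) • 1 := by
    rw [pow_succ, h2, add_mul, mul_sub, mul_sub]
    simp only [mul_smul_comm, smul_mul_assoc, mul_one, one_mul, smul_smul, hPP]
    module
  rw [smul_pow, smul_pow, h2, h3]
  simp only [Matrix.trace_smul, Matrix.trace_add, Matrix.trace_sub, Matrix.trace_one, htr,
    Fintype.card_fin, smul_eq_mul]
  constructor <;> norm_num <;> ring

lemma bulkEnergy_smul_director (a b c s : ℝ) (e : S2) :
    bulkEnergy a b c (s • director e) = uniaxialEnergy a b c s := by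
  obtain ⟨h2, h3⟩ := trace_director s e
  rw [bulkEnergy, uniaxialEnergy, h2, h3]
  ring

lemma norm_sq_smul_director (s : ℝ) (e : S2) : ‖s • director e‖ ^ 2 = 2 / 3 * s ^ 2 := by
  rw [← QTensor.trace_sq, (trace_director s e).1]

lemma norm_sq_director (e : S2) : ‖director e‖ ^ 2 = 2 / 3 := by
  simpa using norm_sq_smul_director 1 e

lemma norm_director_le (e : S2) : ‖director e‖ ≤ 1 := by
  have := norm_sq_director e
  nlinarith [norm_nonneg (director e)]

lemma continuous_bulkEnergy (a b c : ℝ) : Continuous (bulkEnergy a b c) := by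
  have h : Continuous QTensor.mat := by
    refine continuous_matrix fun i j => ?_
    change Continuous fun q : QTensor => q.1 (i, j)
    fun_prop
  unfold bulkEnergy
  have h2 : Continuous fun q : QTensor => (q.mat ^ 2).trace := (h.pow 2).matrix_trace
  have h3 : Continuous fun q : QTensor => (q.mat ^ 3).trace := (h.pow 3).matrix_trace
  fun_prop

/-- Coordinates on the space of Q-tensors. -/
def qCoordinates : QTensor ≃ₗ[ℝ] (Fin 5 → ℝ) where
  toFun q := ![q.1 (0, 0), q.1 (1, 1), q.1 (0, 1), q.1 (0, 2), q.1 (1, 2)]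
  map_add' p q := by ext i; fin_cases i <;> simp
  map_smul' r q := by ext i; fin_cases i <;> simp
  invFun x := ⟨WithLp.toLp 2 fun ij =>
      (!![x 0, x 2, x 3; x 2, x 1, x 4; x 3, x 4, -x 0 - x 1] : Matrix (Fin 3) (Fin 3) ℝ) ij.1 ij.2,
    by
      refine ⟨fun i j => ?_, ?_⟩
      · fin_cases i <;> fin_cases j <;> simp
      · simp [Fin.sum_univ_three]⟩
  left_inv q := by
    obtain ⟨q, hq, hq'⟩ := q
    simp only [Fin.sum_univ_three] at hq'
    ext ⟨i, j⟩
    fin_cases i <;> fin_cases j <;>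
      simp [hq 1 0, hq 2 0, hq 2 1]
    linarith
  right_inv x := by ext i; fin_cases i <;> simp

/-- The dimension enters through the scaling of the mollifier, as `ε ^ 20 = (ε ^ 4) ^ 5`. -/
lemma finrank_QTensor : Module.finrank ℝ QTensor = 5 := by
  rw [qCoordinates.finrank_eq]; simp

end QTensorAlgebra

/-! ### The double well on uniaxial tensors -/

section DoubleWell

/-- The square root of the uniaxial energy between its wells. -/
noncomputable def uniaxialRoot (a b c s : ℝ) : ℝ := √c / 3 * (s * (sPlus a b c - s))

/-- The primitive of the weighted square root of the uniaxial energy. -/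
noncomputable def wellPrimitive (a b c s : ℝ) : ℝ :=
  2 / √3 * (√c / 3 * (sPlus a b c * s ^ 2 / 2 - s ^ 3 / 3))

variable {a b c : ℝ}

lemma sPlus_eq (hb : 0 < b) (habc : b ^ 2 = 27 * a * c) : sPlus a b c = b / (3 * c) := by
  have : b ^ 2 - 24 * a * c = (b / 3) ^ 2 := by linarith
  rw [sPlus, this, Real.sqrt_sq (by positivity)]
  by_cases hc : c = 0
  · simp [hc]
  · field_simp; norm_num

lemma sPlus_pos (hb : 0 < b) (hc : 0 < c) (habc : b ^ 2 = 27 * a * c) : 0 < sPlus a b c := by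
  rw [sPlus_eq hb habc]; positivity

lemma mul_sPlus (hb : 0 < b) (hc : 0 < c) (habc : b ^ 2 = 27 * a * c) :
    3 * c * sPlus a b c = b := by
  rw [sPlus_eq hb habc]; field_simp

lemma mul_sPlus_sq (hb : 0 < b) (hc : 0 < c) (habc : b ^ 2 = 27 * a * c) :
    c * sPlus a b c ^ 2 = 3 * a := by
  rw [sPlus_eq hb habc]; field_simp; linarith

lemma sqrt_mul_sPlus (hb : 0 < b) (hc : 0 < c) (habc : b ^ 2 = 27 * a * c) :
    √c * sPlus a b c = √3 * √a := by
  rw [← Real.sqrt_mul (by norm_num), ← mul_sPlus_sq hb hc habc, Real.sqrt_mul hc.le,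
    Real.sqrt_sq (sPlus_pos hb hc habc).le]

/-- The relation between `a`, `b`, `c` makes the quadratic factor have the double root `s₊`, so the
isotropic and nematic wells are equally deep. -/
lemma uniaxialEnergy_eq (hb : 0 < b) (hc : 0 < c) (habc : b ^ 2 = 27 * a * c) (s : ℝ) :
    uniaxialEnergy a b c s = uniaxialRoot a b c s ^ 2 := by
  rw [uniaxialEnergy, uniaxialRoot, mul_pow, div_pow, Real.sq_sqrt hc.le]
  linear_combination (2 / 27 * s ^ 3) * mul_sPlus hb hc habc - s ^ 2 / 9 * mul_sPlus_sq hb hc habc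

lemma uniaxialRoot_nonneg {s : ℝ} (h0 : 0 ≤ s) (h1 : s ≤ sPlus a b c) :
    0 ≤ uniaxialRoot a b c s := by
  have : 0 ≤ sPlus a b c - s := by linarith
  unfold uniaxialRoot; positivity

lemma hasDerivAt_wellPrimitive (s : ℝ) :
    HasDerivAt (wellPrimitive a b c) (2 / √3 * uniaxialRoot a b c s) s := by
  have h2 : HasDerivAt (fun s : ℝ => s ^ 2) (2 * s) s := by simpa using hasDerivAt_pow 2 s
  have h3 : HasDerivAt (fun s : ℝ => s ^ 3) (3 * s ^ 2) s := by simpa using hasDerivAt_pow 3 s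
  have := ((((h2.const_mul (sPlus a b c)).div_const 2).sub (h3.div_const 3)).const_mul
    (√c / 3)).const_mul (2 / √3)
  refine this.congr_deriv ?_
  rw [uniaxialRoot]; ring

lemma wellPrimitive_zero : wellPrimitive a b c 0 = 0 := by simp [wellPrimitive]

lemma continuous_uniaxialRoot : Continuous (uniaxialRoot a b c) := by
  unfold uniaxialRoot; fun_prop

lemma integral_uniaxialRoot (s t : ℝ) :
    ∫ τ in s..t, 2 / √3 * uniaxialRoot a b c τ = wellPrimitive a b c t - wellPrimitive a b c s :=
  intervalIntegral.integral_eq_sub_of_hasDerivAt (fun x _ => hasDerivAt_wellPrimitive x)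
    ((continuous_const.mul continuous_uniaxialRoot).intervalIntegrable _ _)

lemma surfaceTension_eq (hb : 0 < b) (hc : 0 < c) (habc : b ^ 2 = 27 * a * c) :
    surfaceTension a b c = wellPrimitive a b c (sPlus a b c) := by
  have hs := sPlus_pos hb hc habc
  rw [surfaceTension, ← intervalIntegral.integral_const_mul]
  have := integral_uniaxialRoot (a := a) (b := b) (c := c) 0 (sPlus a b c)
  rw [wellPrimitive_zero, sub_zero] at this
  rw [← this]
  refine intervalIntegral.integral_congr fun τ hτ => ?_
  rw [uIcc_of_le hs.le] at hτ
  simp only [uniaxialEnergy_eq hb hc habc, Real.sqrt_sq (uniaxialRoot_nonneg hτ.1 hτ.2)]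

lemma sqrt_uniaxialEnergy (hb : 0 < b) (hc : 0 < c) (habc : b ^ 2 = 27 * a * c) (s : ℝ) :
    √(2 * uniaxialEnergy a b c s) = √2 * |uniaxialRoot a b c s| := by
  rw [uniaxialEnergy_eq hb hc habc, Real.sqrt_mul (by norm_num), Real.sqrt_sq_eq_abs]

end DoubleWell

/-! ### The quasi-distance -/

section QuasiDistance

/-- The weighted speed of a curve of Q-tensors. -/
noncomputable def weightedSpeed (a b c : ℝ) (γ : ℝ → QTensor) (t : ℝ) : ℝ :=
  √(2 * bulkEnergy a b c (γ t)) * ‖deriv γ t‖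

/-- The lengths of admissible curves from the nematic manifold to `q`. -/
def lengthSet (a b c : ℝ) (q : QTensor) : Set ℝ :=
  {L | ∃ γ : ℝ → QTensor, (∃ K, LipschitzOnWith K γ (Icc 0 1)) ∧
    γ 0 ∈ nematic a b c ∧ γ 1 = q ∧ L = ∫ t in (0 : ℝ)..1, weightedSpeed a b c γ t}

variable {a b c : ℝ}

lemma weightedSpeed_nonneg (γ : ℝ → QTensor) (t : ℝ) : 0 ≤ weightedSpeed a b c γ t :=
  mul_nonneg (Real.sqrt_nonneg _) (norm_nonneg _)

lemma intervalIntegrable_weightedSpeed {γ : ℝ → QTensor} {K : NNReal}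
    (hγ : LipschitzOnWith K γ (Icc 0 1)) :
    IntervalIntegrable (weightedSpeed a b c γ) volume 0 1 := by
  have hc : ContinuousOn (fun t => √(2 * bulkEnergy a b c (γ t))) (Icc 0 1) :=
    (Real.continuous_sqrt.comp
      (continuous_const.mul (continuous_bulkEnergy a b c))).comp_continuousOn hγ.continuousOn
  obtain ⟨B, hB⟩ := isCompact_Icc.exists_bound_of_continuousOn hc
  rw [intervalIntegrable_iff_integrableOn_Ioo_of_le zero_le_one]
  refine IntegrableOn.of_bound (by simp) ?_ (B * K) ?_
  · exact ((hc.mono Ioo_subset_Icc_self).aestronglyMeasurable measurableSet_Ioo).mul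
      (stronglyMeasurable_deriv γ).norm.aestronglyMeasurable
  · rw [ae_restrict_iff' measurableSet_Ioo]
    refine Eventually.of_forall fun t ht => ?_
    rw [weightedSpeed, norm_mul, norm_norm]
    refine mul_le_mul (hB t (Ioo_subset_Icc_self ht)) ?_ (norm_nonneg _)
      ((norm_nonneg _).trans (hB t (Ioo_subset_Icc_self ht)))
    exact norm_deriv_le_of_lipschitzOn (Icc_mem_nhds ht.1 ht.2) hγ

lemma lengthSet_nonneg {q : QTensor} {L : ℝ} (hL : L ∈ lengthSet a b c q) : 0 ≤ L := by
  obtain ⟨γ, -, -, -, rfl⟩ := hL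
  exact intervalIntegral.integral_nonneg zero_le_one fun t _ => weightedSpeed_nonneg γ t

lemma bddBelow_lengthSet (q : QTensor) : BddBelow (lengthSet a b c q) :=
  ⟨0, fun _ hL => lengthSet_nonneg hL⟩

/-- Comparison of difference quotients. This avoids differentiating the norm along the curve, which
would be delicate at the zero tensor. -/
lemma abs_deriv_le_of_abs_sub_le {γ : ℝ → QTensor} {r : ℝ → ℝ} {C t : ℝ}
    (hr : ∀ s, |r s - r t| ≤ C * ‖γ s - γ t‖) (hγ : DifferentiableAt ℝ γ t)
    (hr' : DifferentiableAt ℝ r t) : |deriv r t| ≤ C * ‖deriv γ t‖ := by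
  have h1 := (hasDerivAt_iff_tendsto_slope.mp hγ.hasDerivAt).norm.const_mul C
  have h2 := (hasDerivAt_iff_tendsto_slope.mp hr'.hasDerivAt).norm
  refine le_of_tendsto_of_tendsto' h2 h1 fun s => ?_
  rw [slope_def_module, slope_def_module, norm_smul, norm_smul, mul_left_comm]
  exact mul_le_mul_of_nonneg_left (hr s) (norm_nonneg _)

lemma sqrt_three_halves_mul_norm_smul_director {s : ℝ} (hs : 0 ≤ s) (e : S2) :
    √(3 / 2) * ‖s • director e‖ = s := by
  refine (sq_eq_sq₀ (by positivity) hs).mp ?_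
  rw [mul_pow, norm_sq_smul_director, Real.sq_sqrt (by norm_num)]
  ring

/-- A one-dimensional calibration: along a curve, `W` of the rescaled norm `r = √(3/2) ‖γ‖` changes
no faster than the weighted speed. The scaling makes `r` the order of a uniaxial tensor, and the
constants match because `(2/√3) √(3/2) = √2`. -/
lemma wellPrimitive_sub_le_of_mem_lengthSet (hb : 0 < b) (hc : 0 < c)
    (habc : b ^ 2 = 27 * a * c) {q : QTensor} {L : ℝ} (hL : L ∈ lengthSet a b c q) :
    wellPrimitive a b c (sPlus a b c) - wellPrimitive a b c (√(3 / 2) * ‖q‖) ≤ L := by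
  obtain ⟨γ, ⟨K, hγ⟩, ⟨e, he⟩, h1, rfl⟩ := hL
  have hsp := sPlus_pos hb hc habc
  set r : ℝ → ℝ := fun t => √(3 / 2) * ‖γ t‖ with hr
  have hrac : AbsolutelyContinuousOnInterval r 0 1 := by
    have : LipschitzOnWith (1 * K) (fun t => ‖γ t‖) (uIcc 0 1) := by
      rw [uIcc_of_le zero_le_one]
      exact lipschitzWith_one_norm.comp_lipschitzOnWith hγ
    exact this.absolutelyContinuousOnInterval.const_mul _
  set h : ℝ → ℝ := fun t => wellPrimitive a b c (r t) with hh
  have hac : AbsolutelyContinuousOnInterval h 0 1 := by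
    -- `W` is a cubic polynomial, so absolute continuity of `W ∘ r` follows from that of products
    -- and holds for large `r` as well.
    have h2 := hrac.mul hrac
    have h3 := (h2.mul hrac).const_mul (2 / √3 * (√c / 3) / 3)
    have := (h2.const_mul (2 / √3 * (√c / 3) * sPlus a b c / 2)).sub h3
    refine (congrArg (AbsolutelyContinuousOnInterval · 0 1) (funext fun t => ?_)).mp this
    simp only [hh, wellPrimitive, Pi.sub_apply, Pi.mul_apply]
    ring
  have e1 := hac.integral_deriv_eq_sub
  have hae : ∀ᵐ t ∂volume.restrict (Icc (0 : ℝ) 1), -deriv h t ≤ weightedSpeed a b c γ t := by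
    have hd := hrac.ae_differentiableAt
    rw [uIcc_of_le zero_le_one] at hd
    -- The curve is controlled only on the closed interval, so two-sided derivatives make sense only
    -- at interior points.
    have hne : ∀ᵐ t : ℝ, t ≠ 0 ∧ t ≠ 1 :=
      (Measure.ae_ne volume (0 : ℝ)).and (Measure.ae_ne volume (1 : ℝ))
    rw [ae_restrict_iff' measurableSet_Icc]
    filter_upwards [hd, hne, hγ.ae_differentiableWithinAt_of_mem] with t h1 h2 h3 ht
    have hnhds : Icc (0 : ℝ) 1 ∈ 𝓝 t :=
      Icc_mem_nhds (lt_of_le_of_ne ht.1 h2.1.symm) (lt_of_le_of_ne ht.2 h2.2)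
    have hγd := (h3 ht).differentiableAt hnhds
    have hrd := h1 ht
    have hdr : |deriv r t| ≤ √(3 / 2) * ‖deriv γ t‖ := by
      refine abs_deriv_le_of_abs_sub_le (fun s => ?_) hγd hrd
      rw [hr]
      simp only
      rw [← mul_sub, abs_mul, abs_of_nonneg (Real.sqrt_nonneg _)]
      exact mul_le_mul_of_nonneg_left (abs_norm_sub_norm_le _ _) (Real.sqrt_nonneg _)
    have hdh : deriv h t = 2 / √3 * uniaxialRoot a b c (r t) * deriv r t :=
      ((hasDerivAt_wellPrimitive (r t)).comp t hrd.hasDerivAt).deriv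
    have hF : √2 * |uniaxialRoot a b c (r t)| ≤ √(2 * bulkEnergy a b c (γ t)) := by
      rw [← sqrt_uniaxialEnergy hb hc habc]
      refine Real.sqrt_le_sqrt (mul_le_mul_of_nonneg_left ?_ (by norm_num))
      refine uniaxialEnergy_le_bulkEnergy hb.le (by positivity) ?_
      rw [hr, mul_pow, Real.sq_sqrt (by norm_num)]
      ring
    calc -deriv h t ≤ |deriv h t| := neg_le_abs _
      _ = 2 / √3 * |uniaxialRoot a b c (r t)| * |deriv r t| := by
        rw [hdh, abs_mul, abs_mul, abs_of_nonneg (by positivity : 0 ≤ 2 / √3)]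
      _ ≤ 2 / √3 * |uniaxialRoot a b c (r t)| * (√(3 / 2) * ‖deriv γ t‖) := by gcongr
      _ = √2 * |uniaxialRoot a b c (r t)| * ‖deriv γ t‖ := by
        have : 2 / √3 * √(3 / 2) = √2 := by
          rw [Real.sqrt_div (by norm_num)]
          field_simp
          norm_num
        rw [← this]; ring
      _ ≤ _ := mul_le_mul_of_nonneg_right hF (norm_nonneg _)
  have e2 := intervalIntegral.integral_mono_ae_restrict zero_le_one
    hac.intervalIntegrable_deriv.neg (intervalIntegrable_weightedSpeed hγ) hae
  rw [show (∫ t in (0 : ℝ)..1, (-deriv h) t) = -∫ t in (0 : ℝ)..1, deriv h t from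
    intervalIntegral.integral_neg, e1] at e2
  have r0 : r 0 = sPlus a b c := by
    rw [hr]; simp only [he]; exact sqrt_three_halves_mul_norm_smul_director hsp.le e
  have r1 : r 1 = √(3 / 2) * ‖q‖ := by rw [hr]; simp only [h1]
  rw [hh] at e2
  simp only [r0, r1] at e2
  linarith

/-- The segment from `s₊` to `s` with fixed director is an optimal curve: along it the weighted
speed is exactly the derivative of `-W`. -/
lemma mem_lengthSet_smul_director (hb : 0 < b) (hc : 0 < c) (habc : b ^ 2 = 27 * a * c)
    {s : ℝ} (hs : 0 ≤ s) (hs' : s ≤ sPlus a b c) (e : S2) :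
    wellPrimitive a b c (sPlus a b c) - wellPrimitive a b c s ∈ lengthSet a b c (s • director e) := by
  set p := sPlus a b c with hp
  have hγ : ∀ t, HasDerivAt (fun t : ℝ => (p + t * (s - p)) • director e)
      ((s - p) • director e) t := fun t => by
    have h1 : HasDerivAt (fun t : ℝ => p + t * (s - p)) (s - p) t := by
      simpa using ((hasDerivAt_id t).mul_const (s - p)).const_add p
    exact h1.smul_const (director e)
  refine ⟨fun t => (p + t * (s - p)) • director e, ⟨‖(s - p) • director e‖₊, ?_⟩,
    ⟨e, by simp [hp]⟩, by simp, ?_⟩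
  · refine (lipschitzWith_of_nnnorm_deriv_le (fun t => (hγ t).differentiableAt)
      fun t => ?_).lipschitzOnWith
    rw [(hγ t).deriv]
  · have hn : ‖(s - p) • director e‖ = √(2 / 3) * (p - s) := by
      refine (sq_eq_sq₀ (norm_nonneg _) (mul_nonneg (Real.sqrt_nonneg _) (by linarith))).mp ?_
      rw [norm_sq_smul_director, mul_pow, Real.sq_sqrt (by norm_num)]
      ring
    have hd : ∀ t ∈ uIcc (0 : ℝ) 1, HasDerivAt (fun t => -wellPrimitive a b c (p + t * (s - p)))
        (weightedSpeed a b c (fun t => (p + t * (s - p)) • director e) t) t := fun t ht => by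
      rw [uIcc_of_le zero_le_one] at ht
      have h1 : HasDerivAt (fun t : ℝ => p + t * (s - p)) (s - p) t := by
        simpa using ((hasDerivAt_id t).mul_const (s - p)).const_add p
      refine ((hasDerivAt_wellPrimitive _).comp t h1).neg.congr_deriv ?_
      rw [weightedSpeed, (hγ t).deriv, hn, bulkEnergy_smul_director,
        sqrt_uniaxialEnergy hb hc habc, abs_of_nonneg (uniaxialRoot_nonneg
          (by nlinarith [ht.1, ht.2]) (by nlinarith [ht.1, ht.2]))]
      have : √2 * √(2 / 3) = 2 / √3 := by
        rw [Real.sqrt_div (by norm_num), ← mul_div_assoc, Real.mul_self_sqrt (by norm_num)]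
      rw [← this]; ring
    rw [intervalIntegral.integral_eq_sub_of_hasDerivAt hd]
    · simp
      ring
    · refine intervalIntegrable_weightedSpeed (K := ‖(s - p) • director e‖₊) ?_
      refine (lipschitzWith_of_nnnorm_deriv_le (fun t => (hγ t).differentiableAt)
        fun t => ?_).lipschitzOnWith
      rw [(hγ t).deriv]

/-- Prolongation of an admissible curve by a segment. -/
lemma add_segment_mem_lengthSet {p q : QTensor} {L : ℝ} (hL : L ∈ lengthSet a b c p) :
    L + ∫ t in (0 : ℝ)..1, √(2 * bulkEnergy a b c (p + t • (q - p))) * ‖q - p‖ ∈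
      lengthSet a b c q := by
  obtain ⟨γ, ⟨K, hγ⟩, h0, h1, rfl⟩ := hL
  -- The given curve at double speed on the first half, the segment at double speed on the second.
  -- Clamping with `min` and `max` gives one formula whose Lipschitz bound needs no gluing.
  set g : ℝ → QTensor := fun t => γ (min (2 * t) 1) + max (2 * t - 1) 0 • (q - p) with hg
  have hgl : ∃ K', LipschitzOnWith K' g (Icc 0 1) := by
    have l1 : LipschitzWith 2 (fun t : ℝ => 2 * t) :=
      LipschitzWith.of_dist_le_mul fun x y => by
        rw [Real.dist_eq, Real.dist_eq, ← mul_sub, abs_mul]; simp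
    have l2 : LipschitzWith 2 (fun t : ℝ => min (2 * t) 1) := by simpa using l1.min_const 1
    have l3 : LipschitzWith 2 (fun t : ℝ => max (2 * t - 1) 0) := by
      have : LipschitzWith 2 (fun t : ℝ => 2 * t - 1) :=
        LipschitzWith.of_dist_le_mul fun x y => by
          rw [Real.dist_eq, Real.dist_eq, sub_sub_sub_cancel_right, ← mul_sub, abs_mul]; simp
      simpa using this.max_const 0
    have l4 : LipschitzOnWith (K * 2) (fun t => γ (min (2 * t) 1)) (Icc 0 1) :=
      hγ.comp l2.lipschitzOnWith fun t ht =>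
        ⟨le_min (by linarith [ht.1]) zero_le_one, min_le_right _ _⟩
    have l5 : LipschitzWith (‖q - p‖₊ * 2) (fun t : ℝ => max (2 * t - 1) 0 • (q - p)) :=
      LipschitzWith.of_dist_le_mul fun x y => by
        rw [dist_eq_norm, ← sub_smul, norm_smul, mul_comm, NNReal.coe_mul, mul_assoc]
        exact mul_le_mul_of_nonneg_left (l3.dist_le_mul x y) (norm_nonneg _)
    exact ⟨_, l4.add l5.lipschitzOnWith⟩
  refine ⟨g, hgl, by simpa [hg] using h0, by norm_num [hg, h1], ?_⟩
  obtain ⟨K', hgK⟩ := hgl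
  have hi := intervalIntegrable_weightedSpeed (a := a) (b := b) (c := c) hgK
  have half : (1 / 2 : ℝ) ∈ uIcc (0 : ℝ) 1 := by
    rw [uIcc_of_le zero_le_one]; constructor <;> norm_num
  rw [← intervalIntegral.integral_add_adjacent_intervals (b := (1 / 2 : ℝ))
    (hi.mono_set (uIcc_subset_uIcc left_mem_uIcc half))
    (hi.mono_set (uIcc_subset_uIcc half right_mem_uIcc))]
  congr 1
  · have : ∫ t in (0 : ℝ)..1 / 2, weightedSpeed a b c g t =
        ∫ t in (0 : ℝ)..1 / 2, 2 * weightedSpeed a b c γ (2 * t) := by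
      refine intervalIntegral.integral_congr_ae ?_
      filter_upwards [Measure.ae_ne volume (1 / 2 : ℝ)] with t ht htI
      rw [uIoc_of_le (by norm_num)] at htI
      have hlt : t < 1 / 2 := lt_of_le_of_ne htI.2 ht
      have hev : g =ᶠ[𝓝 t] fun t => γ (2 * t) := by
        filter_upwards [Iio_mem_nhds hlt] with s (hs : s < 1 / 2)
        rw [hg]
        simp only
        rw [min_eq_left (by linarith), max_eq_right (by linarith), zero_smul, add_zero]
      rw [weightedSpeed, weightedSpeed, hev.deriv_eq, hev.self_of_nhds, deriv_comp_mul_left,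
        norm_smul]
      norm_num
      ring
    rw [this, intervalIntegral.integral_const_mul,
      intervalIntegral.integral_comp_mul_left (f := weightedSpeed a b c γ) two_ne_zero]
    norm_num
    ring
  · have : ∫ t in (1 / 2 : ℝ)..1, weightedSpeed a b c g t =
        ∫ t in (1 / 2 : ℝ)..1, 2 * (√(2 * bulkEnergy a b c (p + (2 * t - 1) • (q - p))) *
          ‖q - p‖) := by
      refine intervalIntegral.integral_congr_ae (Eventually.of_forall fun t htI => ?_)
      rw [uIoc_of_le (by norm_num)] at htI
      have hev : g =ᶠ[𝓝 t] fun t => p + (2 * t - 1) • (q - p) := by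
        filter_upwards [Ioi_mem_nhds htI.1] with s (hs : 1 / 2 < s)
        rw [hg]
        simp only
        rw [min_eq_right (by linarith), max_eq_left (by linarith), h1]
      have hd : HasDerivAt (fun t : ℝ => p + (2 * t - 1) • (q - p)) ((2 : ℝ) • (q - p)) t := by
        have h2 : HasDerivAt (fun t : ℝ => 2 * t - 1) 2 t := by
          simpa using ((hasDerivAt_id t).const_mul 2).sub_const 1
        exact (h2.smul_const (q - p)).const_add p
      rw [weightedSpeed, hev.deriv_eq, hev.self_of_nhds, hd.deriv, norm_smul]
      norm_num
      ring
    rw [this, intervalIntegral.integral_const_mul, intervalIntegral.integral_comp_mul_sub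
      (f := fun t : ℝ => √(2 * bulkEnergy a b c (p + t • (q - p))) * ‖q - p‖) two_ne_zero]
    norm_num
    ring

lemma exists_sphere : Nonempty S2 := ⟨⟨EuclideanSpace.single 0 1, by simp⟩⟩

lemma lengthSet_nonempty (hb : 0 < b) (hc : 0 < c) (habc : b ^ 2 = 27 * a * c) (q : QTensor) :
    (lengthSet a b c q).Nonempty := by
  obtain ⟨e⟩ := exists_sphere
  exact ⟨_, add_segment_mem_lengthSet
    (mem_lengthSet_smul_director hb hc habc (sPlus_pos hb hc habc).le le_rfl e)⟩

lemma quasiDist_smul_director (hb : 0 < b) (hc : 0 < c) (habc : b ^ 2 = 27 * a * c)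
    {s : ℝ} (hs : 0 ≤ s) (hs' : s ≤ sPlus a b c) (e : S2) :
    quasiDist a b c (s • director e) =
      wellPrimitive a b c (sPlus a b c) - wellPrimitive a b c s := by
  refine le_antisymm (csInf_le (bddBelow_lengthSet _)
    (mem_lengthSet_smul_director hb hc habc hs hs' e)) ?_
  refine le_csInf (lengthSet_nonempty hb hc habc _) fun L hL => ?_
  have := wellPrimitive_sub_le_of_mem_lengthSet hb hc habc hL
  rwa [sqrt_three_halves_mul_norm_smul_director hs] at this

/-- The quasi-distance is locally Lipschitz. -/
lemma exists_lipschitz_quasiDist (hb : 0 < b) (hc : 0 < c) (habc : b ^ 2 = 27 * a * c) (R : ℝ) :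
    ∃ B, 0 ≤ B ∧ ∀ p ∈ closedBall (0 : QTensor) R, ∀ q ∈ closedBall (0 : QTensor) R,
      |quasiDist a b c q - quasiDist a b c p| ≤ B * ‖q - p‖ := by
  have hcont : Continuous fun q => √(2 * bulkEnergy a b c q) :=
    Real.continuous_sqrt.comp (continuous_const.mul (continuous_bulkEnergy a b c))
  obtain ⟨B, hB⟩ := (isCompact_closedBall (0 : QTensor) R).exists_bound_of_continuousOn
    hcont.continuousOn
  -- One inequality suffices by symmetry. Appending a segment costs at most its length times the
  -- maximum of the weight, as balls are convex.
  have one : ∀ p ∈ closedBall (0 : QTensor) R, ∀ q ∈ closedBall (0 : QTensor) R,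
      quasiDist a b c q ≤ quasiDist a b c p + max B 0 * ‖q - p‖ := by
    intro p hp q hq
    rw [← sub_le_iff_le_add]
    refine le_csInf (lengthSet_nonempty hb hc habc p) fun L hL => ?_
    rw [sub_le_iff_le_add]
    refine (csInf_le (bddBelow_lengthSet q) (add_segment_mem_lengthSet hL)).trans ?_
    gcongr
    have hle : ∫ t in (0 : ℝ)..1, √(2 * bulkEnergy a b c (p + t • (q - p))) * ‖q - p‖ ≤
        ∫ t in (0 : ℝ)..1, max B 0 * ‖q - p‖ := by
      refine intervalIntegral.integral_mono_on zero_le_one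
        (((hcont.comp (by fun_prop : Continuous fun t : ℝ => p + t • (q - p))).mul
          continuous_const).intervalIntegrable _ _) (by simp) fun t ht => ?_
      refine mul_le_mul_of_nonneg_right ?_ (norm_nonneg _)
      have hmem : p + t • (q - p) ∈ closedBall (0 : QTensor) R :=
        (convex_closedBall (0 : QTensor) R).add_smul_sub_mem hp hq ht
      exact (le_abs_self _).trans ((hB _ hmem).trans (le_max_left _ _))
    simpa using hle
  refine ⟨max B 0, le_max_right _ _, fun p hp q hq => abs_le.mpr ⟨?_, ?_⟩⟩
  · have := one q hq p hp
    rw [norm_sub_rev] at this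
    linarith
  · linarith [one p hp q hq]

lemma continuous_quasiDist (hb : 0 < b) (hc : 0 < c) (habc : b ^ 2 = 27 * a * c) :
    Continuous (quasiDist a b c) := by
  rw [continuous_iff_continuousAt]
  intro p
  obtain ⟨B, -, hB⟩ := exists_lipschitz_quasiDist hb hc habc (‖p‖ + 1)
  have hp : p ∈ closedBall (0 : QTensor) (‖p‖ + 1) := by simp
  refine tendsto_iff_norm_sub_tendsto_zero.mpr ?_
  have hlim : Tendsto (fun q => B * ‖q - p‖) (𝓝 p) (𝓝 0) := by
    have : Continuous fun q : QTensor => B * ‖q - p‖ := by fun_prop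
    simpa using this.tendsto p
  refine tendsto_of_tendsto_of_tendsto_of_le_of_le' tendsto_const_nhds hlim
    (Eventually.of_forall fun _ => norm_nonneg _) ?_
  filter_upwards [ball_mem_nhds p one_pos] with q hq
  refine hB p hp q ?_
  rw [mem_ball, dist_eq_norm] at hq
  rw [mem_closedBall_zero_iff]
  have := norm_add_le p (q - p)
  rw [add_sub_cancel] at this
  linarith

instance isAddHaarMeasure_qMeasure : qMeasure.IsAddHaarMeasure := by
  unfold qMeasure; infer_instance

/-! ### The mollified quasi-distance. -/

variable {η : QTensor → ℝ} {ε : ℝ}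

lemma support_scaled_mollifier (hη : IsIsotropicMollifier η) (hε : 0 < ε) :
    Function.support (fun q => (ε ^ 20)⁻¹ * η ((ε ^ 4)⁻¹ • q)) ⊆ ball 0 (ε ^ 4) := by
  intro q hq
  have h1 : η ((ε ^ 4)⁻¹ • q) ≠ 0 := fun h => hq (by simp [h])
  have h2 := hη.support (subset_tsupport η h1)
  rw [mem_ball_zero_iff, norm_smul, norm_inv, Real.norm_of_nonneg (by positivity),
    inv_mul_lt_iff₀ (by positivity), mul_one] at h2
  simpa using h2

lemma contDiff_quasiDistReg (hb : 0 < b) (hc : 0 < c) (habc : b ^ 2 = 27 * a * c)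
    (hη : IsIsotropicMollifier η) (hε : 0 < ε) : ContDiff ℝ ∞ (quasiDistReg a b c η ε) := by
  have hcs : HasCompactSupport (fun q => (ε ^ 20)⁻¹ * η ((ε ^ 4)⁻¹ • q)) :=
    HasCompactSupport.of_support_subset_isCompact (isCompact_closedBall (0 : QTensor) (ε ^ 4))
      ((support_scaled_mollifier hη hε).trans ball_subset_closedBall)
  have hsm : ContDiff ℝ ∞ (fun q => (ε ^ 20)⁻¹ * η ((ε ^ 4)⁻¹ • q)) :=
    contDiff_const.mul (hη.smooth.comp (contDiff_const_smul _))
  exact hcs.contDiff_convolution_left (n := ⊤) _ hsm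
    (continuous_quasiDist hb hc habc).locallyIntegrable

/-- Mollification changes the quasi-distance by `O(ε ^ 4)` on bounded sets. -/
lemma exists_dist_quasiDistReg_le (hb : 0 < b) (hc : 0 < c) (habc : b ^ 2 = 27 * a * c) (R : ℝ) :
    ∃ B, 0 ≤ B ∧ ∀ η, IsIsotropicMollifier η → ∀ ε, 0 < ε → ε ≤ 1 →
      ∀ q ∈ closedBall (0 : QTensor) R,
        |quasiDistReg a b c η ε q - quasiDist a b c q| ≤ B * ε := by
  -- The mollifier reaches no further than `ε ^ 4 ≤ 1`, hence the enlarged radius. The Lipschitz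
  -- constant does not see the mollifier.
  obtain ⟨B, hB0, hB⟩ := exists_lipschitz_quasiDist hb hc habc (R + 1)
  refine ⟨B, hB0, fun η hη ε hε hε1 q hq => ?_⟩
  have hε4 : ε ^ 4 ≤ ε := by
    simpa using pow_le_pow_of_le_one hε.le hε1 (show 1 ≤ 4 by norm_num)
  have hmass : ∫ p, (ε ^ 20)⁻¹ * η ((ε ^ 4)⁻¹ • p) ∂qMeasure = 1 := by
    rw [integral_const_mul, Measure.integral_comp_inv_smul_of_nonneg _ _ (by positivity),
      finrank_QTensor, hη.mass, ← pow_mul]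
    simp [hε.ne']
  rw [mem_closedBall_zero_iff] at hq
  have := dist_convolution_le (μ := qMeasure) (g := quasiDist a b c) (x₀ := q)
    (z₀ := quasiDist a b c q) (ε := B * ε) (R := ε ^ 4) (by positivity)
    (support_scaled_mollifier hη hε)
    (fun p => mul_nonneg (by positivity) (hη.nonneg _)) hmass
    (continuous_quasiDist hb hc habc).aestronglyMeasurable (fun p hp => by
      rw [mem_ball, dist_eq_norm] at hp
      have h2 := norm_add_le q (p - q)
      rw [add_sub_cancel] at h2
      refine (hB q (mem_closedBall_zero_iff.mpr (by linarith)) p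
        (mem_closedBall_zero_iff.mpr (by linarith))).trans ?_
      exact mul_le_mul_of_nonneg_left (by linarith) hB0)
  exact this

end QuasiDistance

/-! ### Geometry of the interface -/

section Geometry

/-- The segment between the two points is connected, so it meets the frontier, and the crossing
point is no further from either end than the ends are from each other. -/
lemma infDist_frontier_le_dist {U : Set Vec3} (hU : IsOpen U) {x y : Vec3} (hx : x ∈ U)
    (hy : y ∉ U) : infDist x (frontier U) ≤ dist x y ∧ infDist y (frontier U) ≤ dist x y := by
  obtain ⟨z, hz, hzU⟩ : (segment ℝ x y ∩ frontier U).Nonempty := by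
    by_contra hne
    rw [not_nonempty_iff_eq_empty] at hne
    have hcl : ∀ z ∈ segment ℝ x y, z ∈ closure U → z ∈ U := fun z hz hzc => by
      by_contra hzU
      have : z ∈ segment ℝ x y ∩ frontier U := ⟨hz, by rw [hU.frontier_eq]; exact ⟨hzc, hzU⟩⟩
      rw [hne] at this
      exact this
    obtain ⟨z, -, hz1, hz2⟩ := (convex_segment (𝕜 := ℝ) x y).isPreconnected U (closure U)ᶜ hU
      isClosed_closure.isOpen_compl
      (fun z hz => by
        by_cases h : z ∈ closure U
        · exact Or.inl (hcl z hz h)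
        · exact Or.inr h)
      ⟨x, left_mem_segment ℝ x y, hx⟩
      ⟨y, right_mem_segment ℝ x y, fun h => hy (hcl y (right_mem_segment ℝ x y) h)⟩
    exact hz2 (subset_closure hz1)
  have hd := dist_add_dist_of_mem_segment hz
  have h1 := infDist_le_dist_of_mem (x := x) hzU
  have h2 := infDist_le_dist_of_mem (x := y) hzU
  rw [dist_comm y z] at h2
  have := dist_nonneg (x := x) (y := z)
  have := dist_nonneg (x := z) (y := y)
  constructor <;> linarith

/-- Smooth boundaries are accessible from the exterior. -/
lemma HasSmoothBoundary.frontier_subset_closure {U Ω : Set Vec3} (hU : IsOpen U)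
    (h : HasSmoothBoundary U) (hΩ : IsOpen Ω) (hUΩ : closure U ⊆ Ω) :
    frontier U ⊆ closure (Ω \ closure U) := by
  intro p hp
  obtain ⟨V, ρ, hV, hpV, hρ, hρ', hUV⟩ := h p hp
  have hpU : p ∉ U := by rw [hU.frontier_eq] at hp; exact hp.2
  have hρp : ρ p ≤ 0 := by
    by_contra hpos
    have : p ∈ U ∩ V := by rw [hUV]; exact ⟨hpV, not_le.mp hpos⟩
    exact hpU this.1
  -- A nonzero functional is negative somewhere; leaving `p` in such a direction makes the defining
  -- function negative, hence leaves the closure of `U`.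
  obtain ⟨v, hv⟩ : ∃ v, fderiv ℝ ρ p v < 0 := by
    by_contra! hcon
    refine hρ' (ContinuousLinearMap.ext fun v => le_antisymm ?_ (hcon v))
    have := hcon (-v)
    rw [map_neg] at this
    simpa using this
  have hdiff : HasFDerivAt ρ (fderiv ℝ ρ p) p :=
    ((hρ.contDiffAt (hV.mem_nhds hpV)).differentiableAt (by simp)).hasFDerivAt
  have hline : HasDerivAt (fun t : ℝ => p + t • v) v 0 := by
    simpa using ((hasDerivAt_id (0 : ℝ)).smul_const v).const_add p
  have hd : HasDerivAt (fun t : ℝ => ρ (p + t • v)) (fderiv ℝ ρ p v) 0 :=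
    HasFDerivAt.comp_hasDerivAt (0 : ℝ) (by simpa using hdiff) hline
  have hneg : ∀ᶠ t in 𝓝[>] (0 : ℝ), ρ (p + t • v) < 0 := by
    have h1 := ((hasDerivAt_iff_tendsto_slope.mp hd).mono_left
      (nhdsWithin_mono 0 fun t (ht : 0 < t) => ht.ne')).eventually (gt_mem_nhds hv)
    filter_upwards [h1, self_mem_nhdsWithin] with t ht (ht0 : 0 < t)
    rw [slope_def_field, div_lt_iff₀ (by simpa using ht0)] at ht
    simp only [zero_smul, add_zero, sub_zero, zero_mul] at ht
    linarith
  have hcont : Tendsto (fun t : ℝ => p + t • v) (𝓝[>] 0) (𝓝 p) := by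
    have := hline.continuousAt.tendsto.mono_left (nhdsWithin_le_nhds (s := Ioi (0 : ℝ)))
    simpa using this
  have hpΩ : p ∈ Ω := hUΩ (_root_.frontier_subset_closure hp)
  refine mem_closure_of_tendsto hcont ?_
  filter_upwards [hneg, hcont.eventually (hV.mem_nhds hpV), hcont.eventually (hΩ.mem_nhds hpΩ)]
    with t ht htV htΩ
  refine ⟨htΩ, fun hcl => ?_⟩
  have hev : ∀ᶠ z in 𝓝 (p + t • v), z ∈ V ∧ ρ z < 0 :=
    (hV.eventually_mem htV).and
      ((hρ.continuousOn.continuousAt (hV.mem_nhds htV)).eventually (gt_mem_nhds ht))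
  obtain ⟨z, hzU, hzV, hz⟩ := (mem_closure_iff_frequently.mp hcl).and_eventually hev |>.exists
  have : z ∈ {x ∈ V | 0 < ρ x} := by rw [← hUV]; exact ⟨hzU, hzV⟩
  exact (this.2.trans hz).false

/-! ### The signed distance and the tube. -/

variable {Ω Ωp : Set Vec3} {δ : ℝ}

namespace IsInterface

lemma plus_nonempty (h : IsInterface Ω Ωp δ) : Ωp.Nonempty := by
  have := h.simplyConnected_plus
  exact nonempty_coe_sort.mp (inferInstance : Nonempty Ωp)

lemma plus_subset (h : IsInterface Ω Ωp δ) : Ωp ⊆ Ω := subset_closure.trans h.closure_plus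

lemma frontier_nonempty (h : IsInterface Ω Ωp δ) : (frontier Ωp).Nonempty := by
  rw [nonempty_frontier_iff]
  refine ⟨h.plus_nonempty, fun heq => ?_⟩
  have : Bornology.IsBounded (univ : Set Vec3) := heq ▸ h.bounded.subset h.plus_subset
  exact NormedSpace.unbounded_univ ℝ Vec3 this

lemma frontier_subset_closure_outer (h : IsInterface Ω Ωp δ) :
    frontier Ωp ⊆ closure (outerPhase Ω Ωp) :=
  h.smooth_plus.frontier_subset_closure h.isOpen_plus h.isOpen h.closure_plus

lemma isOpen_outer (h : IsInterface Ω Ωp δ) : IsOpen (outerPhase Ω Ωp) :=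
  h.isOpen.sdiff isClosed_closure

lemma isOpen_tube (h : IsInterface Ω Ωp δ) (r : ℝ) : IsOpen (tube Ω Ωp r) :=
  h.isOpen.inter (isOpen_lt (continuous_infDist_pt _) continuous_const)

lemma sdist_of_mem_outer (h : IsInterface Ω Ωp δ) {x : Vec3} (hx : x ∈ outerPhase Ω Ωp) :
    sdist Ω Ωp x = -infDist x (frontier Ωp) := by
  rw [sdist, if_pos hx, neg_inj]
  refine le_antisymm ?_ ?_
  · rw [← infDist_closure]
    exact infDist_le_infDist_of_subset frontier_subset_closure h.frontier_nonempty
  · rw [le_infDist h.plus_nonempty]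
    intro y hy
    rw [dist_comm]
    exact (infDist_frontier_le_dist h.isOpen_plus hy fun hx' => hx.2 (subset_closure hx')).2

/-- The signed distance is defined by distance to the opposite phase. It agrees with the distance to
the interface because segments between phases cross it and, by smoothness, it is approached from the
outer phase. -/
lemma sdist_of_mem_closure (h : IsInterface Ω Ωp δ) {x : Vec3} (hx : x ∈ closure Ωp) :
    sdist Ω Ωp x = infDist x (frontier Ωp) := by
  rw [sdist, if_neg fun hx' => hx'.2 hx]
  have hne : (outerPhase Ω Ωp).Nonempty :=
    closure_nonempty_iff.mp (h.frontier_nonempty.mono h.frontier_subset_closure_outer)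
  refine le_antisymm ?_ ?_
  · rw [← infDist_closure]
    exact infDist_le_infDist_of_subset h.frontier_subset_closure_outer h.frontier_nonempty
  · rw [le_infDist hne]
    intro y hy
    by_cases hxp : x ∈ Ωp
    · exact (infDist_frontier_le_dist h.isOpen_plus hxp fun hx' => hy.2 (subset_closure hx')).1
    · have : x ∈ frontier Ωp := by rw [h.isOpen_plus.frontier_eq]; exact ⟨hx, hxp⟩
      rw [infDist_zero_of_mem this]
      exact dist_nonneg

lemma abs_sdist (h : IsInterface Ω Ωp δ) {x : Vec3} (hx : x ∈ Ω) :
    |sdist Ω Ωp x| = infDist x (frontier Ωp) := by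
  by_cases hc : x ∈ closure Ωp
  · rw [h.sdist_of_mem_closure hc, abs_of_nonneg infDist_nonneg]
  · rw [h.sdist_of_mem_outer ⟨hx, hc⟩, abs_neg, abs_of_nonneg infDist_nonneg]

lemma mem_tube_iff (h : IsInterface Ω Ωp δ) {x : Vec3} (hx : x ∈ Ω) (r : ℝ) :
    x ∈ tube Ω Ωp r ↔ |sdist Ω Ωp x| < r := by
  rw [h.abs_sdist hx]
  exact ⟨fun hx => hx.2, fun h => ⟨hx, h⟩⟩

lemma infDist_pos (h : IsInterface Ω Ωp δ) {x : Vec3} (hx : x ∉ frontier Ωp) :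
    0 < infDist x (frontier Ωp) :=
  (isClosed_frontier.notMem_iff_infDist_pos h.frontier_nonempty).mp hx

lemma sdist_pos (h : IsInterface Ω Ωp δ) {x : Vec3} (hx : x ∈ Ωp) : 0 < sdist Ω Ωp x := by
  rw [h.sdist_of_mem_closure (subset_closure hx)]
  refine h.infDist_pos ?_
  rw [h.isOpen_plus.frontier_eq]
  exact fun h => h.2 hx

lemma sdist_neg (h : IsInterface Ω Ωp δ) {x : Vec3} (hx : x ∈ outerPhase Ω Ωp) :
    sdist Ω Ωp x < 0 := by
  rw [h.sdist_of_mem_outer hx, neg_lt_zero]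
  exact h.infDist_pos fun h => hx.2 (frontier_subset_closure h)

lemma sdist_eq_zero (h : IsInterface Ω Ωp δ) {x : Vec3} (hx : x ∈ frontier Ωp) :
    sdist Ω Ωp x = 0 := by
  rw [h.sdist_of_mem_closure (frontier_subset_closure hx), infDist_zero_of_mem hx]

lemma trichotomy (h : IsInterface Ω Ωp δ) {x : Vec3} (hx : x ∈ Ω) :
    x ∈ Ωp ∨ x ∈ frontier Ωp ∨ x ∈ outerPhase Ω Ωp := by
  by_cases hp : x ∈ Ωp
  · exact Or.inl hp
  · by_cases hc : x ∈ closure Ωp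
    · exact Or.inr (Or.inl (by rw [h.isOpen_plus.frontier_eq]; exact ⟨hc, hp⟩))
    · exact Or.inr (Or.inr ⟨hx, hc⟩)

lemma mem_plus_iff (h : IsInterface Ω Ωp δ) {x : Vec3} (hx : x ∈ Ω) :
    x ∈ Ωp ↔ 0 < sdist Ω Ωp x := by
  refine ⟨h.sdist_pos, fun hpos => ?_⟩
  rcases h.trichotomy hx with hp | hf | ho
  · exact hp
  · exact absurd (h.sdist_eq_zero hf) hpos.ne'
  · exact absurd (h.sdist_neg ho) hpos.le.not_gt

lemma mem_outer_iff (h : IsInterface Ω Ωp δ) {x : Vec3} (hx : x ∈ Ω) :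
    x ∈ outerPhase Ω Ωp ↔ sdist Ω Ωp x < 0 := by
  refine ⟨h.sdist_neg, fun hneg => ?_⟩
  rcases h.trichotomy hx with hp | hf | ho
  · exact absurd (h.sdist_pos hp) hneg.le.not_gt
  · exact absurd (h.sdist_eq_zero hf) hneg.ne
  · exact ho

lemma contDiffAt_sdist (h : IsInterface Ω Ωp δ) {x : Vec3} (hx : x ∈ tube Ω Ωp (3 * δ)) :
    ContDiffAt ℝ ∞ (sdist Ω Ωp) x :=
  h.smooth_sdist.contDiffAt ((h.isOpen_tube _).mem_nhds hx)

lemma eventually_sdist_eq (h : IsInterface Ω Ωp δ) {x : Vec3} (hx : x ∈ Ω)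
    (hxf : x ∉ frontier Ωp) :
    (sdist Ω Ωp =ᶠ[𝓝 x] fun y => infDist y (frontier Ωp)) ∨
      sdist Ω Ωp =ᶠ[𝓝 x] fun y => -infDist y (frontier Ωp) := by
  rcases h.trichotomy hx with hp | hf | ho
  · left
    filter_upwards [h.isOpen_plus.mem_nhds hp] with y hy
    exact h.sdist_of_mem_closure (subset_closure hy)
  · exact absurd hf hxf
  · right
    filter_upwards [h.isOpen_outer.mem_nhds ho] with y hy
    exact h.sdist_of_mem_outer hy

lemma continuousAt_sdist (h : IsInterface Ω Ωp δ) {x : Vec3} (hx : x ∈ Ω) :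
    ContinuousAt (sdist Ω Ωp) x := by
  by_cases hf : x ∈ frontier Ωp
  · refine (h.contDiffAt_sdist ?_).continuousAt
    rw [h.mem_tube_iff hx, h.sdist_eq_zero hf]
    simpa using h.δ_pos
  · have hc : ContinuousAt (fun y => infDist y (frontier Ωp)) x :=
      (continuous_infDist_pt _).continuousAt
    rcases h.eventually_sdist_eq hx hf with he | he
    · exact hc.congr he.symm
    · exact hc.neg.congr he.symm

/-- The distance to a closed set has unit gradient wherever it is differentiable off the set. -/
lemma _root_.BerisEdwards.norm_fderiv_infDist {S : Set Vec3} (hS : IsClosed S)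
    (hne : S.Nonempty) {x : Vec3} (hx : x ∉ S)
    (hd : DifferentiableAt ℝ (fun y => infDist y S) x) :
    ‖fderiv ℝ (fun y => infDist y S) x‖ = 1 := by
  refine le_antisymm ?_ ?_
  · simpa using norm_fderiv_le_of_lipschitz ℝ (lipschitz_infDist_pt S) (x₀ := x)
  · obtain ⟨y, hy, hxy⟩ := hS.exists_infDist_eq_dist hne x
    have hne' : x ≠ y := fun h => hx (h ▸ hy)
    have hpos : 0 < ‖y - x‖ := norm_pos_iff.mpr (sub_ne_zero.mpr hne'.symm)
    have hxy' : infDist x S = ‖y - x‖ := by rw [hxy, dist_eq_norm, norm_sub_rev]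
    have hline : HasDerivAt (fun t : ℝ => x + t • (y - x)) (y - x) 0 := by
      simpa using ((hasDerivAt_id (0 : ℝ)).smul_const (y - x)).const_add x
    have hder : HasDerivAt (fun t : ℝ => infDist (x + t • (y - x)) S)
        (fderiv ℝ (fun y => infDist y S) x (y - x)) 0 := by
      have hd' : HasFDerivAt (fun y => infDist y S) (fderiv ℝ (fun y => infDist y S) x)
          (x + (0 : ℝ) • (y - x)) := by simpa using hd.hasFDerivAt
      have := hd'.comp_hasDerivAt (0 : ℝ) hline
      exact this
    -- Moving towards a nearest point decreases the distance at unit rate, which forces the gradient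
    -- norm to be at least one.
    have hle : fderiv ℝ (fun y => infDist y S) x (y - x) ≤ -‖y - x‖ := by
      refine le_of_tendsto ((hasDerivAt_iff_tendsto_slope.mp hder).mono_left
        (nhdsWithin_mono 0 (s := Ioi (0 : ℝ)) fun t (ht : 0 < t) => ht.ne')) ?_
      filter_upwards [Ioo_mem_nhdsGT (zero_lt_one (α := ℝ))] with t ht
      rw [slope_def_field, div_le_iff₀ (by simpa using ht.1)]
      simp only [zero_smul, add_zero, sub_zero, hxy']
      have h1 := infDist_le_dist_of_mem (x := x + t • (y - x)) hy
      have h2 : x + t • (y - x) - y = (t - 1) • (y - x) := by module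
      rw [dist_eq_norm, h2, norm_smul, Real.norm_eq_abs, abs_of_neg (by linarith [ht.2])] at h1
      linarith
    have hop := (fderiv ℝ (fun y => infDist y S) x).le_opNorm (y - x)
    rw [Real.norm_eq_abs] at hop
    have := neg_le_abs (fderiv ℝ (fun y => infDist y S) x (y - x))
    by_contra! hlt
    nlinarith

lemma _root_.BerisEdwards.gradient_apply (f : Vec3 → ℝ) (x : Vec3) (k : Fin 3) :
    gradient f x k = fderiv ℝ f x (EuclideanSpace.single k 1) := by
  have h : inner ℝ (gradient f x) (EuclideanSpace.single k 1) =
      fderiv ℝ f x (EuclideanSpace.single k 1) := by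
    rw [gradient, InnerProductSpace.toDual_symm_apply]
  rw [← h, EuclideanSpace.inner_single_right]
  simp

lemma _root_.BerisEdwards.sum_fderiv_sq (f : Vec3 → ℝ) (x : Vec3) :
    ∑ k, fderiv ℝ f x (EuclideanSpace.single k 1) ^ 2 = ‖fderiv ℝ f x‖ ^ 2 := by
  have h : ‖gradient f x‖ = ‖fderiv ℝ f x‖ := LinearIsometryEquiv.norm_map _ _
  rw [← h, EuclideanSpace.real_norm_sq_eq]
  simp only [gradient_apply]

/-- The eikonal equation for the signed distance in the tube. -/
lemma sum_fderiv_sdist_sq (h : IsInterface Ω Ωp δ) {x : Vec3} (hx : x ∈ tube Ω Ωp (3 * δ)) :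
    ∑ k, fderiv ℝ (sdist Ω Ωp) x (EuclideanSpace.single k 1) ^ 2 = 1 := by
  have off : ∀ y ∈ tube Ω Ωp (3 * δ), y ∉ frontier Ωp → ‖fderiv ℝ (sdist Ω Ωp) y‖ = 1 := by
    intro y hy hyf
    have hd := (h.contDiffAt_sdist hy).differentiableAt (by simp)
    rcases h.eventually_sdist_eq hy.1 hyf with he | he
    · rw [he.fderiv_eq]
      exact norm_fderiv_infDist isClosed_frontier h.frontier_nonempty hyf
        (hd.congr_of_eventuallyEq he.symm)
    · have he' : (fun y => infDist y (frontier Ωp)) =ᶠ[𝓝 y] fun y => -sdist Ω Ωp y := by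
        filter_upwards [he] with z hz
        rw [hz, neg_neg]
      rw [he.fderiv_eq, fderiv_fun_neg, norm_neg]
      exact norm_fderiv_infDist isClosed_frontier h.frontier_nonempty hyf
        (hd.neg.congr_of_eventuallyEq he')
  rw [sum_fderiv_sq]
  by_cases hf : x ∈ frontier Ωp
  -- On the interface the distance formula is not differentiable, but the gradient of the smooth
  -- signed distance is continuous and the outer phase accumulates there.
  · by_contra hne
    have hc : ContinuousAt (fun y => ‖fderiv ℝ (sdist Ω Ωp) y‖ ^ 2) x :=
      (((h.contDiffAt_sdist hx).fderiv_right (m := 0) (by simp)).continuousAt).norm.pow 2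
    have hev := (hc.eventually_ne hne).and ((h.isOpen_tube (3 * δ)).mem_nhds hx)
    obtain ⟨y, hy, hy1, hy2⟩ := (mem_closure_iff_frequently.mp
      (h.frontier_subset_closure_outer hf)).and_eventually hev |>.exists
    refine hy1 ?_
    rw [off y hy2 fun hyf => hy.2 (frontier_subset_closure hyf), one_pow]
  · rw [off x hx hf, one_pow]

/-- Smooth functions of the signed distance that are locally constant far from the interface. -/
lemma contDiffAt_comp_sdist (h : IsInterface Ω Ωp δ) {f : ℝ → ℝ} (hf : ContDiff ℝ ∞ f)
    (hf' : ∀ r, δ < |r| → f =ᶠ[𝓝 r] fun _ => f r) {x : Vec3} (hx : x ∈ Ω) :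
    ContDiffAt ℝ ∞ (fun y => f (sdist Ω Ωp y)) x ∧
    ∀ v, fderiv ℝ (fun y => f (sdist Ω Ωp y)) x v =
      deriv f (sdist Ω Ωp x) * fderiv ℝ (sdist Ω Ωp) x v := by
  by_cases hd : δ < |sdist Ω Ωp x|
  · have he : (fun y => f (sdist Ω Ωp y)) =ᶠ[𝓝 x] fun _ => f (sdist Ω Ωp x) :=
      (h.continuousAt_sdist hx).eventually (hf' _ hd)
    refine ⟨contDiffAt_const.congr_of_eventuallyEq he, fun v => ?_⟩
    rw [he.fderiv_eq, (hf' _ hd).deriv_eq]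
    simp
  · have hxt : x ∈ tube Ω Ωp (3 * δ) := by
      rw [h.mem_tube_iff hx]
      have := h.δ_pos
      linarith
    have hs := h.contDiffAt_sdist hxt
    refine ⟨hf.contDiffAt.comp x hs, fun v => ?_⟩
    have : HasFDerivAt (fun y => f (sdist Ω Ωp y))
        (deriv f (sdist Ω Ωp x) • fderiv ℝ (sdist Ω Ωp) x) x :=
      ((hf.differentiable (by simp) _).hasDerivAt).comp_hasFDerivAt x
        (hs.differentiableAt (by simp)).hasFDerivAt
    rw [this.fderiv]
    simp

/-- The outer boundary is `3δ` away from the interface, so the set is already closed in the whole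
space. -/
lemma isCompact_closed_tube (h : IsInterface Ω Ωp δ) :
    IsCompact {x ∈ Ω | infDist x (frontier Ωp) ≤ δ} := by
  have heq : {x ∈ Ω | infDist x (frontier Ωp) ≤ δ} =
      closure Ω ∩ {x | infDist x (frontier Ωp) ≤ δ} := by
    ext x
    refine ⟨fun hx => ⟨subset_closure hx.1, hx.2⟩, fun hx => ⟨?_, hx.2⟩⟩
    by_contra hxΩ
    have hfr : x ∈ frontier Ω := by rw [h.isOpen.frontier_eq]; exact ⟨hx.1, hxΩ⟩
    have : 3 * δ ≤ infDist x (frontier Ωp) := by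
      rw [le_infDist h.frontier_nonempty]
      intro y hy
      rw [dist_comm]
      exact h.dist_boundary y hy x hfr
    have h2 : infDist x (frontier Ωp) ≤ δ := hx.2
    linarith [h.δ_pos]
  rw [heq]
  exact h.bounded.isCompact_closure.inter_right
    (isClosed_le (continuous_infDist_pt _) continuous_const)

end IsInterface

/-! ### The calibration as a test field. -/

variable {φ : ℝ → ℝ}

lemma calibration_apply (x : Vec3) (k : Fin 3) : calibration Ω Ωp δ φ x k =
    -(φ (sdist Ω Ωp x / δ) * fderiv ℝ (sdist Ω Ωp) x (EuclideanSpace.single k 1)) := by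
  rw [← gradient_apply]
  simp [calibration]

/-- The components of the calibration, restricted to `Ω`, are test functions. -/
lemma calibration_test (h : IsInterface Ω Ωp δ) (hφ : IsCalibrationCutoff φ) (k : Fin 3) :
    ContDiff ℝ ∞ (Ω.indicator fun x => calibration Ω Ωp δ φ x k) ∧
    HasCompactSupport (Ω.indicator fun x => calibration Ω Ωp δ φ x k) ∧
    tsupport (Ω.indicator fun x => calibration Ω Ωp δ φ x k) ⊆ Ω := by
  have hδ := h.δ_pos
  set K := {x ∈ Ω | infDist x (frontier Ωp) ≤ δ} with hK
  have hKc : IsCompact K := h.isCompact_closed_tube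
  -- The indicator discards points outside `Ω`, where the formula for the signed distance no longer
  -- measures distance to the interface.
  have hz : ∀ x ∉ K, (Ω.indicator fun x => calibration Ω Ωp δ φ x k) x = 0 := by
    intro x hx
    by_cases hxΩ : x ∈ Ω
    · rw [indicator_of_mem hxΩ, calibration_apply, hφ.zero]
      · simp
      · rw [abs_div, abs_of_pos hδ, le_div_iff₀ hδ, h.abs_sdist hxΩ]
        by_contra! hlt
        exact hx ⟨hxΩ, by linarith⟩
    · exact indicator_of_notMem hxΩ _
  have hts : tsupport (Ω.indicator fun x => calibration Ω Ωp δ φ x k) ⊆ K := by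
    refine closure_minimal (fun x hx => ?_) hKc.isClosed
    by_contra hxK
    exact hx (hz x hxK)
  refine ⟨?_, hKc.of_isClosed_subset (isClosed_tsupport _) hts, hts.trans fun x hx => hx.1⟩
  rw [contDiff_iff_contDiffAt]
  intro x
  by_cases hx : x ∈ K
  · have hxt : x ∈ tube Ω Ωp (3 * δ) := ⟨hx.1, by linarith [hx.2]⟩
    have hs := h.contDiffAt_sdist hxt
    have h1 : ContDiffAt ℝ ∞ (fun x => -(φ (sdist Ω Ωp x / δ) *
        fderiv ℝ (sdist Ω Ωp) x (EuclideanSpace.single k 1))) x :=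
      ((hφ.smooth.contDiffAt.comp x (hs.div_const δ)).mul
        ((hs.fderiv_right (m := ∞) (by simp)).clm_apply contDiffAt_const)).neg
    refine h1.congr_of_eventuallyEq ?_
    filter_upwards [h.isOpen.mem_nhds hx.1] with y hy
    rw [indicator_of_mem hy, calibration_apply]
  · have : (Ω.indicator fun x => calibration Ω Ωp δ φ x k) =ᶠ[𝓝 x] fun _ => 0 := by
      filter_upwards [hKc.isClosed.isOpen_compl.mem_nhds hx] with y hy
      exact hz y hy
    exact contDiffAt_const.congr_of_eventuallyEq this

end Geometry

/-! ### One-dimensional estimates -/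

section OneDim

/-- The exponential decay rate of the transition layer. -/
noncomputable def layerDecay (a ε r : ℝ) : ℝ := Real.exp (-(√a * |r| / ε))

/-- The sharp transition. -/
noncomputable def sharpStep (r : ℝ) : ℝ := if 0 < r then 1 else 0

/-- The order parameter of the initial datum as a function of the signed distance. -/
noncomputable def layerProfile (a b c δ : ℝ) (ζ : ℝ → ℝ) (ε r : ℝ) : ℝ :=
  ζ (r / δ) * profile a b c (r / ε) + (1 - ζ (r / δ)) * (sPlus a b c * sharpStep r)

variable {a b c δ ε : ℝ} {ζ φ : ℝ → ℝ}

lemma layerDecay_pos (r : ℝ) : 0 < layerDecay a ε r := Real.exp_pos _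

lemma layerDecay_le_one (hε : 0 < ε) (r : ℝ) : layerDecay a ε r ≤ 1 := by
  rw [layerDecay, Real.exp_le_one_iff, neg_nonpos]
  positivity

lemma abs_mul_layerDecay_le (ha : 0 < a) (hε : 0 < ε) (r : ℝ) :
    |r| * layerDecay a ε r ≤ ε / √a := by
  have h1 := Real.add_one_le_exp (√a * |r| / ε)
  have h2 : √a * |r| / ε ≤ Real.exp (√a * |r| / ε) := by linarith
  rw [layerDecay, Real.exp_neg, ← div_eq_mul_inv, div_le_iff₀ (Real.exp_pos _)]
  have hs : 0 < √a := Real.sqrt_pos.mpr ha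
  calc |r| = ε / √a * (√a * |r| / ε) := by field_simp
    _ ≤ _ := by gcongr

lemma sq_mul_layerDecay_le (ha : 0 < a) (hε : 0 < ε) (r : ℝ) :
    r ^ 2 * layerDecay a ε r ≤ 2 * ε ^ 2 / a := by
  have h1 := Real.quadratic_le_exp_of_nonneg (show 0 ≤ √a * |r| / ε by positivity)
  have h2 : (√a * |r| / ε) ^ 2 / 2 ≤ Real.exp (√a * |r| / ε) := by
    have : 0 ≤ √a * |r| / ε := by positivity
    linarith
  rw [layerDecay, Real.exp_neg, ← div_eq_mul_inv, div_le_iff₀ (Real.exp_pos _)]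
  calc r ^ 2 = 2 * ε ^ 2 / a * ((√a * |r| / ε) ^ 2 / 2) := by
        rw [div_pow, mul_pow, Real.sq_sqrt ha.le, sq_abs]; field_simp
    _ ≤ _ := by gcongr

/-- The logistic form shows the exponential decay to both wells and the differential equation at
once. -/
lemma profile_eq (z : ℝ) : profile a b c z = sPlus a b c / (1 + Real.exp (-(√a * z))) := by
  have h : Real.exp (-(√a * z)) = Real.exp (-(√a / 2 * z)) * Real.exp (-(√a / 2 * z)) := by
    rw [← Real.exp_add]; congr 1; ring
  have h1 := Real.exp_pos (-(√a / 2 * z))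
  rw [profile, Real.tanh_eq_sinh_div_cosh, Real.sinh_eq, Real.cosh_eq, h,
    show Real.exp (√a / 2 * z) = (Real.exp (-(√a / 2 * z)))⁻¹ by rw [Real.exp_neg, inv_inv]]
  field_simp
  ring

lemma contDiff_profile : ContDiff ℝ ∞ (profile a b c) := by
  have : profile a b c = fun z => sPlus a b c / (1 + Real.exp (-(√a * z))) :=
    funext fun z => profile_eq z
  rw [this]
  refine contDiff_const.div (contDiff_const.add
    (Real.contDiff_exp.comp (contDiff_const.mul contDiff_id).neg)) fun z => ?_
  have := Real.exp_pos (-(√a * z))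
  positivity

lemma profile_mem (hp : 0 < sPlus a b c) (z : ℝ) : profile a b c z ∈ Icc 0 (sPlus a b c) := by
  have := Real.exp_pos (-(√a * z))
  rw [profile_eq]
  exact ⟨by positivity, div_le_self hp.le (by linarith)⟩

/-- Equipartition: with this equation the gradient and bulk parts of the layer energy are equal, so
the calibrated density becomes a perfect square when `φ = 1`. It relies on `√c s₊ = √3 √a`. -/
lemma hasDerivAt_profile (hb : 0 < b) (hc : 0 < c) (habc : b ^ 2 = 27 * a * c) (z : ℝ) :
    HasDerivAt (profile a b c) (√3 * uniaxialRoot a b c (profile a b c z)) z := by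
  have he := Real.exp_pos (-(√a * z))
  have h1 : HasDerivAt (fun z : ℝ => 1 + Real.exp (-(√a * z)))
      (Real.exp (-(√a * z)) * -(√a * 1)) z :=
    (((hasDerivAt_id z).const_mul (√a)).neg.exp).const_add 1
  have h2 := (hasDerivAt_const z (sPlus a b c)).div h1 (by positivity)
  have hfun : profile a b c = fun z => sPlus a b c / (1 + Real.exp (-(√a * z))) :=
    funext fun z => profile_eq z
  rw [hfun]
  refine h2.congr_deriv ?_
  have hs := sqrt_mul_sPlus hb hc habc
  have h3 : √3 * √3 = 3 := Real.mul_self_sqrt (by norm_num)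
  rw [uniaxialRoot]
  have e1 : √3 * (√c / 3 * (sPlus a b c / (1 + Real.exp (-(√a * z))) *
      (sPlus a b c - sPlus a b c / (1 + Real.exp (-(√a * z)))))) =
      √3 * (√c * sPlus a b c) / 3 * sPlus a b c * Real.exp (-(√a * z)) /
        (1 + Real.exp (-(√a * z))) ^ 2 := by
    field_simp
    ring
  rw [e1, hs, ← mul_assoc √3, h3]
  field_simp
  ring

lemma abs_profile_sub_le (hp : 0 < sPlus a b c) (r : ℝ) :
    |profile a b c (r / ε) - sPlus a b c * sharpStep r| ≤ sPlus a b c * layerDecay a ε r := by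
  rw [profile_eq, sharpStep, layerDecay]
  split_ifs with hr
  · have he := Real.exp_pos (-(√a * (r / ε)))
    rw [abs_of_pos hr, mul_div_assoc]
    have : sPlus a b c / (1 + Real.exp (-(√a * (r / ε)))) - sPlus a b c * 1 =
        -(sPlus a b c * (Real.exp (-(√a * (r / ε))) / (1 + Real.exp (-(√a * (r / ε)))))) := by
      field_simp; ring
    rw [this, abs_neg, abs_of_pos (by positivity)]
    gcongr
    exact div_le_self he.le (by linarith)
  · rw [abs_of_nonpos (not_lt.mp hr), mul_zero, sub_zero]
    have he := Real.exp_pos (√a * (r / ε))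
    have h1 : -(√a * -r / ε) = √a * (r / ε) := by ring
    rw [h1, Real.exp_neg, abs_of_pos (by positivity), div_eq_mul_inv]
    gcongr
    rw [inv_le_comm₀ (by positivity) he]
    linarith

/-- `m` vanishes linearly at each well, so closeness to the sharp step on either side makes it
small. -/
lemma uniaxialRoot_le (hp : 0 < sPlus a b c) {s r t : ℝ} (hs : s ∈ Icc 0 (sPlus a b c))
    (hd : |s - sPlus a b c * sharpStep r| ≤ sPlus a b c * t) :
    uniaxialRoot a b c s ≤ √c / 3 * sPlus a b c ^ 2 * t := by
  rw [uniaxialRoot, mul_assoc]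
  refine mul_le_mul_of_nonneg_left ?_ (by positivity)
  rw [sharpStep] at hd
  split_ifs at hd with hr
  · rw [mul_one, abs_sub_comm, abs_of_nonneg (by linarith [hs.2])] at hd
    calc s * (sPlus a b c - s) ≤ sPlus a b c * (sPlus a b c * t) := by
          gcongr
          · linarith [hs.2]
          · exact hs.2
      _ = _ := by ring
  · rw [mul_zero, sub_zero, abs_of_nonneg hs.1] at hd
    calc s * (sPlus a b c - s) ≤ sPlus a b c * t * sPlus a b c := by
          gcongr
          · linarith [hs.2]
          · exact hs.1.trans hd
          · linarith [hs.1]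
      _ = _ := by ring

lemma layerProfile_sub (r : ℝ) : layerProfile a b c δ ζ ε r - sPlus a b c * sharpStep r =
    ζ (r / δ) * (profile a b c (r / ε) - sPlus a b c * sharpStep r) := by
  rw [layerProfile]; ring

lemma sharpStep_mem (r : ℝ) : sharpStep r ∈ Icc (0 : ℝ) 1 := by
  rw [sharpStep]; split_ifs <;> simp

lemma convexComb_mem {x y p t : ℝ} (hx : x ∈ Icc 0 p) (hy : y ∈ Icc 0 p) (ht : t ∈ Icc (0 : ℝ) 1) :
    t * x + (1 - t) * y ∈ Icc 0 p := by
  have := convex_Icc 0 p hx hy ht.1 (sub_nonneg.mpr ht.2) (by ring)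
  simpa using this

lemma layerProfile_mem (hp : 0 < sPlus a b c) (hζ : IsInitialCutoff ζ) (r : ℝ) :
    layerProfile a b c δ ζ ε r ∈ Icc 0 (sPlus a b c) := by
  refine convexComb_mem (profile_mem hp _) ?_ (hζ.range _)
  have h := sharpStep_mem r
  exact ⟨mul_nonneg hp.le h.1, mul_le_of_le_one_right hp.le h.2⟩

lemma abs_layerProfile_sub_le (hp : 0 < sPlus a b c) (hζ : IsInitialCutoff ζ) (r : ℝ) :
    |layerProfile a b c δ ζ ε r - sPlus a b c * sharpStep r| ≤
      sPlus a b c * layerDecay a ε r := by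
  rw [layerProfile_sub, abs_mul, abs_of_nonneg (hζ.range _).1]
  exact (mul_le_of_le_one_left (abs_nonneg _) (hζ.range _).2).trans (abs_profile_sub_le hp r)

lemma eventually_layerProfile_inner (hζ : IsInitialCutoff ζ) (hδ : 0 < δ) {r : ℝ}
    (hr : |r| < δ / 2) : layerProfile a b c δ ζ ε =ᶠ[𝓝 r] fun r => profile a b c (r / ε) := by
  filter_upwards [continuous_abs.continuousAt.eventually (gt_mem_nhds hr)] with s hs
  have : |s / δ| ≤ 1 / 2 := by
    rw [abs_div, abs_of_pos hδ, div_le_iff₀ hδ]; linarith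
  rw [layerProfile, hζ.one _ this]
  ring

lemma eventually_sharpStep {r : ℝ} (hr : r ≠ 0) : sharpStep =ᶠ[𝓝 r] fun _ => sharpStep r := by
  rcases lt_or_gt_of_ne hr with h | h
  · filter_upwards [Iio_mem_nhds h] with s (hs : s < 0)
    rw [sharpStep, sharpStep, if_neg hs.le.not_gt, if_neg h.le.not_gt]
  · filter_upwards [Ioi_mem_nhds h] with s (hs : 0 < s)
    rw [sharpStep, sharpStep, if_pos hs, if_pos h]

lemma eventually_layerProfile_outer {r : ℝ} (hr : r ≠ 0) :
    layerProfile a b c δ ζ ε =ᶠ[𝓝 r] fun s => ζ (s / δ) * profile a b c (s / ε) +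
      (1 - ζ (s / δ)) * (sPlus a b c * sharpStep r) := by
  filter_upwards [eventually_sharpStep hr] with s hs
  rw [layerProfile, hs]

/-- The jump of the sharp step at `0` is invisible because its coefficient vanishes near `0`. -/
lemma contDiff_layerProfile (hζ : IsInitialCutoff ζ) (hδ : 0 < δ) :
    ContDiff ℝ ∞ (layerProfile a b c δ ζ ε) := by
  rw [contDiff_iff_contDiffAt]
  intro r
  have hS : ContDiff ℝ ∞ fun r => profile a b c (r / ε) :=
    contDiff_profile.comp (contDiff_id.div_const ε)
  have hZ : ContDiff ℝ ∞ fun r => ζ (r / δ) := hζ.smooth.comp (contDiff_id.div_const δ)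
  by_cases hr : r = 0
  · refine hS.contDiffAt.congr_of_eventuallyEq (eventually_layerProfile_inner hζ hδ ?_)
    rw [hr, abs_zero]; linarith
  · exact ((hZ.mul hS).add ((contDiff_const.sub hZ).mul
      contDiff_const)).contDiffAt.congr_of_eventuallyEq (eventually_layerProfile_outer hr)

lemma eventually_layerProfile_const (hζ : IsInitialCutoff ζ) (hδ : 0 < δ) {r : ℝ}
    (hr : δ < |r|) :
    layerProfile a b c δ ζ ε =ᶠ[𝓝 r] fun _ => layerProfile a b c δ ζ ε r := by
  have hr0 : r ≠ 0 := fun h => by rw [h, abs_zero] at hr; linarith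
  have hz : ∀ s, δ < |s| → ζ (s / δ) = 0 := fun s hs => hζ.zero _ (by
    rw [abs_div, abs_of_pos hδ, le_div_iff₀ hδ]; linarith)
  filter_upwards [eventually_sharpStep hr0,
    continuous_abs.continuousAt.eventually (lt_mem_nhds hr)] with s h1 h2
  rw [layerProfile, layerProfile, h1, hz s h2, hz r hr]
  ring

lemma hasDerivAt_scaled_profile (hb : 0 < b) (hc : 0 < c) (habc : b ^ 2 = 27 * a * c) (r : ℝ) :
    HasDerivAt (fun r => profile a b c (r / ε))
      (√3 * uniaxialRoot a b c (profile a b c (r / ε)) / ε) r := by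
  have h := (hasDerivAt_profile hb hc habc (r / ε)).comp r ((hasDerivAt_id r).div_const ε)
  refine h.congr_deriv ?_
  ring

lemma deriv_layerProfile_inner (hb : 0 < b) (hc : 0 < c) (habc : b ^ 2 = 27 * a * c)
    (hζ : IsInitialCutoff ζ) (hδ : 0 < δ) {r : ℝ} (hr : |r| < δ / 2) :
    deriv (layerProfile a b c δ ζ ε) r =
      √3 * uniaxialRoot a b c (layerProfile a b c δ ζ ε r) / ε := by
  have he := eventually_layerProfile_inner (a := a) (b := b) (c := c) (ε := ε) hζ hδ hr
  rw [he.deriv_eq, (hasDerivAt_scaled_profile hb hc habc r).deriv, he.self_of_nhds]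

lemma exists_bound_deriv_cutoff (hζ : IsInitialCutoff ζ) : ∃ Z, 0 ≤ Z ∧ ∀ s, |deriv ζ s| ≤ Z := by
  have hc : HasCompactSupport ζ :=
    HasCompactSupport.of_support_subset_isCompact (isCompact_Icc (a := (-1 : ℝ)) (b := 1))
      fun s hs => by
        rw [mem_Icc, ← abs_le]
        by_contra! h
        exact hs (hζ.zero s h.le)
  obtain ⟨Z, hZ⟩ := (hζ.smooth.continuous_deriv (by simp)).bounded_above_of_compact_support
    hc.deriv
  exact ⟨Z, (norm_nonneg _).trans (hZ 0), hZ⟩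

/-- The derivative of the layer profile decays exponentially. -/
lemma exists_abs_deriv_layerProfile_le (hb : 0 < b) (hc : 0 < c) (habc : b ^ 2 = 27 * a * c)
    (hζ : IsInitialCutoff ζ) (hδ : 0 < δ) :
    ∃ D, 0 ≤ D ∧ ∀ ε, 0 < ε → ε ≤ 1 → ∀ r, r ≠ 0 →
      |deriv (layerProfile a b c δ ζ ε) r| ≤ D * layerDecay a ε r / ε := by
  obtain ⟨Z, hZ0, hZ⟩ := exists_bound_deriv_cutoff hζ
  have hp := sPlus_pos hb hc habc
  refine ⟨Z / δ * sPlus a b c + √3 * (√c / 3 * sPlus a b c ^ 2), by positivity,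
    fun ε hε hε1 r hr => ?_⟩
  have hE := layerDecay_pos (a := a) (ε := ε) r
  have hS := hasDerivAt_scaled_profile (ε := ε) hb hc habc r
  have hZd : HasDerivAt (fun r => ζ (r / δ)) (deriv ζ (r / δ) * (1 / δ)) r :=
    ((hζ.smooth.differentiable (by simp) _).hasDerivAt).comp r ((hasDerivAt_id r).div_const δ)
  have hd := (hZd.mul hS).add ((hZd.const_sub 1).mul_const (sPlus a b c * sharpStep r))
  have h1 := abs_profile_sub_le (ε := ε) hp r
  have hm := profile_mem hp (r / ε)
  have h2 := uniaxialRoot_le hp hm h1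
  have h3 := uniaxialRoot_nonneg hm.1 hm.2
  rw [(eventually_layerProfile_outer hr).deriv_eq, HasDerivAt.deriv (f := fun s =>
    ζ (s / δ) * profile a b c (s / ε) + (1 - ζ (s / δ)) * (sPlus a b c * sharpStep r)) hd]
  set m := uniaxialRoot a b c (profile a b c (r / ε))
  set S := profile a b c (r / ε)
  set p := sPlus a b c
  set E := layerDecay a ε r
  have hζr := hζ.range (r / δ)
  have t1 : |deriv ζ (r / δ) * (1 / δ) * (S - p * sharpStep r)| ≤ Z / δ * p * E / ε := by
    rw [abs_mul, abs_mul, abs_of_pos (by positivity : 0 < 1 / δ), mul_one_div]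
    calc |deriv ζ (r / δ)| / δ * |S - p * sharpStep r| ≤ Z / δ * (p * E) := by
          gcongr; exact hZ _
      _ = Z / δ * p * E := by ring
      _ ≤ _ := by rw [le_div_iff₀ hε]; exact mul_le_of_le_one_right (by positivity) hε1
  have t2 : |ζ (r / δ) * (√3 * m / ε)| ≤ √3 * (√c / 3 * p ^ 2) * E / ε := by
    rw [abs_mul, abs_of_nonneg hζr.1, abs_of_nonneg (by positivity)]
    calc ζ (r / δ) * (√3 * m / ε) ≤ 1 * (√3 * (√c / 3 * p ^ 2 * E) / ε) := by
          gcongr; exact hζr.2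
      _ = _ := by ring
  -- The derivative of the cut-off meets only the difference between profile and sharp step, which
  -- decays exponentially.
  have e : deriv ζ (r / δ) * (1 / δ) * S + ζ (r / δ) * (√3 * m / ε) +
      -(deriv ζ (r / δ) * (1 / δ)) * (p * sharpStep r) =
      deriv ζ (r / δ) * (1 / δ) * (S - p * sharpStep r) + ζ (r / δ) * (√3 * m / ε) := by ring
  rw [e]
  refine (abs_add_le _ _).trans ((add_le_add t1 t2).trans (le_of_eq ?_))
  ring

lemma IsCalibrationCutoff.nonneg (hφ : IsCalibrationCutoff φ) (x : ℝ) : 0 ≤ φ x := by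
  rcases lt_or_ge |x| 1 with h | h
  · exact (hφ.pos x h).le
  · exact (hφ.zero x h).ge

/-- The quadratic bound covers `|x| ≤ 1/2`; monotonicity carries its value at `1/2` up to `1`,
evenness treats negative arguments. -/
lemma IsCalibrationCutoff.le_one (hφ : IsCalibrationCutoff φ) (x : ℝ) : φ x ≤ 1 := by
  have habs : φ x = φ |x| := by
    rcases abs_cases x with ⟨h, -⟩ | ⟨h, -⟩
    · rw [h]
    · rw [h, hφ.even]
  rcases le_or_gt |x| (1 / 2) with h | h
  · have := (hφ.bounds x h).2
    nlinarith [sq_nonneg x]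
  · rcases le_or_gt |x| 1 with h1 | h1
    · rw [habs]
      have h2 := hφ.antitone (by norm_num : (1 / 2 : ℝ) ∈ Icc (0 : ℝ) 1) ⟨abs_nonneg x, h1⟩ h.le
      have h3 := (hφ.bounds (1 / 2) (by norm_num [abs_of_pos])).2
      norm_num at h3 h2 ⊢
      linarith
    · rw [hφ.zero x h1.le]; norm_num

/-- The calibrated energy density of the layer is of order `ε`, uniformly. -/
lemma exists_calibrated_density_le (ha : 0 < a) (hb : 0 < b) (hc : 0 < c)
    (habc : b ^ 2 = 27 * a * c) (hζ : IsInitialCutoff ζ) (hφ : IsCalibrationCutoff φ)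
    (hδ : 0 < δ) :
    ∃ C, 0 ≤ C ∧ ∀ ε, 0 < ε → ε ≤ 1 → ∀ r,
      ε / 3 * deriv (layerProfile a b c δ ζ ε) r ^ 2 +
        1 / ε * uniaxialRoot a b c (layerProfile a b c δ ζ ε r) ^ 2 -
        φ (r / δ) * (2 / √3 * uniaxialRoot a b c (layerProfile a b c δ ζ ε r) *
          deriv (layerProfile a b c δ ζ ε) r) ≤ C * ε := by
  obtain ⟨D, hD0, hD⟩ := exists_abs_deriv_layerProfile_le hb hc habc hζ hδ
  have hp := sPlus_pos hb hc habc
  obtain ⟨A, hA⟩ : ∃ A, A = √c / 3 * sPlus a b c ^ 2 := ⟨_, rfl⟩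
  have hA0 : 0 ≤ A := by rw [hA]; positivity
  have hC2 : 0 ≤ (D ^ 2 / 3 + A ^ 2 + 2 / √3 * (A * D)) * (8 / (a * δ ^ 2)) := by positivity
  have hC1 : 0 ≤ 16 * A ^ 2 / (a * δ ^ 2) := by positivity
  -- The first summand serves `|r| < δ/2`, where the profile equation holds exactly, the second
  -- serves `|r| ≥ δ/2`.
  refine ⟨16 * A ^ 2 / (a * δ ^ 2) +
    (D ^ 2 / 3 + A ^ 2 + 2 / √3 * (A * D)) * (8 / (a * δ ^ 2)), by positivity,
    fun ε hε hε1 r => ?_⟩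
  have hE := layerDecay_pos (a := a) (ε := ε) r
  have hE1 := layerDecay_le_one (a := a) hε r
  have hEr := sq_mul_layerDecay_le ha hε r
  have hL := layerProfile_mem (a := a) (b := b) (c := c) (δ := δ) (ε := ε) hp hζ r
  have hm0 := uniaxialRoot_nonneg hL.1 hL.2
  have hm := uniaxialRoot_le hp hL
    (abs_layerProfile_sub_le (a := a) (b := b) (c := c) (δ := δ) (ε := ε) hp hζ r)
  have hinner := fun h => deriv_layerProfile_inner (a := a) (b := b) (c := c) (ε := ε)
    hb hc habc hζ hδ (r := r) h
  have houter := hD ε hε hε1 r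
  set m := uniaxialRoot a b c (layerProfile a b c δ ζ ε r)
  set dL := deriv (layerProfile a b c δ ζ ε) r
  set E := layerDecay a ε r
  rw [← hA] at hm
  have hE2 : E ^ 2 ≤ E := by nlinarith
  have hm2 : m ^ 2 ≤ A ^ 2 * E := by
    calc m ^ 2 ≤ (A * E) ^ 2 := by gcongr
      _ = A ^ 2 * E ^ 2 := by ring
      _ ≤ _ := by gcongr
  have h3 : √3 * √3 = 3 := Real.mul_self_sqrt (by norm_num)
  rw [add_mul]
  rcases lt_or_ge |r| (δ / 2) with hr | hr
  · rw [hinner hr]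
    have hb1 := (hφ.bounds (r / δ) (by
      rw [abs_div, abs_of_pos hδ, div_le_iff₀ hδ]; linarith)).1
    have e : ε / 3 * (√3 * m / ε) ^ 2 + 1 / ε * m ^ 2 -
        φ (r / δ) * (2 / √3 * m * (√3 * m / ε)) = 2 * (1 - φ (r / δ)) * (m ^ 2 / ε) := by
      rw [div_pow, mul_pow, Real.sq_sqrt (by norm_num)]
      field_simp
      ring
    rw [e]
    have : 2 * (1 - φ (r / δ)) * (m ^ 2 / ε) ≤ 16 * A ^ 2 / (a * δ ^ 2) * ε := by
      calc 2 * (1 - φ (r / δ)) * (m ^ 2 / ε) ≤ 2 * (4 * (r / δ) ^ 2) * (A ^ 2 * E / ε) := by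
            gcongr
            linarith
        _ = 8 * A ^ 2 / δ ^ 2 / ε * (r ^ 2 * E) := by field_simp; ring
        _ ≤ 8 * A ^ 2 / δ ^ 2 / ε * (2 * ε ^ 2 / a) := by gcongr
        _ = _ := by field_simp; ring
    have := mul_nonneg hC2 hε.le
    linarith
  · have hr0 : r ≠ 0 := fun h => by rw [h, abs_zero] at hr; linarith
    have hS := houter hr0
    -- At fixed distance from the interface, quadratic decay in `ε` is enough to absorb the factor
    -- `1/ε` in all three terms.
    have hEε : E ≤ 8 / (a * δ ^ 2) * ε ^ 2 := by
      have h1 : (δ / 2) ^ 2 ≤ r ^ 2 := by rw [← sq_abs r]; gcongr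
      have h2 : (δ / 2) ^ 2 * E ≤ 2 * ε ^ 2 / a := (by gcongr : _ ≤ r ^ 2 * E).trans hEr
      calc E = 4 / δ ^ 2 * ((δ / 2) ^ 2 * E) := by field_simp; ring
        _ ≤ 4 / δ ^ 2 * (2 * ε ^ 2 / a) := by gcongr
        _ = _ := by field_simp; ring
    have t1 : ε / 3 * dL ^ 2 ≤ D ^ 2 / 3 * E / ε := by
      rw [← sq_abs]
      calc ε / 3 * |dL| ^ 2 ≤ ε / 3 * (D * E / ε) ^ 2 := by gcongr
        _ = D ^ 2 / 3 * E ^ 2 / ε := by field_simp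
        _ ≤ _ := by gcongr
    have t2 : 1 / ε * m ^ 2 ≤ A ^ 2 * E / ε := by
      rw [one_div_mul_eq_div]; gcongr
    have t3 : -(φ (r / δ) * (2 / √3 * m * dL)) ≤ 2 / √3 * (A * D) * E / ε := by
      have hs3 : 0 ≤ 2 / √3 := by positivity
      calc -(φ (r / δ) * (2 / √3 * m * dL)) ≤ |φ (r / δ) * (2 / √3 * m * dL)| := neg_le_abs _
        _ = φ (r / δ) * (2 / √3 * m * |dL|) := by
          rw [abs_mul, abs_mul, abs_mul, abs_of_nonneg (hφ.nonneg _), abs_of_nonneg hs3,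
            abs_of_nonneg hm0]
        _ ≤ 1 * (2 / √3 * (A * E) * (D * E / ε)) := by
          gcongr
          exact hφ.le_one _
        _ = 2 / √3 * (A * D) * E ^ 2 / ε := by ring
        _ ≤ _ := by gcongr
    have t4 : (D ^ 2 / 3 + A ^ 2 + 2 / √3 * (A * D)) * (E / ε) ≤
        (D ^ 2 / 3 + A ^ 2 + 2 / √3 * (A * D)) * (8 / (a * δ ^ 2)) * ε := by
      rw [mul_assoc]
      refine mul_le_mul_of_nonneg_left ?_ (by positivity)
      rw [div_le_iff₀ hε]
      calc E ≤ _ := hEε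
        _ = _ := by ring
    have e4 : (D ^ 2 / 3 + A ^ 2 + 2 / √3 * (A * D)) * (E / ε) =
        D ^ 2 / 3 * E / ε + A ^ 2 * E / ε + 2 / √3 * (A * D) * E / ε := by ring
    have := mul_nonneg hC1 hε.le
    linarith

lemma abs_wellPrimitive_sub_le {s t : ℝ} (hs : s ∈ Icc 0 (sPlus a b c))
    (ht : t ∈ Icc 0 (sPlus a b c)) :
    |wellPrimitive a b c t - wellPrimitive a b c s| ≤
      2 / √3 * (√c / 3 * sPlus a b c ^ 2) * |t - s| := by
  refine Convex.norm_image_sub_le_of_norm_hasDerivWithin_le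
    (fun x _ => (hasDerivAt_wellPrimitive x).hasDerivWithinAt) (fun x hx => ?_)
    (convex_Icc 0 (sPlus a b c)) hs ht
  have h0 := uniaxialRoot_nonneg hx.1 hx.2
  rw [Real.norm_of_nonneg (by positivity), uniaxialRoot, pow_two]
  gcongr
  · linarith [hx.2]
  · exact hx.1.trans hx.2
  · exact hx.2
  · linarith [hx.1]

lemma abs_truncation_le (hδ : 0 < δ) (r : ℝ) : |truncation δ r| ≤ δ ∧ |truncation δ r| ≤ |r| := by
  rw [truncation]
  split_ifs with h1 h2
  · rw [abs_neg, abs_of_pos hδ, abs_of_pos (hδ.trans_le h1)]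
    exact ⟨le_rfl, h1⟩
  · rw [abs_of_pos hδ, abs_of_neg (by linarith)]
    exact ⟨le_rfl, by linarith⟩
  · rw [abs_neg]
    exact ⟨abs_le.mpr ⟨by linarith, by linarith⟩, le_rfl⟩

/-- The bulk error density of the layer is of order `ε`, uniformly. -/
lemma exists_bulk_density_le (ha : 0 < a) (hb : 0 < b) (hc : 0 < c)
    (habc : b ^ 2 = 27 * a * c) (hζ : IsInitialCutoff ζ) (hδ : 0 < δ) :
    ∃ C, 0 ≤ C ∧ ∀ ε, 0 < ε → ∀ r,
      |(wellPrimitive a b c (sPlus a b c) * (if r < 0 then 1 else 0) -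
        (wellPrimitive a b c (sPlus a b c) -
          wellPrimitive a b c (layerProfile a b c δ ζ ε r))) * truncation δ r| ≤ C * ε := by
  have hp := sPlus_pos hb hc habc
  have hsa : 0 < √a := Real.sqrt_pos.mpr ha
  refine ⟨2 / √3 * (√c / 3 * sPlus a b c ^ 2) * sPlus a b c / √a, by positivity,
    fun ε hε r => ?_⟩
  have hL := layerProfile_mem (a := a) (b := b) (c := c) (δ := δ) (ε := ε) hp hζ r
  have hd := abs_layerProfile_sub_le (a := a) (b := b) (c := c) (δ := δ) (ε := ε) hp hζ r
  have hE := abs_mul_layerDecay_le ha hε r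
  have hE0 := layerDecay_pos (a := a) (ε := ε) r
  have ht := (abs_truncation_le hδ r).2
  set s := layerProfile a b c δ ζ ε r
  set p := sPlus a b c
  set E := layerDecay a ε r
  rw [abs_mul]
  -- On the interface itself the layer is close to neither phase, but the weight vanishes.
  rcases eq_or_ne r 0 with h0 | h0
  · have : |truncation δ r| = 0 :=
      le_antisymm (by simpa [h0] using ht) (abs_nonneg _)
    rw [this, mul_zero]
    positivity
  have key : |wellPrimitive a b c p * (if r < 0 then 1 else 0) -
      (wellPrimitive a b c p - wellPrimitive a b c s)| ≤
      2 / √3 * (√c / 3 * p ^ 2) * (p * E) := by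
    rw [sharpStep] at hd
    rcases lt_or_gt_of_ne h0 with h | h
    · rw [if_neg h.le.not_gt, mul_zero] at hd
      rw [if_pos h]
      have := abs_wellPrimitive_sub_le (c := c) (s := 0) (t := s) ⟨le_rfl, hp.le⟩ hL
      rw [wellPrimitive_zero, sub_zero] at this
      rw [show wellPrimitive a b c p * 1 - (wellPrimitive a b c p - wellPrimitive a b c s) =
        wellPrimitive a b c s by ring]
      exact this.trans (mul_le_mul_of_nonneg_left hd (by positivity))
    · rw [if_pos h, mul_one] at hd
      rw [if_neg h.le.not_gt]
      have := abs_wellPrimitive_sub_le (c := c) (s := p) (t := s) ⟨hp.le, le_rfl⟩ hL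
      rw [show wellPrimitive a b c p * 0 - (wellPrimitive a b c p - wellPrimitive a b c s) =
        wellPrimitive a b c s - wellPrimitive a b c p by ring]
      exact this.trans (mul_le_mul_of_nonneg_left hd (by positivity))
  calc _ ≤ 2 / √3 * (√c / 3 * p ^ 2) * (p * E) * |r| := by gcongr
    _ = 2 / √3 * (√c / 3 * p ^ 2) * p * (|r| * E) := by ring
    _ ≤ 2 / √3 * (√c / 3 * p ^ 2) * p * (ε / √a) := by gcongr
    _ = _ := by ring

end OneDim

/-! ### The director field -/

section DirectorField

/-- Off the sphere the formula for the director has nonzero trace; the orthogonal projection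
restores the constraint and fixes the values on the sphere, so the chain rule applies. -/
lemma exists_director_extension :
    ∃ Φ : Vec3 → QTensor, ContDiff ℝ ∞ Φ ∧ ∀ e : S2, Φ e = director e := by
  refine ⟨fun v => symTraceless.orthogonalProjectionOnto (WithLp.toLp 2 fun ij =>
    v ij.1 * v ij.2 - if ij.1 = ij.2 then 1 / 3 else 0), ?_, fun e => ?_⟩
  · refine (ContinuousLinearMap.contDiff _).comp (PiLp.contDiff_toLp.comp ?_)
    rw [contDiff_pi]
    intro i
    fun_prop
  · exact Submodule.orthogonalProjectionOnto_mem_subspace_eq_self (director e)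

variable {Ω : Set Vec3}

/-- The director field of an `H¹` map into the sphere: its weak gradient is controlled by that of
the map, and is orthogonal to the field. -/
lemma exists_director_gradient_bound : ∃ B, 0 ≤ B ∧ ∀ {Ω : Set Vec3}, IsOpen Ω → volume Ω ≠ ⊤ →
    ∀ u₀ : Vec3 → S2, MemH1 Ω (fun x => (u₀ x : Vec3)) → ∃ G : Fin 3 → Vec3 → QTensor,
      IsWeakGradient Ω (fun x => director (u₀ x)) G ∧
      (∀ k, MemLp (G k) 2 (volume.restrict Ω)) ∧
      (∀ k x, ‖G k x‖ ≤ B * ‖weakGrad Ω (fun x => (u₀ x : Vec3)) k x‖) ∧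
      ∀ k, ∀ᵐ x ∂volume.restrict Ω, inner ℝ (director (u₀ x)) (G k x) = 0 := by
  obtain ⟨Φ, hΦ, hΦd⟩ := exists_director_extension
  -- The constant bounds a fixed derivative on the unit ball and so depends neither on the domain
  -- nor on the map.
  obtain ⟨B, hB⟩ := (isCompact_closedBall (0 : Vec3) 1).exists_bound_of_continuousOn
    (E := Vec3 →L[ℝ] QTensor) (f := fderiv ℝ Φ) (hΦ.continuous_fderiv (by simp)).continuousOn
  refine ⟨B, (norm_nonneg _).trans (hB 0 (by simp)), fun {Ω} hΩ hfin u₀ hu => ?_⟩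
  have hn : ∀ x, ‖(u₀ x : Vec3)‖ ≤ 1 := fun x => by simp
  have hw := hu.isWeakGradient_weakGrad
  have hG := hw.comp_of_bounded hΩ hn hΦ
  simp only [hΦd] at hG
  refine ⟨_, hG, fun k => memLp_fderiv_apply hu.1.aestronglyMeasurable hn hΦ
    (hu.memLp_weakGrad hΩ k), fun k x => ?_, fun k => ?_⟩
  · exact (ContinuousLinearMap.le_opNorm _ _).trans
      (mul_le_mul_of_nonneg_right (hB _ (by simp)) (norm_nonneg _))
  -- The chain rule for the squared norm, which is the constant `2/3`, combined with uniqueness of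
  -- weak gradients.
  · have h2 := hG.comp_of_bounded hΩ (fun x => norm_director_le (u₀ x))
      (contDiff_norm_sq ℝ (E := QTensor) (n := ∞))
    simp only [norm_sq_director] at h2
    filter_upwards [h2.ae_eq hΩ (isWeakGradient_const Ω (2 / 3 : ℝ)) k] with x hx
    rw [fderiv_norm_sq_apply] at hx
    simpa using hx

end DirectorField

/-! ### The initial datum -/

section InitialDatum

variable {a b c δ ε : ℝ} {Ω Ωp : Set Vec3} {ζ φ : ℝ → ℝ}

lemma initialOrder_mem (hp : 0 < sPlus a b c) (hζ : IsInitialCutoff ζ) (x : Vec3) :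
    initialOrder a b c Ω Ωp δ ζ ε x ∈ Icc 0 (sPlus a b c) := by
  refine convexComb_mem (profile_mem hp _) ?_ (hζ.range _)
  by_cases hx : x ∈ Ωp <;> simp [hx, hp.le]

lemma norm_initialDatum_le (hp : 0 < sPlus a b c) (hζ : IsInitialCutoff ζ) (u₀ : Vec3 → S2)
    (x : Vec3) : ‖initialDatum a b c Ω Ωp δ ζ ε u₀ x‖ ≤ sPlus a b c := by
  have h := initialOrder_mem (Ω := Ω) (Ωp := Ωp) (δ := δ) (ε := ε) hp hζ x
  rw [initialDatum, norm_smul, Real.norm_of_nonneg h.1]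
  exact (mul_le_of_le_one_right h.1 (norm_director_le _)).trans h.2

lemma initialOrder_eq (h : IsInterface Ω Ωp δ) {x : Vec3} (hx : x ∈ Ω) :
    initialOrder a b c Ω Ωp δ ζ ε x = layerProfile a b c δ ζ ε (sdist Ω Ωp x) := by
  rw [initialOrder, layerProfile, sharpStep]
  by_cases hp : x ∈ Ωp
  · rw [indicator_of_mem hp, if_pos ((h.mem_plus_iff hx).mp hp), Pi.one_apply]
  · rw [indicator_of_notMem hp, if_neg fun hpos => hp ((h.mem_plus_iff hx).mpr hpos)]

lemma contDiffAt_initialOrder (h : IsInterface Ω Ωp δ) (hζ : IsInitialCutoff ζ) {x : Vec3}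
    (hx : x ∈ Ω) :
    ContDiffAt ℝ ∞ (initialOrder a b c Ω Ωp δ ζ ε) x ∧
    ∀ v, fderiv ℝ (initialOrder a b c Ω Ωp δ ζ ε) x v =
      deriv (layerProfile a b c δ ζ ε) (sdist Ω Ωp x) * fderiv ℝ (sdist Ω Ωp) x v := by
  have he : initialOrder a b c Ω Ωp δ ζ ε =ᶠ[𝓝 x]
      fun y => layerProfile a b c δ ζ ε (sdist Ω Ωp y) := by
    filter_upwards [h.isOpen.mem_nhds hx] with y hy using initialOrder_eq h hy
  obtain ⟨h1, h2⟩ := h.contDiffAt_comp_sdist (contDiff_layerProfile (a := a) (b := b) (c := c)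
    (ε := ε) hζ h.δ_pos) (fun r hr => eventually_layerProfile_const hζ h.δ_pos hr) hx
  exact ⟨h1.congr_of_eventuallyEq he, fun v => by rw [he.fderiv_eq, h2 v]⟩

lemma contDiffOn_initialOrder (h : IsInterface Ω Ωp δ) (hζ : IsInitialCutoff ζ) :
    ContDiffOn ℝ ∞ (initialOrder a b c Ω Ωp δ ζ ε) Ω :=
  fun _ hx => (contDiffAt_initialOrder h hζ hx).1.contDiffWithinAt

/-- The eikonal equation is available only in the tube; outside it the derivative of the layer
vanishes, so the product identity holds throughout `Ω`. -/
lemma deriv_layerProfile_mul_eikonal (h : IsInterface Ω Ωp δ) (hζ : IsInitialCutoff ζ)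
    {x : Vec3} (hx : x ∈ Ω) :
    deriv (layerProfile a b c δ ζ ε) (sdist Ω Ωp x) *
      ∑ k, fderiv ℝ (sdist Ω Ωp) x (EuclideanSpace.single k 1) ^ 2 =
    deriv (layerProfile a b c δ ζ ε) (sdist Ω Ωp x) := by
  by_cases hd : δ < |sdist Ω Ωp x|
  · rw [(eventually_layerProfile_const hζ h.δ_pos hd).deriv_eq]
    simp
  · rw [h.sum_fderiv_sdist_sq, mul_one]
    rw [h.mem_tube_iff hx]
    linarith [h.δ_pos]

lemma sum_fderiv_initialOrder_sq (h : IsInterface Ω Ωp δ) (hζ : IsInitialCutoff ζ)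
    {x : Vec3} (hx : x ∈ Ω) :
    ∑ k, fderiv ℝ (initialOrder a b c Ω Ωp δ ζ ε) x (EuclideanSpace.single k 1) ^ 2 =
      deriv (layerProfile a b c δ ζ ε) (sdist Ω Ωp x) ^ 2 := by
  simp only [(contDiffAt_initialOrder h hζ hx).2, mul_pow]
  rw [← Finset.mul_sum, pow_two, mul_assoc, deriv_layerProfile_mul_eikonal h hζ hx]

lemma sum_calibration_mul_fderiv (h : IsInterface Ω Ωp δ) (hζ : IsInitialCutoff ζ)
    {x : Vec3} (hx : x ∈ Ω) :
    ∑ k, calibration Ω Ωp δ φ x k *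
        fderiv ℝ (initialOrder a b c Ω Ωp δ ζ ε) x (EuclideanSpace.single k 1) =
      -(φ (sdist Ω Ωp x / δ) * deriv (layerProfile a b c δ ζ ε) (sdist Ω Ωp x)) := by
  rw [← deriv_layerProfile_mul_eikonal h hζ hx, Finset.mul_sum, Finset.mul_sum,
    ← Finset.sum_neg_distrib]
  refine Finset.sum_congr rfl fun k _ => ?_
  rw [calibration_apply, (contDiffAt_initialOrder h hζ hx).2]
  ring

/-- The bound may depend on `ε`; it is needed only for membership in `H¹`. -/
lemma exists_bound_fderiv_initialOrder (h : IsInterface Ω Ωp δ) (hζ : IsInitialCutoff ζ) :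
    ∃ B, ∀ x ∈ Ω, ∀ k : Fin 3,
      |fderiv ℝ (initialOrder a b c Ω Ωp δ ζ ε) x (EuclideanSpace.single k 1)| ≤ B := by
  have hcs : HasCompactSupport (deriv (layerProfile a b c δ ζ ε)) := by
    refine HasCompactSupport.of_support_subset_isCompact (isCompact_Icc (a := -δ) (b := δ))
      fun r hr => ?_
    rw [mem_Icc, ← abs_le]
    by_contra! hlt
    refine hr ?_
    rw [(eventually_layerProfile_const hζ h.δ_pos hlt).deriv_eq]
    simp
  obtain ⟨B, hB⟩ := ((contDiff_layerProfile (a := a) (b := b) (c := c) (ε := ε) hζ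
    h.δ_pos).continuous_deriv (by simp)).bounded_above_of_compact_support hcs
  refine ⟨B, fun x hx k => ?_⟩
  refine le_trans ?_ (hB (sdist Ω Ωp x))
  rw [Real.norm_eq_abs, ← sq_le_sq, ← sum_fderiv_initialOrder_sq h hζ hx]
  exact Finset.single_le_sum (f := fun k => fderiv ℝ (initialOrder a b c Ω Ωp δ ζ ε) x
    (EuclideanSpace.single k 1) ^ 2) (fun _ _ => sq_nonneg _) (Finset.mem_univ k)

lemma IsInterface.volume_ne_top (h : IsInterface Ω Ωp δ) : volume Ω ≠ ⊤ :=
  h.bounded.measure_lt_top.ne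

lemma isWeakGradient_initialDatum (h : IsInterface Ω Ωp δ) (hζ : IsInitialCutoff ζ)
    {u₀ : Vec3 → S2} {G : Fin 3 → Vec3 → QTensor}
    (hG : IsWeakGradient Ω (fun x => director (u₀ x)) G) :
    IsWeakGradient Ω (initialDatum a b c Ω Ωp δ ζ ε u₀)
      (fun k x => fderiv ℝ (initialOrder a b c Ω Ωp δ ζ ε) x (EuclideanSpace.single k 1) •
        director (u₀ x) + initialOrder a b c Ω Ωp δ ζ ε x • G k x) :=
  hG.smul h.isOpen (contDiffOn_initialOrder h hζ)

lemma aestronglyMeasurable_initialDatum (h : IsInterface Ω Ωp δ) (hζ : IsInitialCutoff ζ)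
    {u₀ : Vec3 → S2}
    (hu : AEStronglyMeasurable (fun x => director (u₀ x)) (volume.restrict Ω)) :
    AEStronglyMeasurable (initialDatum a b c Ω Ωp δ ζ ε u₀) (volume.restrict Ω) :=
  ((contDiffOn_initialOrder h hζ).continuousOn.aestronglyMeasurable
    h.isOpen.measurableSet).smul hu

lemma IsWeakGradient.aestronglyMeasurable {E : Type*} [NormedAddCommGroup E] [NormedSpace ℝ E]
    {w : Vec3 → E} {G : Fin 3 → Vec3 → E} (hw : IsWeakGradient Ω w G) :
    AEStronglyMeasurable w (volume.restrict Ω) :=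
  hw.locInt.aestronglyMeasurable

lemma memH1_initialDatum (h : IsInterface Ω Ωp δ) (hp : 0 < sPlus a b c) (hζ : IsInitialCutoff ζ)
    {u₀ : Vec3 → S2} {G : Fin 3 → Vec3 → QTensor}
    (hG : IsWeakGradient Ω (fun x => director (u₀ x)) G)
    (hG2 : ∀ k, MemLp (G k) 2 (volume.restrict Ω)) :
    MemH1 Ω (initialDatum a b c Ω Ωp δ ζ ε u₀) ∧
      MemLp (initialDatum a b c Ω Ωp δ ζ ε u₀) ⊤ (volume.restrict Ω) := by
  have : IsFiniteMeasure (volume.restrict Ω) := ⟨by simpa using h.volume_ne_top.lt_top⟩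
  have hm := aestronglyMeasurable_initialDatum (a := a) (b := b) (c := c) (ε := ε) h hζ
    hG.aestronglyMeasurable
  have hb := norm_initialDatum_le (Ω := Ω) (Ωp := Ωp) (δ := δ) (ε := ε) hp hζ u₀
  refine ⟨⟨MemLp.of_bound hm _ (Eventually.of_forall hb), _,
    isWeakGradient_initialDatum h hζ hG, fun k => ?_⟩,
    MemLp.of_bound hm _ (Eventually.of_forall hb)⟩
  obtain ⟨B, hB⟩ := exists_bound_fderiv_initialOrder (a := a) (b := b) (c := c) (ε := ε) h hζ
  have hc := contDiffOn_initialOrder (a := a) (b := b) (c := c) (ε := ε) h hζ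
  refine MemLp.add (MemLp.of_bound (((continuousOn_fderiv_apply h.isOpen hc
    _).aestronglyMeasurable h.isOpen.measurableSet).smul hG.aestronglyMeasurable) B ?_)
    (((hG2 k).norm.const_mul (sPlus a b c)).mono
      ((hc.continuousOn.aestronglyMeasurable h.isOpen.measurableSet).smul
        (hG2 k).aestronglyMeasurable) (Eventually.of_forall fun x => ?_))
  · rw [ae_restrict_iff' h.isOpen.measurableSet]
    refine Eventually.of_forall fun x hx => ?_
    rw [norm_smul]
    exact (mul_le_of_le_one_right (norm_nonneg _) (norm_director_le _)).trans (hB x hx k)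
  · have hs := initialOrder_mem (Ω := Ω) (Ωp := Ωp) (δ := δ) (ε := ε) hp hζ x
    rw [norm_smul, Real.norm_of_nonneg hs.1, Real.norm_of_nonneg (by positivity)]
    exact mul_le_mul_of_nonneg_right hs.2 (norm_nonneg _)

lemma initialDatum_inner (h : IsInterface Ω Ωp δ) (hζ : IsInitialCutoff ζ) (u₀ : Vec3 → S2) :
    (∀ x ∈ Ωp \ tube Ω Ωp δ,
      initialDatum a b c Ω Ωp δ ζ ε u₀ x = sPlus a b c • director (u₀ x)) ∧
    (∀ x ∈ tube Ω Ωp (δ / 2), initialDatum a b c Ω Ωp δ ζ ε u₀ x =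
      profile a b c (sdist Ω Ωp x / ε) • director (u₀ x)) ∧
    (∀ x ∈ outerPhase Ω Ωp \ tube Ω Ωp δ, initialDatum a b c Ω Ωp δ ζ ε u₀ x = 0) := by
  have hδ := h.δ_pos
  have hz : ∀ x ∈ Ω, x ∉ tube Ω Ωp δ → ζ (sdist Ω Ωp x / δ) = 0 := fun x hx hxt => by
    refine hζ.zero _ ?_
    rw [h.mem_tube_iff hx, not_lt] at hxt
    rwa [abs_div, abs_of_pos hδ, le_div_iff₀ hδ, one_mul]
  refine ⟨fun x hx => ?_, fun x hx => ?_, fun x hx => ?_⟩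
  · rw [initialDatum, initialOrder, hz x (h.plus_subset hx.1) hx.2, indicator_of_mem hx.1]
    simp
  · have h1 : |sdist Ω Ωp x / δ| ≤ 1 / 2 := by
      have := (h.mem_tube_iff hx.1 _).mp hx
      rw [abs_div, abs_of_pos hδ, div_le_iff₀ hδ]
      linarith
    rw [initialDatum, initialOrder, hζ.one _ h1]
    simp
  · have hxp : x ∉ Ωp := fun hp => hx.1.2 (subset_closure hp)
    rw [initialDatum, initialOrder, hz x hx.1.1 hx.2, indicator_of_notMem hxp]
    simp

end InitialDatum

/-! ### The energy estimate -/

section Energy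

variable {a b c δ ε : ℝ} {Ω Ωp : Set Vec3} {ζ φ : ℝ → ℝ}

lemma integrable_sum_test_mul {X : Fin 3 → Vec3 → ℝ} (hX : ∀ k, ContDiff ℝ ∞ (X k))
    (hXc : ∀ k, HasCompactSupport (X k)) (hXs : ∀ k, tsupport (X k) ⊆ Ω) {w : Vec3 → ℝ}
    {G : Fin 3 → Vec3 → ℝ} (hG : IsWeakGradient Ω w G) :
    (∀ k, Integrable fun x => X k x * G k x) ∧
    ∫ x in Ω, ∑ k, X k x * G k x =
      -∑ k, ∫ x in Ω, fderiv ℝ (X k) x (EuclideanSpace.single k 1) * w x := by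
  have hi : ∀ k, Integrable fun x => X k x * G k x := fun k =>
    integrable_smul_of_tsupport_subset (hG.locInt_grad k) (hX k).continuous.continuousOn (hXc k)
      (hXs k) fun x hx => image_eq_zero_of_notMem_tsupport hx
  refine ⟨hi, ?_⟩
  rw [integral_finsetSum _ fun k _ => (hi k).integrableOn, ← Finset.sum_neg_distrib]
  refine Finset.sum_congr rfl fun k _ => ?_
  have := hG.byParts k (X k) (hX k) (hXc k) (hXs k)
  simp only [smul_eq_mul] at this
  rw [this, neg_neg]

/-- Replacing the potential by a uniformly close one in a calibrated flux. -/
lemma neg_integral_flux_le (hΩ : IsOpen Ω) {X : Fin 3 → Vec3 → ℝ} (hX : ∀ k, ContDiff ℝ ∞ (X k))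
    (hXc : ∀ k, HasCompactSupport (X k)) (hXs : ∀ k, tsupport (X k) ⊆ Ω) {w w' : Vec3 → ℝ}
    {G G' : Fin 3 → Vec3 → ℝ} (hG : IsWeakGradient Ω w G) (hG' : IsWeakGradient Ω w' G') {β : ℝ}
    (hβ : ∀ x, |w x - w' x| ≤ β) :
    -∫ x in Ω, ∑ k, X k x * G k x ≤ (-∫ x in Ω, ∑ k, X k x * G' k x) +
      (∑ k, ∫ x in Ω, |fderiv ℝ (X k) x (EuclideanSpace.single k 1)|) * β := by
  rw [(integrable_sum_test_mul hX hXc hXs hG).2, (integrable_sum_test_mul hX hXc hXs hG').2,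
    neg_neg, neg_neg, Finset.sum_mul, ← Finset.sum_add_distrib]
  refine Finset.sum_le_sum fun k _ => ?_
  set v : Vec3 := EuclideanSpace.single k 1
  have hcd : Continuous fun x => fderiv ℝ (X k) x v :=
    ((hX k).continuous_fderiv (by simp)).clm_apply continuous_const
  have hi : ∀ {f : Vec3 → ℝ}, LocallyIntegrableOn f Ω →
      Integrable fun x => fderiv ℝ (X k) x v * f x := fun hf =>
    integrable_smul_of_tsupport_subset hf hcd.continuousOn (hXc k) (hXs k)
      fun x hx => by rw [fderiv_of_notMem_tsupport ℝ hx]; simp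
  have h0 : Integrable fun x => |fderiv ℝ (X k) x v| :=
    (hcd.integrable_of_hasCompactSupport ((hXc k).fderiv_apply (𝕜 := ℝ) v)).abs
  rw [← integral_mul_const, ← integral_add (hi hG'.locInt).integrableOn
    (h0.mul_const β).integrableOn]
  refine setIntegral_mono_on (hi hG.locInt).integrableOn
    ((hi hG'.locInt).add (h0.mul_const β)).integrableOn hΩ.measurableSet fun x _ => ?_
  have h1 := le_abs_self (fderiv ℝ (X k) x v * (w x - w' x))
  rw [abs_mul] at h1
  have h2 := mul_le_mul_of_nonneg_left (hβ x) (abs_nonneg (fderiv ℝ (X k) x v))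
  linarith

lemma norm_sq_smul_add_smul {E : Type*} [NormedAddCommGroup E] [InnerProductSpace ℝ E] {D g : E}
    (hD : ‖D‖ ^ 2 = 2 / 3) (h : inner ℝ D g = 0) (s t : ℝ) :
    ‖s • D + t • g‖ ^ 2 = 2 / 3 * s ^ 2 + t ^ 2 * ‖g‖ ^ 2 := by
  rw [norm_add_sq_real, real_inner_smul_left, real_inner_smul_right, h, norm_smul, norm_smul,
    mul_pow, mul_pow, hD, Real.norm_eq_abs, Real.norm_eq_abs, sq_abs, sq_abs]
  ring

/-- The unmollified potential of the initial datum. -/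
lemma quasiDist_initialDatum (hb : 0 < b) (hc : 0 < c) (habc : b ^ 2 = 27 * a * c)
    (hζ : IsInitialCutoff ζ) (u₀ : Vec3 → S2) (x : Vec3) :
    quasiDist a b c (initialDatum a b c Ω Ωp δ ζ ε u₀ x) =
      wellPrimitive a b c (sPlus a b c) -
        wellPrimitive a b c (initialOrder a b c Ω Ωp δ ζ ε x) := by
  have h := initialOrder_mem (Ω := Ω) (Ωp := Ωp) (δ := δ) (ε := ε)
    (sPlus_pos hb hc habc) hζ x
  exact quasiDist_smul_director hb hc habc h.1 h.2 _

lemma contDiff_wellPrimitive : ContDiff ℝ ∞ (wellPrimitive a b c) := by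
  unfold wellPrimitive
  fun_prop

/-- The quasi-distance is only shown to be locally Lipschitz, but along the datum it is a polynomial
in the smooth order parameter, so its gradient is classical even though `u₀` is merely `H¹`. -/
lemma isWeakGradient_quasiDist_initialDatum (h : IsInterface Ω Ωp δ) (hb : 0 < b) (hc : 0 < c)
    (habc : b ^ 2 = 27 * a * c) (hζ : IsInitialCutoff ζ) (u₀ : Vec3 → S2) :
    IsWeakGradient Ω (fun x => quasiDist a b c (initialDatum a b c Ω Ωp δ ζ ε u₀ x))
      (fun k x => fderiv ℝ (fun x => wellPrimitive a b c (sPlus a b c) -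
        wellPrimitive a b c (initialOrder a b c Ω Ωp δ ζ ε x)) x (EuclideanSpace.single k 1)) := by
  simp only [quasiDist_initialDatum hb hc habc hζ]
  exact isWeakGradient_of_contDiffOn h.isOpen (contDiffOn_const.sub
    (contDiff_wellPrimitive.comp_contDiffOn (contDiffOn_initialOrder h hζ)))

lemma fderiv_wellPrimitive_initialOrder (h : IsInterface Ω Ωp δ) (hζ : IsInitialCutoff ζ)
    {x : Vec3} (hx : x ∈ Ω) (v : Vec3) :
    fderiv ℝ (fun x => wellPrimitive a b c (sPlus a b c) -
      wellPrimitive a b c (initialOrder a b c Ω Ωp δ ζ ε x)) x v =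
    -(2 / √3 * uniaxialRoot a b c (initialOrder a b c Ω Ωp δ ζ ε x)) *
      fderiv ℝ (initialOrder a b c Ω Ωp δ ζ ε) x v := by
  have h1 := ((contDiffAt_initialOrder (a := a) (b := b) (c := c) (ε := ε) h hζ
    hx).1.differentiableAt (by simp)).hasFDerivAt
  have h2 := ((hasDerivAt_wellPrimitive (a := a) (b := b) (c := c)
    (initialOrder a b c Ω Ωp δ ζ ε x)).comp_hasFDerivAt x h1).const_sub
      (wellPrimitive a b c (sPlus a b c))
  have h3 := h2.fderiv
  simp only [Function.comp_def] at h3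
  rw [h3]
  simp

/-- Pointwise estimate of the calibrated energy density of the initial datum. -/
lemma calibrated_density_initialDatum_le (h : IsInterface Ω Ωp δ) (hb : 0 < b) (hc : 0 < c)
    (habc : b ^ 2 = 27 * a * c) (hζ : IsInitialCutoff ζ) (hε : 0 < ε) (hε1 : ε ≤ 1)
    {C B : ℝ} (hC : ∀ r, ε / 3 * deriv (layerProfile a b c δ ζ ε) r ^ 2 +
        1 / ε * uniaxialRoot a b c (layerProfile a b c δ ζ ε r) ^ 2 -
        φ (r / δ) * (2 / √3 * uniaxialRoot a b c (layerProfile a b c δ ζ ε r) *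
          deriv (layerProfile a b c δ ζ ε) r) ≤ C * ε)
    {u₀ : Vec3 → S2} {x : Vec3} (hx : x ∈ Ω) {g : Fin 3 → QTensor} {U : Fin 3 → Vec3}
    (horth : ∀ k, inner ℝ (director (u₀ x)) (g k) = 0) (hg : ∀ k, ‖g k‖ ≤ B * ‖U k‖) :
    ε / 2 * ∑ k, ‖fderiv ℝ (initialOrder a b c Ω Ωp δ ζ ε) x (EuclideanSpace.single k 1) •
        director (u₀ x) + initialOrder a b c Ω Ωp δ ζ ε x • g k‖ ^ 2 +
      1 / ε * bulkEnergyReg a b c ε (initialDatum a b c Ω Ωp δ ζ ε u₀ x) -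
      ∑ k, calibration Ω Ωp δ φ x k * fderiv ℝ (fun x => wellPrimitive a b c (sPlus a b c) -
        wellPrimitive a b c (initialOrder a b c Ω Ωp δ ζ ε x)) x (EuclideanSpace.single k 1) ≤
    (C + 1) * ε + ε / 2 * (sPlus a b c ^ 2 * B ^ 2) * ∑ k, ‖U k‖ ^ 2 := by
  have hp := sPlus_pos hb hc habc
  have hs := initialOrder_mem (Ω := Ω) (Ωp := Ωp) (δ := δ) (ε := ε) hp hζ x
  have hCx := hC (sdist Ω Ωp x)
  rw [← initialOrder_eq h hx] at hCx
  simp only [norm_sq_smul_add_smul (norm_sq_director _) (horth _),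
    fderiv_wellPrimitive_initialOrder h hζ hx]
  rw [Finset.sum_add_distrib, ← Finset.mul_sum, ← Finset.mul_sum,
    sum_fderiv_initialOrder_sq h hζ hx, bulkEnergyReg, initialDatum, bulkEnergy_smul_director,
    uniaxialEnergy_eq hb hc habc]
  have e3 : ∑ k, calibration Ω Ωp δ φ x k *
      (-(2 / √3 * uniaxialRoot a b c (initialOrder a b c Ω Ωp δ ζ ε x)) *
        fderiv ℝ (initialOrder a b c Ω Ωp δ ζ ε) x (EuclideanSpace.single k 1)) =
      φ (sdist Ω Ωp x / δ) * (2 / √3 * uniaxialRoot a b c (initialOrder a b c Ω Ωp δ ζ ε x) *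
          deriv (layerProfile a b c δ ζ ε) (sdist Ω Ωp x)) := by
    have := sum_calibration_mul_fderiv (a := a) (b := b) (c := c) (ε := ε) (φ := φ) h hζ hx
    calc _ = -(2 / √3 * uniaxialRoot a b c (initialOrder a b c Ω Ωp δ ζ ε x)) *
          ∑ k, calibration Ω Ωp δ φ x k *
            fderiv ℝ (initialOrder a b c Ω Ωp δ ζ ε) x (EuclideanSpace.single k 1) := by
          rw [Finset.mul_sum]
          exact Finset.sum_congr rfl fun k _ => by ring
      _ = _ := by rw [this]; ring
  rw [e3]
  have e2 : ∑ k, ‖g k‖ ^ 2 ≤ B ^ 2 * ∑ k, ‖U k‖ ^ 2 := by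
    rw [Finset.mul_sum]
    refine Finset.sum_le_sum fun k _ => ?_
    rw [← mul_pow]
    exact pow_le_pow_left₀ (norm_nonneg _) (hg k) 2
  have e1 : initialOrder a b c Ω Ωp δ ζ ε x ^ 2 * ∑ k, ‖g k‖ ^ 2 ≤
      sPlus a b c ^ 2 * (B ^ 2 * ∑ k, ‖U k‖ ^ 2) := by
    refine mul_le_mul (pow_le_pow_left₀ hs.1 hs.2 2) e2
      (Finset.sum_nonneg fun _ _ => sq_nonneg _) (sq_nonneg _)
  -- The regularisation of the bulk energy accounts for the `1` in `C + 1`.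
  have e4 : 1 / ε * ε ^ 3 ≤ ε := by
    rw [show 1 / ε * ε ^ 3 = ε * ε by field_simp]
    exact mul_le_of_le_one_left hε.le hε1
  have e5 := mul_le_mul_of_nonneg_left e1 (by positivity : 0 ≤ ε / 2)
  rw [mul_add (1 / ε)]
  linarith

lemma measurable_truncation : Measurable (truncation δ) := by
  unfold truncation
  exact Measurable.ite measurableSet_Ici measurable_const
    (Measurable.ite measurableSet_Iic measurable_const measurable_neg)

/-- The bulk error density of a field whose potential is close to that of the layer. -/
lemma abs_bulkErrorDensity_le (h : IsInterface Ω Ωp δ) (hb : 0 < b) (hc : 0 < c)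
    (habc : b ^ 2 = 27 * a * c) (hζ : IsInitialCutoff ζ) {C β : ℝ} (hβ0 : 0 ≤ β)
    (hC : ∀ r, |(wellPrimitive a b c (sPlus a b c) * (if r < 0 then 1 else 0) -
        (wellPrimitive a b c (sPlus a b c) -
          wellPrimitive a b c (layerProfile a b c δ ζ ε r))) * truncation δ r| ≤ C)
    {η : QTensor → ℝ} {u₀ : Vec3 → S2} {x : Vec3} (hx : x ∈ Ω)
    (hβ : |psi a b c η ε (initialDatum a b c Ω Ωp δ ζ ε u₀) x -
      quasiDist a b c (initialDatum a b c Ω Ωp δ ζ ε u₀ x)| ≤ β) :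
    |bulkErrorDensity a b c Ω Ωp δ η ε (initialDatum a b c Ω Ωp δ ζ ε u₀) x| ≤ C + β * δ := by
  have hCx := hC (sdist Ω Ωp x)
  rw [← initialOrder_eq h hx, ← quasiDist_initialDatum hb hc habc hζ u₀,
    ← surfaceTension_eq hb hc habc] at hCx
  have hind : (if sdist Ω Ωp x < 0 then (1 : ℝ) else 0) = (outerPhase Ω Ωp).indicator 1 x := by
    by_cases ho : x ∈ outerPhase Ω Ωp
    · rw [if_pos ((h.mem_outer_iff hx).mp ho), indicator_of_mem ho, Pi.one_apply]
    · rw [if_neg fun hn => ho ((h.mem_outer_iff hx).mpr hn), indicator_of_notMem ho]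
  rw [hind] at hCx
  have ht := (abs_truncation_le h.δ_pos (sdist Ω Ωp x)).1
  rw [bulkErrorDensity]
  have e : ∀ A P q t : ℝ, (A - P) * t = (A - q) * t - (P - q) * t := fun A P q t => by ring
  -- The unmollified potential is inserted: one part is the layer estimate, the other the
  -- mollification error times `|ϑ| ≤ δ`.
  rw [e _ _ (quasiDist a b c (initialDatum a b c Ω Ωp δ ζ ε u₀ x)) _]
  refine (abs_sub _ _).trans (add_le_add hCx ?_)
  rw [abs_mul]
  exact mul_le_mul hβ ht (abs_nonneg _) hβ0

end Energy

/-! ### The energies of the initial datum -/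

section Assembly

variable {a b c δ ε β C B : ℝ} {Ω Ωp : Set Vec3} {ζ φ : ℝ → ℝ} {η : QTensor → ℝ} {u₀ : Vec3 → S2}
  {Q : Vec3 → QTensor}

lemma integrable_dirichlet {E : Type*} [NormedAddCommGroup E] [NormedSpace ℝ E] [CompleteSpace E]
    (hΩ : IsOpen Ω) {w : Vec3 → E} (hw : MemH1 Ω w) :
    IntegrableOn (fun x => ∑ k, ‖weakGrad Ω w k x‖ ^ 2) Ω :=
  integrable_finsetSum _ fun k _ =>
    (memLp_two_iff_integrable_sq_norm (hw.memLp_weakGrad hΩ k).aestronglyMeasurable).mp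
      (hw.memLp_weakGrad hΩ k)

lemma integral_dirichlet_le {E : Type*} [NormedAddCommGroup E] [NormedSpace ℝ E]
    {w : Vec3 → E} {M : ℝ} (hM : h1Norm Ω w ≤ M) :
    ∫ x in Ω, ∑ k, ‖weakGrad Ω w k x‖ ^ 2 ≤ M ^ 2 := by
  have h := (Real.sqrt_le_iff.mp hM).2
  have h0 : 0 ≤ ∫ x in Ω, ‖w x‖ ^ 2 := integral_nonneg fun x => by positivity
  linarith

lemma integrable_bulkEnergyReg (hfin : volume Ω ≠ ⊤)
    (hm : AEStronglyMeasurable Q (volume.restrict Ω)) {R : ℝ} (hR : ∀ x, ‖Q x‖ ≤ R) :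
    IntegrableOn (fun x => bulkEnergyReg a b c ε (Q x)) Ω := by
  have : IsFiniteMeasure (volume.restrict Ω) := ⟨by simpa using hfin.lt_top⟩
  have hcont : Continuous (bulkEnergyReg a b c ε) := (continuous_bulkEnergy _ _ _).add continuous_const
  obtain ⟨A, hA⟩ := (isCompact_closedBall (0 : QTensor) R).exists_bound_of_continuousOn
    hcont.continuousOn
  exact Integrable.of_bound (hcont.comp_aestronglyMeasurable hm) A
    (Eventually.of_forall fun x => hA _ (by simpa using hR x))

lemma sum_indicator_calibration_mul {x : Vec3} (hx : x ∈ Ω) (g : Fin 3 → ℝ) :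
    ∑ k, (Ω.indicator fun x => calibration Ω Ωp δ φ x k) x * g k =
      ∑ k, calibration Ω Ωp δ φ x k * g k := by
  simp only [indicator_of_mem hx]

lemma integrable_calibration_flux (h : IsInterface Ω Ωp δ) (hφ : IsCalibrationCutoff φ)
    {w : Vec3 → ℝ} {G : Fin 3 → Vec3 → ℝ} (hG : IsWeakGradient Ω w G) :
    IntegrableOn (fun x => ∑ k, calibration Ω Ωp δ φ x k * G k x) Ω := by
  refine IntegrableOn.congr_fun (f := fun x => ∑ k,
    (Ω.indicator fun x => calibration Ω Ωp δ φ x k) x * G k x) ?_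
    (fun x hx => sum_indicator_calibration_mul hx _) h.isOpen.measurableSet
  exact integrable_finsetSum _ fun k _ => ((integrable_sum_test_mul
    (fun k => (calibration_test h hφ k).1) (fun k => (calibration_test h hφ k).2.1)
    (fun k => (calibration_test h hφ k).2.2) hG).1 k).integrableOn

lemma neg_integral_calibration_flux_le (h : IsInterface Ω Ωp δ) (hφ : IsCalibrationCutoff φ)
    {w w' : Vec3 → ℝ} {G G' : Fin 3 → Vec3 → ℝ} (hG : IsWeakGradient Ω w G)
    (hG' : IsWeakGradient Ω w' G') (hβ : ∀ x, |w x - w' x| ≤ β) :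
    -∫ x in Ω, ∑ k, calibration Ω Ωp δ φ x k * G k x ≤
      (-∫ x in Ω, ∑ k, calibration Ω Ωp δ φ x k * G' k x) +
      (∑ k, ∫ x in Ω, |fderiv ℝ (Ω.indicator fun x => calibration Ω Ωp δ φ x k) x
        (EuclideanSpace.single k 1)|) * β := by
  have e : ∀ g : Fin 3 → Vec3 → ℝ, ∫ x in Ω, ∑ k, calibration Ω Ωp δ φ x k * g k x =
      ∫ x in Ω, ∑ k, (Ω.indicator fun x => calibration Ω Ωp δ φ x k) x * g k x := fun g =>
    setIntegral_congr_fun h.isOpen.measurableSet fun x hx =>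
      (sum_indicator_calibration_mul hx _).symm
  rw [e, e]
  exact neg_integral_flux_le h.isOpen (fun k => (calibration_test h hφ k).1)
    (fun k => (calibration_test h hφ k).2.1) (fun k => (calibration_test h hφ k).2.2) hG hG' hβ

lemma integrable_relativeDensity (h : IsInterface Ω Ωp δ) (hφ : IsCalibrationCutoff φ)
    (hQ : MemH1 Ω Q) {R : ℝ} (hR : ∀ x, ‖Q x‖ ≤ R) (hψ : MemH1 Ω (psi a b c η ε Q)) :
    IntegrableOn (relativeDensity a b c Ω Ωp δ φ η ε Q) Ω :=
  (((integrable_dirichlet h.isOpen hQ).const_mul _).add ((integrable_bulkEnergyReg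
    h.volume_ne_top hQ.1.aestronglyMeasurable hR).const_mul _)).sub
    (integrable_calibration_flux h hφ hψ.isWeakGradient_weakGrad)

/-- The energy of the initial datum relative to the calibration. -/
lemma integral_relativeDensity_initialDatum_le (h : IsInterface Ω Ωp δ) (hb : 0 < b) (hc : 0 < c)
    (habc : b ^ 2 = 27 * a * c) (hζ : IsInitialCutoff ζ) (hφ : IsCalibrationCutoff φ)
    (hε : 0 < ε) (hε1 : ε ≤ 1)
    (hC : ∀ r, ε / 3 * deriv (layerProfile a b c δ ζ ε) r ^ 2 +
        1 / ε * uniaxialRoot a b c (layerProfile a b c δ ζ ε r) ^ 2 -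
        φ (r / δ) * (2 / √3 * uniaxialRoot a b c (layerProfile a b c δ ζ ε r) *
          deriv (layerProfile a b c δ ζ ε) r) ≤ C * ε)
    (hu : MemH1 Ω (fun x => (u₀ x : Vec3))) {G : Fin 3 → Vec3 → QTensor}
    (hG : IsWeakGradient Ω (fun x => director (u₀ x)) G)
    (hGB : ∀ k x, ‖G k x‖ ≤ B * ‖weakGrad Ω (fun x => (u₀ x : Vec3)) k x‖)
    (horth : ∀ k, ∀ᵐ x ∂volume.restrict Ω, inner ℝ (director (u₀ x)) (G k x) = 0)
    (hQ : MemH1 Ω (initialDatum a b c Ω Ωp δ ζ ε u₀))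
    (hψ : MemH1 Ω (psi a b c η ε (initialDatum a b c Ω Ωp δ ζ ε u₀)))
    (hβ : ∀ x, |psi a b c η ε (initialDatum a b c Ω Ωp δ ζ ε u₀) x -
      quasiDist a b c (initialDatum a b c Ω Ωp δ ζ ε u₀ x)| ≤ β) :
    ∫ x in Ω, relativeDensity a b c Ω Ωp δ φ η ε (initialDatum a b c Ω Ωp δ ζ ε u₀) x ≤
      (C + 1) * ε * volume.real Ω + ε / 2 * (sPlus a b c ^ 2 * B ^ 2) *
        (∫ x in Ω, ∑ k, ‖weakGrad Ω (fun x => (u₀ x : Vec3)) k x‖ ^ 2) +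
      (∑ k, ∫ x in Ω, |fderiv ℝ (Ω.indicator fun x => calibration Ω Ωp δ φ x k) x
        (EuclideanSpace.single k 1)|) * β := by
  have : IsFiniteMeasure (volume.restrict Ω) := ⟨by simpa using h.volume_ne_top.lt_top⟩
  have hp := sPlus_pos hb hc habc
  have hR := norm_initialDatum_le (Ω := Ω) (Ωp := Ωp) (δ := δ) (ε := ε) hp hζ u₀
  have hψ0 := isWeakGradient_quasiDist_initialDatum (ε := ε) h hb hc habc hζ u₀
  have i1 : IntegrableOn (fun x => ε / 2 * ∑ k,
      ‖weakGrad Ω (initialDatum a b c Ω Ωp δ ζ ε u₀) k x‖ ^ 2 + 1 / ε *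
        bulkEnergyReg a b c ε (initialDatum a b c Ω Ωp δ ζ ε u₀ x)) Ω :=
    ((integrable_dirichlet h.isOpen hQ).const_mul _).add ((integrable_bulkEnergyReg
      h.volume_ne_top hQ.1.aestronglyMeasurable hR).const_mul _)
  have i2 := integrable_calibration_flux h hφ hψ.isWeakGradient_weakGrad
  have i3 := integrable_calibration_flux h hφ hψ0
  have i4 := integrable_dirichlet h.isOpen hu
  have hflux := neg_integral_calibration_flux_le h hφ hψ.isWeakGradient_weakGrad hψ0 hβ
  -- The pointwise estimate is used with the unmollified flux; `hflux` accounts for the exchange.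
  have hmain : ∫ x in Ω, ((ε / 2 * ∑ k,
      ‖weakGrad Ω (initialDatum a b c Ω Ωp δ ζ ε u₀) k x‖ ^ 2 + 1 / ε *
        bulkEnergyReg a b c ε (initialDatum a b c Ω Ωp δ ζ ε u₀ x)) -
      ∑ k, calibration Ω Ωp δ φ x k * fderiv ℝ (fun x => wellPrimitive a b c (sPlus a b c) -
        wellPrimitive a b c (initialOrder a b c Ω Ωp δ ζ ε x)) x (EuclideanSpace.single k 1)) ≤
      ∫ x in Ω, ((C + 1) * ε + ε / 2 * (sPlus a b c ^ 2 * B ^ 2) *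
        ∑ k, ‖weakGrad Ω (fun x => (u₀ x : Vec3)) k x‖ ^ 2) := by
    refine integral_mono_ae (i1.sub i3) ((integrable_const _).add (i4.const_mul _)) ?_
    have hae : ∀ᵐ x ∂volume.restrict Ω, ∀ k,
        weakGrad Ω (initialDatum a b c Ω Ωp δ ζ ε u₀) k x =
        fderiv ℝ (initialOrder a b c Ω Ωp δ ζ ε) x (EuclideanSpace.single k 1) •
          director (u₀ x) + initialOrder a b c Ω Ωp δ ζ ε x • G k x :=
      ae_all_iff.mpr fun k => hQ.isWeakGradient_weakGrad.ae_eq h.isOpen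
        (isWeakGradient_initialDatum h hζ hG) k
    filter_upwards [hae, ae_all_iff.mpr horth, ae_restrict_mem h.isOpen.measurableSet]
      with x hx ho hxΩ
    simp only [hx]
    exact calibrated_density_initialDatum_le h hb hc habc hζ hε hε1 hC hxΩ ho fun k => hGB k x
  rw [integral_sub i1 i3, integral_add (integrable_const _) (i4.const_mul _), integral_const,
    measureReal_restrict_apply_univ, smul_eq_mul, integral_const_mul] at hmain
  have hsplit : ∫ x in Ω, relativeDensity a b c Ω Ωp δ φ η ε
      (initialDatum a b c Ω Ωp δ ζ ε u₀) x = _ := integral_sub i1 i2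
  rw [hsplit]
  linarith

lemma aestronglyMeasurable_bulkErrorDensity (h : IsInterface Ω Ωp δ)
    (hψ : AEStronglyMeasurable (psi a b c η ε Q) (volume.restrict Ω)) :
    AEStronglyMeasurable (bulkErrorDensity a b c Ω Ωp δ η ε Q) (volume.restrict Ω) := by
  have h1 : AEMeasurable (sdist Ω Ωp) (volume.restrict Ω) :=
    ContinuousOn.aemeasurable (fun x hx => (h.continuousAt_sdist hx).continuousWithinAt)
      h.isOpen.measurableSet
  refine AEStronglyMeasurable.mul (AEStronglyMeasurable.sub ?_ hψ)
    (measurable_truncation.comp_aemeasurable h1).aestronglyMeasurable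
  exact ((measurable_one.indicator
    h.isOpen_outer.measurableSet).const_mul _).aestronglyMeasurable

lemma integrable_of_abs_le {f : Vec3 → ℝ} (h : IsOpen Ω) (hfin : volume Ω ≠ ⊤)
    (hf : AEStronglyMeasurable f (volume.restrict Ω)) (hC : ∀ x ∈ Ω, |f x| ≤ C) :
    IntegrableOn f Ω ∧ ∫ x in Ω, f x ≤ C * volume.real Ω :=
  ⟨IntegrableOn.of_bound hfin.lt_top hf C ((ae_restrict_iff' h.measurableSet).mpr
    (Eventually.of_forall hC)),
    (Real.le_norm_self _).trans (norm_setIntegral_le_of_norm_le_const hfin.lt_top hC)⟩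

end Assembly

end BerisEdwards

theorem proposition2p9
    (a b c : ℝ) (ha : 0 < a) (hb : 0 < b) (hc : 0 < c) (habc : b ^ 2 = 27 * a * c)
    (Ω Ωp : Set Vec3) (δ : ℝ) (hΩ : IsInterface Ω Ωp δ)
    (φ ζ : ℝ → ℝ) (hφ : IsCalibrationCutoff φ) (hζ : IsInitialCutoff ζ) (M : ℝ) :
    ∃ C₀ : ℝ, 0 < C₀ ∧
      ∀ u₀ : Vec3 → S2, MemH1 Ω (fun x => (u₀ x : Vec3)) →
        h1Norm Ω (fun x => (u₀ x : Vec3)) ≤ M →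
      ∀ ε : ℝ, 0 < ε → ε ≤ 1 →
        MemH1 Ω (initialDatum a b c Ω Ωp δ ζ ε u₀) ∧
        MemLp (initialDatum a b c Ω Ωp δ ζ ε u₀) ⊤ (volume.restrict Ω) ∧
        (∀ x ∈ Ωp \ tube Ω Ωp δ,
          initialDatum a b c Ω Ωp δ ζ ε u₀ x = sPlus a b c • director (u₀ x)) ∧
        (∀ x ∈ tube Ω Ωp (δ / 2),
          initialDatum a b c Ω Ωp δ ζ ε u₀ x =
            profile a b c (sdist Ω Ωp x / ε) • director (u₀ x)) ∧
        (∀ x ∈ outerPhase Ω Ωp \ tube Ω Ωp δ, initialDatum a b c Ω Ωp δ ζ ε u₀ x = 0) ∧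
        ∀ η : QTensor → ℝ, IsIsotropicMollifier η →
          MemH1 Ω (psi a b c η ε (initialDatum a b c Ω Ωp δ ζ ε u₀)) ∧
          IntegrableOn
            (relativeDensity a b c Ω Ωp δ φ η ε (initialDatum a b c Ω Ωp δ ζ ε u₀)) Ω ∧
          IntegrableOn
            (bulkErrorDensity a b c Ω Ωp δ η ε (initialDatum a b c Ω Ωp δ ζ ε u₀)) Ω ∧
          ∀ v₀ε v₀ : Vec3 → Vec3, MemLp v₀ε 2 (volume.restrict Ω) →
            MemLp v₀ 2 (volume.restrict Ω) →
            ∀ K : ℝ, ∫ x in Ω, 1 / 2 * ‖v₀ε x - v₀ x‖ ^ 2 ≤ K * ε →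
              relativeEnergy a b c Ω Ωp δ φ η ε v₀ε v₀ (initialDatum a b c Ω Ωp δ ζ ε u₀)
                + bulkError a b c Ω Ωp δ η ε (initialDatum a b c Ω Ωp δ ζ ε u₀)
              ≤ (C₀ + K) * ε := by
  have hp := sPlus_pos hb hc habc
  have hδ := hΩ.δ_pos
  obtain ⟨CA, hCA0, hCA⟩ := exists_calibrated_density_le ha hb hc habc hζ hφ hδ
  obtain ⟨CV, hCV0, hCV⟩ := exists_bulk_density_le ha hb hc habc hζ hδ
  obtain ⟨B, -, hB⟩ := exists_director_gradient_bound
  obtain ⟨Bq, hBq0, hBq⟩ := exists_dist_quasiDistReg_le hb hc habc (sPlus a b c)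
  obtain ⟨D, hD⟩ : ∃ D, D = ∑ k, ∫ x in Ω, |fderiv ℝ (Ω.indicator fun x =>
    calibration Ω Ωp δ φ x k) x (EuclideanSpace.single k 1)| := ⟨_, rfl⟩
  have hD0 : 0 ≤ D := hD ▸ Finset.sum_nonneg fun k _ => integral_nonneg fun x => abs_nonneg _
  have hV : 0 ≤ volume.real Ω := measureReal_nonneg
  -- The terms are, in order, the calibrated layer density with the regularisation, the director
  -- gradient, the mollification error in the flux, and the bulk error with its own mollification
  -- error. The final `1` ensures strict positivity.
  refine ⟨(CA + 1) * volume.real Ω + sPlus a b c ^ 2 * B ^ 2 / 2 * M ^ 2 + D * Bq +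
    (CV + Bq * δ) * volume.real Ω + 1, by positivity, fun u₀ hu hM ε hε hε1 => ?_⟩
  obtain ⟨G, hG, hG2, hGB, horth⟩ := hB hΩ.isOpen hΩ.volume_ne_top u₀ hu
  obtain ⟨hQ, hQtop⟩ := memH1_initialDatum (ε := ε) hΩ hp hζ hG hG2
  obtain ⟨hin, hmid, hout⟩ := initialDatum_inner (a := a) (b := b) (c := c) (ε := ε) hΩ hζ u₀
  refine ⟨hQ, hQtop, hin, hmid, hout, fun η hη => ?_⟩
  have hR := norm_initialDatum_le (Ω := Ω) (Ωp := Ωp) (δ := δ) (ε := ε) hp hζ u₀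
  have hψ : MemH1 Ω (psi a b c η ε (initialDatum a b c Ω Ωp δ ζ ε u₀)) :=
    hQ.comp_of_bounded hΩ.isOpen hΩ.volume_ne_top hR (contDiff_quasiDistReg hb hc habc hη hε)
  have hβ : ∀ x, |psi a b c η ε (initialDatum a b c Ω Ωp δ ζ ε u₀) x -
      quasiDist a b c (initialDatum a b c Ω Ωp δ ζ ε u₀ x)| ≤ Bq * ε := fun x =>
    hBq η hη ε hε hε1 _ (by simpa using hR x)
  obtain ⟨hvi, hvol⟩ := integrable_of_abs_le hΩ.isOpen hΩ.volume_ne_top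
    (aestronglyMeasurable_bulkErrorDensity hΩ hψ.1.aestronglyMeasurable) fun x hx =>
      abs_bulkErrorDensity_le hΩ hb hc habc hζ (mul_nonneg hBq0 hε.le) (hCV ε hε) hx (hβ x)
  refine ⟨hψ, integrable_relativeDensity hΩ hφ hQ hR hψ, hvi, fun v₀ε v₀ _ _ K hK => ?_⟩
  have hE := integral_relativeDensity_initialDatum_le hΩ hb hc habc hζ hφ hε hε1
    (hCA ε hε hε1) hu hG hGB horth hQ hψ hβ
  rw [← hD] at hE
  have hU := mul_le_mul_of_nonneg_left (integral_dirichlet_le hM)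
    (by positivity : 0 ≤ ε / 2 * (sPlus a b c ^ 2 * B ^ 2))
  rw [relativeEnergy, bulkError]
  linarith
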